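/- Let $n\ge 3$ and let $(M^{n+1},g)$ be a smooth complete Riemannian manifold that is conformally compact: $M$ is the interior of a compact smooth manifold with boundary $\bar M$, and there is a smooth function $\rho:\bar M\to\mathbb R$ with $\rho>0$ on $M$, $\rho=0$ and $d\rho\ne 0$ on $\partial M$, such that $\rho^2 g$ extends to a $C^k$ Riemannian metric on $\bar M$ (for some $k\in\{0,1,\dots,\infty\}$). Suppose that $M$ has a pole $p$, i.e. $\exp_p:T_pM\to M$ is a diffeomorphism, and that $\mathrm{Ric}\ge -n\,g$. Let $t(x)=\mathrm{dist}_g(p,x)$, let $\Sigma_t$ be the level set of the distance function at the value $t>0$ (the hypersurface $\{\exp_p(t\theta): \theta\in T_pM, |\theta|=1\}$), let $R$ be the scalar curvature (the trace of the Ricci curvature) of $g$, and suppose that $$\frac{1}{\mathrm{Vol}(\Sigma_t)}\int_{\Sigma_t}|R+n(n+1)|=o(e^{-2t})\qquad (t\to\infty).$$ Let $\bar g'=4e^{-2t}g$, let $\bar\Sigma'_t$ denote $\Sigma_t$ with the metric $\bar\gamma'_t$ induced by $\bar g'$, let $\bar R'_t$ be the intrinsic scalar curvature of $(\bar\Sigma'_t,\bar\gamma'_t)$,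 and let $\omega_n$ be the volume of the unit round sphere $S^n$. Then, integrals and volumes of $\bar\Sigma'_t$ being those of $\bar\gamma'_t$, $$\int_{\bar\Sigma'_t}\bar R'_t\le n(n-1)\,\mathrm{Vol}(\bar\Sigma'_t)+o(1)\qquad (t\to\infty),$$ $$\mathrm{Vol}(\bar\Sigma'_t)\le\omega_n\qquad\text{for all } t>0.$$ If moreover $|R+n(n+1)|=o(e^{-2t})$ pointwise, i.e. $e^{2t(x)}|R(x)+n(n+1)|\to 0$ as $t(x)\to\infty$, then $\bar R'_t\le n(n-1)+o(1)$ uniformly on $\bar\Sigma'_t$ as $t\to\infty$. -/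

import Mathlib

open Filter Topology MeasureTheory Bundle Manifold
open scoped ContDiff Matrix ENNReal Asymptotics

noncomputable section

universe u

/-- Euclidean space `ℝ^m`. -/
abbrev Euc (m : ℕ) : Type := EuclideanSpace ℝ (Fin m)

/-- The unit sphere `S^n ⊂ ℝ^{n+1}`. -/
abbrev Sph (n : ℕ) : Type := Metric.sphere (0 : Euc (n + 1)) 1

/-! ### Curvature of a metric given by its coefficient matrix in local coordinates -/

namespace Coord

variable {m : ℕ}

/-- The partial derivative `∂_i f`. -/
def pd (i : Fin m) (f : Euc m → ℝ) (y : Euc m) : ℝ :=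
  fderiv ℝ f y (EuclideanSpace.single i 1)

/-- Christoffel symbols `Γ^k_{ij} = ½ G^{kl} (∂_i G_{jl} + ∂_j G_{il} - ∂_l G_{ij})`. -/
def christoffel (G : Euc m → Matrix (Fin m) (Fin m) ℝ) (k i j : Fin m) (y : Euc m) : ℝ :=
  (1 / 2) * ∑ l, (G y)⁻¹ k l *
    (pd i (fun z => G z j l) y + pd j (fun z => G z i l) y - pd l (fun z => G z i j) y)

/-- The curvature tensor
`R^l_{kij} = ∂_i Γ^l_{jk} - ∂_j Γ^l_{ik} + Γ^l_{ia} Γ^a_{jk} - Γ^l_{ja} Γ^a_{ik}`. -/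
def riemann (G : Euc m → Matrix (Fin m) (Fin m) ℝ) (l k i j : Fin m) (y : Euc m) : ℝ :=
  pd i (christoffel G l j k) y - pd j (christoffel G l i k) y
    + ∑ a, (christoffel G l i a y * christoffel G a j k y
        - christoffel G l j a y * christoffel G a i k y)

/-- The Ricci tensor `R_{kj} = R^i_{kij}` (positive on round spheres). -/
def ricci (G : Euc m → Matrix (Fin m) (Fin m) ℝ) (y : Euc m) : Matrix (Fin m) (Fin m) ℝ :=
  Matrix.of fun k j => ∑ i, riemann G i k i j y

/-- The scalar curvature, the trace `G^{kj} R_{kj}` of the Ricci tensor. -/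
def scalar (G : Euc m → Matrix (Fin m) (Fin m) ℝ) (y : Euc m) : ℝ :=
  ∑ k, ∑ j, (G y)⁻¹ k j * ricci G y k j

end Coord

/-! ### Metrics on a manifold, and metrics induced by maps into it -/

section Metrics

variable {d m n : ℕ} {M : Type*} [TopologicalSpace M] [ChartedSpace (Euc d) M]

variable (d M) in
/-- A field of (bilinear) forms on the tangent spaces of a `d`-dimensional manifold. -/
abbrev FormField : Type _ :=
  ∀ x : M, TangentSpace (𝓡 d) x → TangentSpace (𝓡 d) x → ℝ

/-- The coefficients `b(∂_i u, ∂_j u)` of the pull-back `u^* b` under `u : ℝ^m → M`. -/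
def gram (b : FormField d M) (u : Euc m → M) (y : Euc m) : Matrix (Fin m) (Fin m) ℝ :=
  Matrix.of fun i j =>
    b (u y) (mfderiv (𝓡 m) (𝓡 d) u y (EuclideanSpace.single i (1 : ℝ)))
      (mfderiv (𝓡 m) (𝓡 d) u y (EuclideanSpace.single j (1 : ℝ)))

/-- The coefficients of `b` in the preferred chart at `x`. -/
def chartGram (b : FormField d M) (x : M) : Euc d → Matrix (Fin d) (Fin d) ℝ :=
  gram b (extChartAt (𝓡 d) x).symm

/-- The scalar curvature of the metric `b` on `M`. -/
def scalarCurvature (b : FormField d M) (x : M) : ℝ :=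
  Coord.scalar (chartGram b x) (extChartAt (𝓡 d) x x)

/-- `Ric ≥ κ b` as quadratic forms at every point of `M`. -/
def RicciBoundedBelow (b : FormField d M) (κ : ℝ) : Prop :=
  ∀ (x : M) (v : Fin d → ℝ),
    κ * (v ⬝ᵥ (chartGram b x (extChartAt (𝓡 d) x x) *ᵥ v)) ≤
      v ⬝ᵥ (Coord.ricci (chartGram b x) (extChartAt (𝓡 d) x x) *ᵥ v)

/-- `γ` solves the geodesic equation `γ''^k + Γ^k_{ij} γ'^i γ'^j = 0` of the metric `b`. -/
def IsGeodesic (b : FormField d M) (γ : ℝ → M) : Prop :=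
  ContMDiff 𝓘(ℝ, ℝ) (𝓡 d) ∞ γ ∧
  ∀ (s : ℝ) (k : Fin d),
    let c : Fin d → ℝ → ℝ := fun i τ => (extChartAt (𝓡 d) (γ s) (γ τ)) i
    deriv (deriv (c k)) s
      + ∑ i, ∑ j, Coord.christoffel (chartGram b (γ s)) k i j (extChartAt (𝓡 d) (γ s) (γ s))
          * deriv (c i) s * deriv (c j) s = 0

/-- The coefficients, in the preferred chart of `S^n` at `θ`, of the metric `F^* b` which `b`
induces on the hypersurface parametrized by `F : S^n → M`. -/
def sphGram (b : FormField d M) (F : Sph n → M) (θ : Sph n) : Euc n → Matrix (Fin n) (Fin n) ℝ :=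
  gram b (F ∘ (extChartAt (𝓡 n) θ).symm)

/-- The (intrinsic) scalar curvature of `(S^n, F^* b)`. -/
def inducedScalar (b : FormField d M) (F : Sph n → M) (θ : Sph n) : ℝ :=
  Coord.scalar (sphGram b F θ) (extChartAt (𝓡 n) θ θ)

variable (n) in
/-- The surface measure of the unit sphere. -/
def sphMeasure : Measure (Sph n) := (volume : Measure (Euc (n + 1))).toSphere

variable (n) in
/-- The Euclidean metric of `ℝ^{n+1}`. -/
def euclideanForm : FormField (n + 1) (Euc (n + 1)) :=
  fun _ v w => inner ℝ (show Euc (n + 1) from v) (show Euc (n + 1) from w)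

/-- The Riemannian volume measure of `(S^n, F^* b)`: its density with respect to the volume
measure of the round metric `γ₀` is `√(det (F^* b) / det γ₀)`, the two determinants being taken in
the same coordinates. -/
def inducedVolume (b : FormField d M) (F : Sph n → M) : Measure (Sph n) :=
  (sphMeasure n).withDensity fun θ => ENNReal.ofReal <| Real.sqrt <|
    (sphGram b F θ (extChartAt (𝓡 n) θ θ)).det /
      (sphGram (euclideanForm n) ((↑) : Sph n → Euc (n + 1)) θ (extChartAt (𝓡 n) θ θ)).det

end Metrics

/-! ### Riemannian manifolds -/

section Riemannian

variable {d n : ℕ}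

/-- The given Riemannian metric `g` of `M`. -/
def metricForm (d : ℕ) (M : Type*) [TopologicalSpace M] [ChartedSpace (Euc d) M]
    [RiemannianBundle (fun x : M => TangentSpace (𝓡 d) x)] : FormField d M :=
  fun _ v w => inner ℝ v w

/-- The metric `4 e^{-2t} g`, where `t` is the distance to `p`. -/
def compactifiedForm (d : ℕ) {M : Type*} [MetricSpace M] [ChartedSpace (Euc d) M]
    [RiemannianBundle (fun x : M => TangentSpace (𝓡 d) x)] (p : M) : FormField d M :=
  fun x v w => 4 * Real.exp (-2 * dist p x) * metricForm d M x v w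

/-- `Φ` is the exponential map at `p`, the tangent space `T_p M` being identified with Euclidean
space by a linear isometry: `Φ 0 = p`, the differential of `Φ` at `0` is isometric, and `Φ` sends
the lines `s ↦ s v` to geodesics. Since `Φ` is a diffeomorphism, `p` is a pole. -/
structure IsPoleExp {M : Type*} [TopologicalSpace M] [ChartedSpace (Euc d) M]
    [RiemannianBundle (fun x : M => TangentSpace (𝓡 d) x)]
    (p : M) (Φ : Euc d ≃ₘ^∞⟮𝓡 d, 𝓡 d⟯ M) : Prop where
  map_zero : Φ 0 = p
  isometric : gram (metricForm d M) Φ 0 = 1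
  geodesic : ∀ v : Euc d, IsGeodesic (metricForm d M) (fun s : ℝ => Φ (s • v))

/-- The geodesic sphere of radius `t`, parametrized by `θ ↦ exp_p (t θ)`. -/
def geodesicSphere {M : Type*} [TopologicalSpace M] [ChartedSpace (Euc (n + 1)) M]
    (Φ : Euc (n + 1) ≃ₘ^∞⟮𝓡 (n + 1), 𝓡 (n + 1)⟯ M) (t : ℝ) : Sph n → M :=
  fun θ => Φ (t • (θ : Euc (n + 1)))

/-- `(M, g)` is `C^k` conformally compact: `M` is diffeomorphic (through `ι`) to the interior of a
compact manifold with boundary `N` carrying a defining function `ρ` of its boundary, and `ρ² g`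
extends to a `C^k` metric on all of `N`. -/
def IsConformallyCompact (n : ℕ) (k : ℕ∞) (M : Type u) [TopologicalSpace M]
    [ChartedSpace (Euc (n + 1)) M]
    [RiemannianBundle (fun x : M => TangentSpace (𝓡 (n + 1)) x)] : Prop :=
  ∃ (N : Type u) (_ : TopologicalSpace N) (_ : T2Space N) (_ : CompactSpace N)
    (_ : ChartedSpace (EuclideanHalfSpace (n + 1)) N) (_ : IsManifold (𝓡∂ (n + 1)) ∞ N)
    (ι : M → N) (ρ : N → ℝ)
    (gbar : ContMDiffRiemannianMetric (𝓡∂ (n + 1)) (k : WithTop ℕ∞) (Euc (n + 1))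
      (fun x : N => TangentSpace (𝓡∂ (n + 1)) x)),
    IsOpenEmbedding ι ∧
    ContMDiff (𝓡 (n + 1)) (𝓡∂ (n + 1)) ∞ ι ∧
    Set.range ι = (𝓡∂ (n + 1)).interior N ∧
    ContMDiff (𝓡∂ (n + 1)) 𝓘(ℝ, ℝ) ∞ ρ ∧
    (∀ x ∈ (𝓡∂ (n + 1)).interior N, 0 < ρ x) ∧
    (∀ x ∈ (𝓡∂ (n + 1)).boundary N, ρ x = 0 ∧ mfderiv (𝓡∂ (n + 1)) 𝓘(ℝ, ℝ) ρ x ≠ 0) ∧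
    ∀ (x : M) (v w : TangentSpace (𝓡 (n + 1)) x),
      gbar.inner (ι x) (mfderiv (𝓡 (n + 1)) (𝓡∂ (n + 1)) ι x v)
          (mfderiv (𝓡 (n + 1)) (𝓡∂ (n + 1)) ι x w)
        = ρ (ι x) ^ 2 * metricForm (n + 1) M x v w

end Riemannian

end

/-! The exponential map gives global coordinates in which the rays from the origin are geodesics.
The Gauss lemma (`gauss_lemma`) then makes the metric radial: in polar coordinates it is `ds² +
h_s`. A path from `p` is thus at least as long as the change of its radius, so `dist p (Φ v) = ‖v‖`
(`IsPoleExp.dist_eq_norm`) and the parametrized spheres are the level sets of the distance.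

Let `S = ½ h⁻¹ h'` be the shape operator of the spheres and `H = tr S`. The Riccati equation
(`IsBlock.ricci_zero_zero`) is `Ric(∂_s, ∂_s) = -H' - tr S²`. The traced Gauss equation
(`IsBlock.scalar_eq`) is `R = R_h - 2H' - H² - tr S²`. Eliminating `tr S²` gives `R_h = R + H' -
Ric(∂_s, ∂_s) + H²`. Since `tr S² ≥ H²/n`, the Riccati equation bounds `H'` above, and `Ric ≥ -n`
gives `R_h ≤ R + 2n + (1 - 1/n) H²`.

The `n`-th root `f` of the volume density along a ray satisfies `f'/f = H/n`, so `f'' ≤ f`. Sturm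
comparison yields `f'/f ≤ coth`. Also `f'/f ≥ -1`, for otherwise `f` would vanish at a finite
radius, which a pole excludes. Hence `H² ≤ n² coth²`, and `R_h ≤ (R + n(n+1)) + n(n-1)/sinh² t`
(`IsRadial.scalar_sphMetric_le`). Moreover `f/sinh` is nonincreasing with limit `1` at the origin,
so `f ≤ sinh`.

On a sphere of radius `t` the factor `4e^{-2t}` is constant. It multiplies scalar curvature by
`e^{2t}/4` and volume by `(2e^{-t})^n`. The density becomes `(2e^{-t} f)^n ≤ (1 - e^{-2t})^n ≤ 1`,
which is the volume bound. The curvature bound becomes `e^{2t}/4 · |R + n(n+1)| + n(n-1) κ(t)` with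
`κ = e^{2t}/(4 sinh² t) → 1`; both decay hypotheses are of the order that makes the first term
vanish in the limit.

Curvature is defined in the preferred chart of each point, so its invariance under changes of
coordinates (`IsPullback.ricci_law`, `IsPullback.scalar_law`) is what allows a passage to
exponential and polar coordinates. -/

noncomputable section

/-! ### Metric, connection and curvature in coordinates as multilinear maps -/

namespace Coord

instance instNormedAddCommGroupForm {m : ℕ} : NormedAddCommGroup (Euc m →L[ℝ] Euc m →L[ℝ] ℝ) :=
  ContinuousLinearMap.toNormedAddCommGroup

instance instNormedSpaceForm {m : ℕ} : NormedSpace ℝ (Euc m →L[ℝ] Euc m →L[ℝ] ℝ) :=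
  ContinuousLinearMap.toNormedSpace

instance instNormedAddCommGroupConn {m : ℕ} :
    NormedAddCommGroup (Euc m →L[ℝ] Euc m →L[ℝ] Euc m) :=
  ContinuousLinearMap.toNormedAddCommGroup

instance instNormedSpaceConn {m : ℕ} : NormedSpace ℝ (Euc m →L[ℝ] Euc m →L[ℝ] Euc m) :=
  ContinuousLinearMap.toNormedSpace

variable {m : ℕ}

/-- The elementary bilinear form `(u, v) ↦ u_i v_j`. -/
def elemForm (i j : Fin m) : Euc m →L[ℝ] Euc m →L[ℝ] ℝ :=
  (EuclideanSpace.proj i : Euc m →L[ℝ] ℝ).smulRight (EuclideanSpace.proj j : Euc m →L[ℝ] ℝ)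

/-- The elementary vector valued bilinear form `(u, v) ↦ u_i v_j e_k`. -/
def elemConn (k i j : Fin m) : Euc m →L[ℝ] Euc m →L[ℝ] Euc m :=
  (EuclideanSpace.proj i : Euc m →L[ℝ] ℝ).smulRight
    ((EuclideanSpace.proj j : Euc m →L[ℝ] ℝ).smulRight (EuclideanSpace.single k (1 : ℝ)))

/-- The bilinear form with coefficient matrix `G x`. -/
def form (G : Euc m → Matrix (Fin m) (Fin m) ℝ) (x : Euc m) : Euc m →L[ℝ] Euc m →L[ℝ] ℝ :=
  ∑ i, ∑ j, G x i j • elemForm i j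

/-- The Christoffel symbols as a vector valued bilinear form. -/
def conn (G : Euc m → Matrix (Fin m) (Fin m) ℝ) (x : Euc m) : Euc m →L[ℝ] Euc m →L[ℝ] Euc m :=
  ∑ k, ∑ i, ∑ j, christoffel G k i j x • elemConn k i j

/-- The curvature operator `R(u, v) w`. -/
def curv (G : Euc m → Matrix (Fin m) (Fin m) ℝ) (x u v w : Euc m) : Euc m :=
  fderiv ℝ (conn G) x u v w - fderiv ℝ (conn G) x v u w
    + (conn G x u (conn G x v w) - conn G x v (conn G x u w))

lemma form_apply (G : Euc m → Matrix (Fin m) (Fin m) ℝ) (x u v : Euc m) :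
    form G x u v = ∑ i, ∑ j, G x i j * (u i * v j) := by
  simp [form, elemForm]

lemma form_eq_dotProduct (G : Euc m → Matrix (Fin m) (Fin m) ℝ) (x u v : Euc m) :
    form G x u v = u.ofLp ⬝ᵥ (G x *ᵥ v.ofLp) := by
  simp only [form_apply, dotProduct, Matrix.mulVec, Finset.mul_sum]
  exact Finset.sum_congr rfl fun i _ => Finset.sum_congr rfl fun j _ => by ring

lemma form_single (G : Euc m → Matrix (Fin m) (Fin m) ℝ) (x : Euc m) (i j : Fin m) :
    form G x (EuclideanSpace.single i 1) (EuclideanSpace.single j 1) = G x i j := by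
  simp [form_eq_dotProduct, Matrix.mulVec_single]

lemma conn_apply (G : Euc m → Matrix (Fin m) (Fin m) ℝ) (x u v : Euc m) (k : Fin m) :
    conn G x u v k = ∑ i, ∑ j, christoffel G k i j x * (u i * v j) := by
  simp [conn, elemConn, Pi.single_apply]

lemma conn_single (G : Euc m → Matrix (Fin m) (Fin m) ℝ) (x : Euc m) (i j k : Fin m) :
    conn G x (EuclideanSpace.single i 1) (EuclideanSpace.single j 1) k = christoffel G k i j x := by
  simp [conn_apply]

lemma form_symm {G : Euc m → Matrix (Fin m) (Fin m) ℝ} {x : Euc m} (h : (G x).IsSymm)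
    (u v : Euc m) : form G x u v = form G x v u := by
  rw [form_apply, form_apply, Finset.sum_comm]
  refine Finset.sum_congr rfl fun i _ => Finset.sum_congr rfl fun j _ => ?_
  rw [h.apply]; ring

lemma sum_smul_single (u : Euc m) : ∑ i, u i • EuclideanSpace.single i (1 : ℝ) = u := by
  ext k; simp [Pi.single_apply]

/-- Nondegeneracy: vectors may be compared through their pairings, which is all that the Koszul
formula provides. -/
lemma eq_of_form_eq {G : Euc m → Matrix (Fin m) (Fin m) ℝ} {x : Euc m} (hG : IsUnit (G x).det)
    {a b : Euc m} (h : ∀ w, form G x a w = form G x b w) : a = b := by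
  have hv : a.ofLp ᵥ* G x = b.ofLp ᵥ* G x := by
    ext j
    have := h (EuclideanSpace.single j 1)
    simp only [form_eq_dotProduct, PiLp.ofLp_single, Matrix.mulVec_single_one] at this
    exact this
  have := Matrix.vecMul_injective_iff_isUnit.2 ((Matrix.isUnit_iff_isUnit_det _).2 hG) hv
  exact (WithLp.ofLp_injective 2) this

section Smoothness

variable {E' : Type*} [NormedAddCommGroup E'] [NormedSpace ℝ E']

variable {F : Type*} [NormedAddCommGroup F] [NormedSpace ℝ F]

lemma contDiffAt_smul_const {k : WithTop ℕ∞} {f : E' → ℝ} {x : E'} (hf : ContDiffAt ℝ k f x)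
    (c : F) : ContDiffAt ℝ k (fun y => f y • c) x :=
  hf.smul contDiffAt_const

lemma hasFDerivAt_smul_const {f : E' → ℝ} {f' : E' →L[ℝ] ℝ} {x : E'} (hf : HasFDerivAt f f' x)
    (c : F) : HasFDerivAt (fun y => f y • c) (f'.smulRight c) x :=
  hf.smul_const c

lemma contDiffAt_det {ι : Type*} [Fintype ι] [DecidableEq ι] {k : WithTop ℕ∞}
    {A : E' → Matrix ι ι ℝ} {x : E'}
    (h : ∀ i j, ContDiffAt ℝ k (fun y => A y i j) x) : ContDiffAt ℝ k (fun y => (A y).det) x := by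
  simp only [Matrix.det_apply']
  exact ContDiffAt.sum fun σ _ => contDiffAt_const.mul (contDiffAt_prod fun i _ => h _ _)

lemma contDiffAt_inv_apply {ι : Type*} [Fintype ι] [DecidableEq ι] {k : WithTop ℕ∞}
    {A : E' → Matrix ι ι ℝ} {x : E'} (h : ∀ i j, ContDiffAt ℝ k (fun y => A y i j) x)
    (hu : IsUnit (A x).det) (i j : ι) : ContDiffAt ℝ k (fun y => (A y)⁻¹ i j) x := by
  simp only [Matrix.inv_def, Ring.inverse_eq_inv', Matrix.smul_apply, smul_eq_mul,
    Matrix.adjugate_apply]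
  refine ((contDiffAt_det h).inv hu.ne_zero).mul (contDiffAt_det fun a b => ?_)
  by_cases hab : a = j
  · subst hab; simpa using contDiffAt_const
  · simpa [Matrix.updateRow_ne hab] using h a b

end Smoothness

lemma contDiffAt_pd {f : Euc m → ℝ} {x : Euc m} {k k' : WithTop ℕ∞} (h : ContDiffAt ℝ k' f x)
    (hk : k + 1 ≤ k') (i : Fin m) : ContDiffAt ℝ k (pd i f) x :=
  (h.fderiv_right hk).clm_apply contDiffAt_const

lemma contDiffAt_christoffel {G : Euc m → Matrix (Fin m) (Fin m) ℝ} {x : Euc m}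
    {k k' : WithTop ℕ∞} (hk : k + 1 ≤ k')
    (hG : ∀ i j, ContDiffAt ℝ k' (fun y => G y i j) x) (hu : IsUnit (G x).det) (a i j : Fin m) :
    ContDiffAt ℝ k (christoffel G a i j) x := by
  have hk' : k ≤ k' := le_trans (by simp) hk
  unfold christoffel
  refine contDiffAt_const.mul (ContDiffAt.sum fun l _ => ?_)
  exact ((contDiffAt_inv_apply hG hu a l).of_le hk').mul
    (((contDiffAt_pd (hG _ _) hk _).add (contDiffAt_pd (hG _ _) hk _)).sub
      (contDiffAt_pd (hG _ _) hk _))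

lemma contDiffAt_form {G : Euc m → Matrix (Fin m) (Fin m) ℝ} {x : Euc m} {k : WithTop ℕ∞}
    (hG : ∀ i j, ContDiffAt ℝ k (fun y => G y i j) x) : ContDiffAt ℝ k (form G) x := by
  unfold form
  exact ContDiffAt.sum fun i _ => ContDiffAt.sum fun j _ => contDiffAt_smul_const (hG i j) _

lemma contDiffAt_conn {G : Euc m → Matrix (Fin m) (Fin m) ℝ} {x : Euc m}
    {k k' : WithTop ℕ∞} (hk : k + 1 ≤ k')
    (hG : ∀ i j, ContDiffAt ℝ k' (fun y => G y i j) x) (hu : IsUnit (G x).det) :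
    ContDiffAt ℝ k (conn G) x := by
  unfold conn
  exact ContDiffAt.sum fun a _ => ContDiffAt.sum fun i _ => ContDiffAt.sum fun j _ =>
    contDiffAt_smul_const (contDiffAt_christoffel hk hG hu a i j) _

lemma fderiv_form_apply {G : Euc m → Matrix (Fin m) (Fin m) ℝ} {x : Euc m}
    (hG : ∀ i j, DifferentiableAt ℝ (fun y => G y i j) x) (u v w : Euc m) :
    fderiv ℝ (form G) x u v w = ∑ i, ∑ j, ∑ l, pd l (fun y => G y i j) x * (u l * v i * w j) := by
  have h : HasFDerivAt (form G)
      (∑ i, ∑ j, (fderiv ℝ (fun y => G y i j) x).smulRight (elemForm i j)) x := by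
    unfold form
    exact HasFDerivAt.fun_sum fun i _ => HasFDerivAt.fun_sum fun j _ =>
      hasFDerivAt_smul_const (hG i j).hasFDerivAt _
  rw [h.fderiv]
  have hu : ∀ i j, fderiv ℝ (fun y => G y i j) x u = ∑ l, u l * pd l (fun y => G y i j) x := by
    intro i j
    conv_lhs => rw [← sum_smul_single u]
    simp [pd]
  simp only [sum_apply, ContinuousLinearMap.smulRight_apply,
    smul_apply, hu, smul_eq_mul, Finset.sum_mul]
  refine Finset.sum_congr rfl fun i _ => Finset.sum_congr rfl fun j _ =>
    Finset.sum_congr rfl fun l _ => ?_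
  simp [elemForm]; ring

lemma fderiv_conn_single {G : Euc m → Matrix (Fin m) (Fin m) ℝ} {x : Euc m}
    (hG : DifferentiableAt ℝ (conn G) x) (i j k l : Fin m) :
    fderiv ℝ (conn G) x (EuclideanSpace.single i 1) (EuclideanSpace.single j 1)
      (EuclideanSpace.single k 1) l = pd i (christoffel G l j k) x := by
  have h1 := ((hG.hasFDerivAt.clm_apply
    (hasFDerivAt_const (EuclideanSpace.single j (1 : ℝ) : Euc m) x)).clm_apply
    (hasFDerivAt_const (EuclideanSpace.single k (1 : ℝ) : Euc m) x))
  have h2 := (EuclideanSpace.proj l : Euc m →L[ℝ] ℝ).hasFDerivAt.comp x h1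
  have h3 : ((EuclideanSpace.proj l : Euc m →L[ℝ] ℝ) ∘ fun y =>
      conn G y (EuclideanSpace.single j 1) (EuclideanSpace.single k 1)) = christoffel G l j k := by
    ext y; simp [conn_single]
  rw [h3] at h2
  rw [pd, h2.fderiv]
  simp

/-- The Koszul formula. -/
lemma form_conn {G : Euc m → Matrix (Fin m) (Fin m) ℝ} {x : Euc m}
    (hG : ∀ i j, DifferentiableAt ℝ (fun y => G y i j) x) (hs : (G x).IsSymm)
    (hu : IsUnit (G x).det) (u v w : Euc m) :
    form G x (conn G x u v) w = (1 / 2) * (fderiv ℝ (form G) x u v w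
      + fderiv ℝ (form G) x v u w - fderiv ℝ (form G) x w u v) := by
  -- Lowering the upper index of the Christoffel symbol cancels the inverse matrix in its
  -- definition.
  have key : ∀ i j l, ∑ k, G x k l * christoffel G k i j x = (1 / 2) *
      (pd i (fun z => G z j l) x + pd j (fun z => G z i l) x - pd l (fun z => G z i j) x) := by
    intro i j l
    set D : Fin m → ℝ := fun a =>
      pd i (fun z => G z j a) x + pd j (fun z => G z i a) x - pd a (fun z => G z i j) x with hD
    have h1 : G x *ᵥ ((G x)⁻¹ *ᵥ D) = D := by
      rw [Matrix.mulVec_mulVec, Matrix.mul_nonsing_inv _ hu, Matrix.one_mulVec]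
    have h2 := congrFun h1 l
    simp only [Matrix.mulVec, dotProduct] at h2
    change _ = 1 / 2 * D l
    rw [← h2, Finset.mul_sum]
    refine Finset.sum_congr rfl fun k _ => ?_
    rw [christoffel, ← hs.apply k l]; ring
  have lhs : form G x (conn G x u v) w =
      ∑ i, ∑ j, ∑ l, (∑ k, G x k l * christoffel G k i j x) * (u i * v j * w l) := by
    rw [form_apply]
    simp only [conn_apply, Finset.sum_mul, Finset.mul_sum]
    rw [Finset.sum_comm]
    simp only [fun l : Fin m => Finset.sum_comm (s := (Finset.univ : Finset (Fin m)))
      (t := (Finset.univ : Finset (Fin m))) (f := fun k i => ∑ j,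
        G x k l * (christoffel G k i j x * (u i * v j) * w l))]
    rw [Finset.sum_comm]
    refine Finset.sum_congr rfl fun i _ => ?_
    simp only [fun l : Fin m => Finset.sum_comm (s := (Finset.univ : Finset (Fin m)))
      (t := (Finset.univ : Finset (Fin m))) (f := fun k j => 
        G x k l * (christoffel G k i j x * (u i * v j) * w l))]
    rw [Finset.sum_comm]
    refine Finset.sum_congr rfl fun j _ => Finset.sum_congr rfl fun l _ =>
      Finset.sum_congr rfl fun k _ => by ring
  rw [lhs]
  have e1 : fderiv ℝ (form G) x u v w =
      ∑ i, ∑ j, ∑ l, pd i (fun y => G y j l) x * (u i * v j * w l) := by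
    rw [fderiv_form_apply hG]
    simp only [fun a : Fin m => Finset.sum_comm (s := (Finset.univ : Finset (Fin m)))
      (t := (Finset.univ : Finset (Fin m))) (f := fun b c => 
        pd c (fun y => G y a b) x * (u c * v a * w b))]
    rw [Finset.sum_comm]
  have e2 : fderiv ℝ (form G) x v u w =
      ∑ i, ∑ j, ∑ l, pd j (fun y => G y i l) x * (u i * v j * w l) := by
    rw [fderiv_form_apply hG]
    refine Finset.sum_congr rfl fun i _ => ?_
    rw [Finset.sum_comm]
    refine Finset.sum_congr rfl fun j _ => Finset.sum_congr rfl fun l _ => by ring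
  have e3 : fderiv ℝ (form G) x w u v =
      ∑ i, ∑ j, ∑ l, pd l (fun y => G y i j) x * (u i * v j * w l) := by
    rw [fderiv_form_apply hG]
    refine Finset.sum_congr rfl fun i _ => Finset.sum_congr rfl fun j _ =>
      Finset.sum_congr rfl fun l _ => by ring
  rw [e1, e2, e3]
  simp only [← Finset.sum_add_distrib, ← Finset.sum_sub_distrib, Finset.mul_sum, key]
  refine Finset.sum_congr rfl fun i _ => Finset.sum_congr rfl fun j _ =>
      Finset.sum_congr rfl fun l _ => by ring

lemma curv_single {G : Euc m → Matrix (Fin m) (Fin m) ℝ} {x : Euc m}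
    (hG : DifferentiableAt ℝ (conn G) x) (i j k l : Fin m) :
    curv G x (EuclideanSpace.single i 1) (EuclideanSpace.single j 1)
      (EuclideanSpace.single k 1) l = riemann G l k i j x := by
  have h : ∀ (a : Fin m) (w : Euc m),
      conn G x (EuclideanSpace.single a 1) w l = ∑ b, christoffel G l a b x * w b := by
    intro a w; simp [conn_apply]
  simp only [curv, riemann, PiLp.add_apply, PiLp.sub_apply, fderiv_conn_single hG, h, conn_single,
    Finset.sum_sub_distrib]

/-- The curvature operator as a linear map in its first argument. -/
def curvLin (G : Euc m → Matrix (Fin m) (Fin m) ℝ) (x v w : Euc m) : Euc m →ₗ[ℝ] Euc m where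
  toFun u := curv G x u v w
  map_add' a b := by simp only [curv, map_add, add_apply]; abel
  map_smul' c a := by
    simp only [curv, map_smul, smul_apply, RingHom.id_apply, smul_sub, smul_add]

lemma curv_eq_sum (G : Euc m → Matrix (Fin m) (Fin m) ℝ) (x u v w : Euc m) :
    curv G x u v w = ∑ k, ∑ j, (w k * v j) •
      curv G x u (EuclideanSpace.single j 1) (EuclideanSpace.single k 1) := by
  have h1 : curv G x u v w = ∑ k, w k • curv G x u v (EuclideanSpace.single k 1) := by
    conv_lhs => rw [← sum_smul_single w]
    simp only [curv, map_sum, map_smul, smul_add, smul_sub, Finset.sum_add_distrib,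
      Finset.sum_sub_distrib]
  have h2 : ∀ z, curv G x u v z = ∑ j, v j • curv G x u (EuclideanSpace.single j 1) z := by
    intro z
    conv_lhs => rw [← sum_smul_single v]
    simp only [curv, map_sum, map_smul, smul_add, smul_sub, Finset.sum_add_distrib,
      Finset.sum_sub_distrib, sum_apply, smul_apply]
  rw [h1]
  refine Finset.sum_congr rfl fun k _ => ?_
  rw [h2, Finset.smul_sum]
  simp only [smul_smul]

lemma trace_eq_sum (T : Euc m →ₗ[ℝ] Euc m) :
    LinearMap.trace ℝ (Euc m) T = ∑ i, T (EuclideanSpace.single i 1) i := by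
  rw [LinearMap.trace_eq_matrix_trace ℝ (EuclideanSpace.basisFun (Fin m) ℝ).toBasis]
  simp [Matrix.trace, LinearMap.toMatrix_apply]

lemma scalar_eq_trace (A : Euc m → Matrix (Fin m) (Fin m) ℝ) (x : Euc m) :
    scalar A x = ((A x)⁻¹ * (ricci A x)ᵀ).trace := by
  simp [scalar, Matrix.trace, Matrix.mul_apply]

/-- Ricci curvature as the trace of `u ↦ R(u, v) w`: in this form its invariance is the conjugation
invariance of the trace. -/
lemma form_ricci {G : Euc m → Matrix (Fin m) (Fin m) ℝ} {x : Euc m}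
    (hG : DifferentiableAt ℝ (conn G) x) (v w : Euc m) :
    form (ricci G) x w v = LinearMap.trace ℝ (Euc m) (curvLin G x v w) := by
  rw [trace_eq_sum, form_apply]
  have h : ∀ i, curvLin G x v w (EuclideanSpace.single i 1) i =
      ∑ k, ∑ j, (w k * v j) * riemann G i k i j x := by
    intro i
    change curv G x _ v w i = _
    rw [curv_eq_sum]
    simp [curv_single hG]
  simp only [h, ricci, Matrix.of_apply, Finset.sum_mul]
  symm
  rw [Finset.sum_comm]
  refine Finset.sum_congr rfl fun k _ => ?_
  rw [Finset.sum_comm]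
  refine Finset.sum_congr rfl fun j _ => Finset.sum_congr rfl fun i _ => by ring

end Coord

/-! ### Differentiating the transformation laws of forms and connections -/

section AbstractPullback

variable {E F : Type*} [NormedAddCommGroup E] [NormedSpace ℝ E]
  [NormedAddCommGroup F] [NormedSpace ℝ F]

instance instNormedAddCommGroupBilin : NormedAddCommGroup (E →L[ℝ] E →L[ℝ] F) :=
  ContinuousLinearMap.toNormedAddCommGroup

instance instNormedSpaceBilin : NormedSpace ℝ (E →L[ℝ] E →L[ℝ] F) :=
  ContinuousLinearMap.toNormedSpace

lemma fderiv_clm_apply₂ {q : E → F →L[ℝ] F →L[ℝ] ℝ} {y : E} (hq : DifferentiableAt ℝ q y)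
    (u : E) (v w : F) : fderiv ℝ (fun z => q z v w) y u = fderiv ℝ q y u v w := by
  have h := (hq.hasFDerivAt.clm_apply (hasFDerivAt_const v y)).clm_apply (hasFDerivAt_const w y)
  rw [h.fderiv]; simp

/-- The derivative of a pulled back bilinear form. -/
lemma fderiv_pullback_form {g q : E → E →L[ℝ] E →L[ℝ] ℝ} {ψ : E → E} {y : E}
    (hg : DifferentiableAt ℝ g (ψ y)) (hq : DifferentiableAt ℝ q y) (hψ : ContDiffAt ℝ 2 ψ y)
    (h : ∀ᶠ z in 𝓝 y, ∀ v w, q z v w = g (ψ z) (fderiv ℝ ψ z v) (fderiv ℝ ψ z w)) (u v w : E) :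
    fderiv ℝ q y u v w =
      fderiv ℝ g (ψ y) (fderiv ℝ ψ y u) (fderiv ℝ ψ y v) (fderiv ℝ ψ y w)
      + g (ψ y) (fderiv ℝ (fderiv ℝ ψ) y u v) (fderiv ℝ ψ y w)
      + g (ψ y) (fderiv ℝ ψ y v) (fderiv ℝ (fderiv ℝ ψ) y u w) := by
  rw [← fderiv_clm_apply₂ hq]
  have he : (fun z => q z v w) =ᶠ[𝓝 y] fun z => g (ψ z) (fderiv ℝ ψ z v) (fderiv ℝ ψ z w) :=
    h.mono fun z hz => hz v w
  rw [he.fderiv_eq]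
  have h1 : HasFDerivAt ψ (fderiv ℝ ψ y) y := (hψ.differentiableAt (by norm_num)).hasFDerivAt
  have h2 : HasFDerivAt (fderiv ℝ ψ) (fderiv ℝ (fderiv ℝ ψ) y) y :=
    ((hψ.fderiv_right (m := 1) (by norm_num)).differentiableAt (by norm_num)).hasFDerivAt
  have h3 := ((hg.hasFDerivAt.comp y h1).clm_apply
    (h2.clm_apply (hasFDerivAt_const v y))).clm_apply (h2.clm_apply (hasFDerivAt_const w y))
  rw [show (fun z => g (ψ z) (fderiv ℝ ψ z v) (fderiv ℝ ψ z w)) =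
    fun z => ((g ∘ ψ) z) (fderiv ℝ ψ z v) (fderiv ℝ ψ z w) from rfl, h3.fderiv]
  simp
  ring

set_option synthInstance.maxHeartbeats 200000 in
/-- The derivative of the transformation law of a connection. -/
lemma fderiv_connection_law {Γ Γ' : E → E →L[ℝ] E →L[ℝ] E} {ψ : E → E} {y : E}
    (hΓ : DifferentiableAt ℝ Γ (ψ y)) (hΓ' : DifferentiableAt ℝ Γ' y) (hψ : ContDiffAt ℝ 3 ψ y)
    (h : ∀ᶠ z in 𝓝 y, ∀ v w, fderiv ℝ ψ z (Γ' z v w) =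
      Γ (ψ z) (fderiv ℝ ψ z v) (fderiv ℝ ψ z w) + fderiv ℝ (fderiv ℝ ψ) z v w) (u v w : E) :
    fderiv ℝ (fderiv ℝ ψ) y u (Γ' y v w) + fderiv ℝ ψ y (fderiv ℝ Γ' y u v w) =
      fderiv ℝ Γ (ψ y) (fderiv ℝ ψ y u) (fderiv ℝ ψ y v) (fderiv ℝ ψ y w)
      + Γ (ψ y) (fderiv ℝ (fderiv ℝ ψ) y u v) (fderiv ℝ ψ y w)
      + Γ (ψ y) (fderiv ℝ ψ y v) (fderiv ℝ (fderiv ℝ ψ) y u w)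
      + fderiv ℝ (fderiv ℝ (fderiv ℝ ψ)) y u v w := by
  have h1 : HasFDerivAt ψ (fderiv ℝ ψ y) y := (hψ.differentiableAt (by norm_num)).hasFDerivAt
  have c2 : ContDiffAt ℝ 2 (fderiv ℝ ψ) y := hψ.fderiv_right (m := 2) (by norm_num)
  have h2 : HasFDerivAt (fderiv ℝ ψ) (fderiv ℝ (fderiv ℝ ψ) y) y :=
    (c2.differentiableAt (by norm_num)).hasFDerivAt
  have h3 : HasFDerivAt (fderiv ℝ (fderiv ℝ ψ)) (fderiv ℝ (fderiv ℝ (fderiv ℝ ψ)) y) y :=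
    ((c2.fderiv_right (m := 1) (by norm_num)).differentiableAt (by norm_num)).hasFDerivAt
  have hR := (((hΓ.hasFDerivAt.comp y h1).clm_apply
    (h2.clm_apply (hasFDerivAt_const v y))).clm_apply
      (h2.clm_apply (hasFDerivAt_const w y))).add
        ((h3.clm_apply (hasFDerivAt_const v y)).clm_apply (hasFDerivAt_const w y))
  have hL := h2.clm_apply ((hΓ'.hasFDerivAt.clm_apply (hasFDerivAt_const v y)).clm_apply
    (hasFDerivAt_const w y))
  have he : (fun z => fderiv ℝ ψ z (Γ' z v w)) =ᶠ[𝓝 y] fun z =>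
      Γ (ψ z) (fderiv ℝ ψ z v) (fderiv ℝ ψ z w) + fderiv ℝ (fderiv ℝ ψ) z v w :=
    h.mono fun z hz => hz v w
  have := congrArg (fun T : E →L[ℝ] E => T u) (hL.unique (hR.congr_of_eventuallyEq he))
  simp at this
  rw [add_comm, this]
  abel

end AbstractPullback

/-! ### Invariance of curvature under changes of coordinates -/

namespace Coord

variable {m : ℕ}

/-- `G'` is, near `y`, the pull-back of the nondegenerate metric `G` under the local
diffeomorphism `ψ`. -/
structure IsPullback (G G' : Euc m → Matrix (Fin m) (Fin m) ℝ) (ψ : Euc m → Euc m) (y : Euc m) :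
    Prop where
  contDiffAt : ContDiffAt ℝ 3 ψ y
  isUnit_fderiv : IsUnit (fderiv ℝ ψ y)
  contDiffAt_metric : ∀ i j, ContDiffAt ℝ 2 (fun z => G z i j) (ψ y)
  isSymm : ∀ᶠ z in 𝓝 (ψ y), (G z).IsSymm
  isUnit_det : IsUnit (G (ψ y)).det
  form_eq : ∀ᶠ z in 𝓝 y, ∀ v w,
    form G' z v w = form G (ψ z) (fderiv ℝ ψ z v) (fderiv ℝ ψ z w)

namespace IsPullback

variable {G G' : Euc m → Matrix (Fin m) (Fin m) ℝ} {ψ : Euc m → Euc m} {y : Euc m}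

/-- All conditions are open. A law proved at a point therefore holds in a neighbourhood and can be
differentiated. -/
lemma eventually (h : IsPullback G G' ψ y) : ∀ᶠ z in 𝓝 y, IsPullback G G' ψ z := by
  have hc : ContinuousAt ψ y := h.contDiffAt.continuousAt
  have e1 : ∀ᶠ z in 𝓝 y, ContDiffAt ℝ 3 ψ z := h.contDiffAt.eventually (by decide)
  have e2 : ∀ᶠ z in 𝓝 y, IsUnit (fderiv ℝ ψ z) := by
    have : ContinuousAt (fderiv ℝ ψ) y :=
      (h.contDiffAt.fderiv_right (m := 2) (by norm_num)).continuousAt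
    exact this.eventually (Units.isOpen.mem_nhds h.isUnit_fderiv)
  have e3 : ∀ᶠ z in 𝓝 y, ∀ i j, ContDiffAt ℝ 2 (fun z => G z i j) (ψ z) := by
    refine hc.eventually (p := fun x => ∀ i j, ContDiffAt ℝ 2 (fun z => G z i j) x) ?_
    exact eventually_all.2 fun i => eventually_all.2 fun j =>
      (h.contDiffAt_metric i j).eventually (by decide)
  have e4 : ∀ᶠ z in 𝓝 y, ∀ᶠ x in 𝓝 (ψ z), (G x).IsSymm :=
    hc.eventually (eventually_eventually_nhds.2 h.isSymm)
  have e5 : ∀ᶠ z in 𝓝 y, IsUnit (G (ψ z)).det := by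
    refine hc.eventually (p := fun x => IsUnit (G x).det) ?_
    simp only [isUnit_iff_ne_zero]
    exact (contDiffAt_det h.contDiffAt_metric).continuousAt.eventually_ne h.isUnit_det.ne_zero
  filter_upwards [e1, e2, e3, e4, e5, eventually_eventually_nhds.2 h.form_eq]
    with z a b c d e f using ⟨a, b, c, d, e, f⟩

lemma bijective (h : IsPullback G G' ψ y) : Function.Bijective (fderiv ℝ ψ y) :=
  ContinuousLinearMap.isUnit_iff_bijective.1 h.isUnit_fderiv

lemma contDiffAt_pullback (h : IsPullback G G' ψ y) (i j : Fin m) :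
    ContDiffAt ℝ 2 (fun z => G' z i j) y := by
  have h1 : ContDiffAt ℝ 2 (fderiv ℝ ψ) y := h.contDiffAt.fderiv_right (by norm_num)
  have h2 : ContDiffAt ℝ 2 (fun z => form G (ψ z)) y :=
    (contDiffAt_form h.contDiffAt_metric).comp y (h.contDiffAt.of_le (by norm_num))
  have h3 : ContDiffAt ℝ 2 (fun z => form G (ψ z) (fderiv ℝ ψ z (EuclideanSpace.single i 1))
      (fderiv ℝ ψ z (EuclideanSpace.single j 1))) y :=
    (h2.clm_apply (h1.clm_apply contDiffAt_const)).clm_apply (h1.clm_apply contDiffAt_const)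
  refine h3.congr_of_eventuallyEq ?_
  filter_upwards [h.form_eq] with z hz
  rw [← hz, form_single]

lemma isSymm_pullback (h : IsPullback G G' ψ y) : (G' y).IsSymm := by
  refine Matrix.IsSymm.ext fun i j => ?_
  rw [← form_single G', ← form_single G', h.form_eq.self_of_nhds, h.form_eq.self_of_nhds,
    form_symm h.isSymm.self_of_nhds]

lemma isUnit_det_pullback (h : IsPullback G G' ψ y) : IsUnit (G' y).det := by
  rw [← Matrix.isUnit_iff_isUnit_det, ← Matrix.vecMul_injective_iff_isUnit]
  intro a b hab
  have h1 : ∀ w, form G' y (WithLp.toLp 2 a) w = form G' y (WithLp.toLp 2 b) w := by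
    intro w
    simp only [form_eq_dotProduct, Matrix.dotProduct_mulVec]
    rw [show a ᵥ* G' y = b ᵥ* G' y from hab]
  have h2 : fderiv ℝ ψ y (WithLp.toLp 2 a) = fderiv ℝ ψ y (WithLp.toLp 2 b) := by
    refine eq_of_form_eq h.isUnit_det fun w => ?_
    obtain ⟨w, rfl⟩ := h.bijective.2 w
    rw [← h.form_eq.self_of_nhds, ← h.form_eq.self_of_nhds, h1]
  exact WithLp.toLp_injective 2 (h.bijective.1 h2)

/-- Pair both sides with `dψ w` and expand by the Koszul formula. In the alternating sum of the
three derivatives of the pulled-back form, the symmetric second derivatives of `ψ` cancel except for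
one term. -/
lemma conn_law (h : IsPullback G G' ψ y) (u v : Euc m) :
    fderiv ℝ ψ y (conn G' y u v) =
      conn G (ψ y) (fderiv ℝ ψ y u) (fderiv ℝ ψ y v) + fderiv ℝ (fderiv ℝ ψ) y u v := by
  have dG : ∀ i j, DifferentiableAt ℝ (fun z => G z i j) (ψ y) := fun i j =>
    (h.contDiffAt_metric i j).differentiableAt (by norm_num)
  have dG' : ∀ i j, DifferentiableAt ℝ (fun z => G' z i j) y := fun i j =>
    (h.contDiffAt_pullback i j).differentiableAt (by norm_num)
  have df : DifferentiableAt ℝ (form G) (ψ y) :=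
    (contDiffAt_form h.contDiffAt_metric).differentiableAt (by norm_num)
  have df' : DifferentiableAt ℝ (form G') y :=
    (contDiffAt_form h.contDiffAt_pullback).differentiableAt (by norm_num)
  have hs : ∀ a b, fderiv ℝ (fderiv ℝ ψ) y a b = fderiv ℝ (fderiv ℝ ψ) y b a := fun a b =>
    (h.contDiffAt.isSymmSndFDerivAt (by simp; norm_num)).eq a b
  have hsym := form_symm h.isSymm.self_of_nhds
  have hp := fderiv_pullback_form df df' (h.contDiffAt.of_le (by norm_num)) h.form_eq
  -- Since `dψ` is onto, it suffices to test against vectors `dψ w`.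
  refine eq_of_form_eq h.isUnit_det fun w => ?_
  obtain ⟨w, rfl⟩ := h.bijective.2 w
  rw [← h.form_eq.self_of_nhds, form_conn dG' h.isSymm_pullback h.isUnit_det_pullback, map_add,
    add_apply, form_conn dG h.isSymm.self_of_nhds h.isUnit_det, hp, hp, hp,
    hs v u, hs w u, hs w v, hsym (fderiv ℝ ψ y v) (fderiv ℝ (fderiv ℝ ψ) y u w)]
  ring

lemma differentiableAt_conn (h : IsPullback G G' ψ y) : DifferentiableAt ℝ (conn G) (ψ y) :=
  (contDiffAt_conn (k := 1) (by norm_num) h.contDiffAt_metric h.isUnit_det).differentiableAt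
    (by norm_num)

lemma differentiableAt_conn_pullback (h : IsPullback G G' ψ y) : DifferentiableAt ℝ (conn G') y :=
  (contDiffAt_conn (k := 1) (by norm_num) h.contDiffAt_pullback
    h.isUnit_det_pullback).differentiableAt (by norm_num)

/-- Differentiate the connection law and antisymmetrize in `u, v`: the second and third derivatives
of `ψ` are symmetric and drop out. -/
lemma curv_law (h : IsPullback G G' ψ y) (u v w : Euc m) :
    fderiv ℝ ψ y (curv G' y u v w) =
      curv G (ψ y) (fderiv ℝ ψ y u) (fderiv ℝ ψ y v) (fderiv ℝ ψ y w) := by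
  have key := fderiv_connection_law h.differentiableAt_conn h.differentiableAt_conn_pullback
    h.contDiffAt (h.eventually.mono fun z hz => hz.conn_law)
  have c2 : ContDiffAt ℝ 2 (fderiv ℝ ψ) y := h.contDiffAt.fderiv_right (m := 2) (by norm_num)
  have hs : ∀ a b, fderiv ℝ (fderiv ℝ ψ) y a b = fderiv ℝ (fderiv ℝ ψ) y b a := fun a b =>
    (h.contDiffAt.isSymmSndFDerivAt (by simp; norm_num)).eq a b
  have ht : ∀ a b, fderiv ℝ (fderiv ℝ (fderiv ℝ ψ)) y a b = fderiv ℝ (fderiv ℝ (fderiv ℝ ψ)) y b a :=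
    fun a b => (c2.isSymmSndFDerivAt (by simp)).eq a b
  have k1 := eq_sub_of_add_eq' (key u v w)
  have k2 := eq_sub_of_add_eq' (key v u w)
  simp only [curv, map_add, map_sub, k1, k2, h.conn_law]
  rw [ht v u, hs v u]
  abel

/-- The curvature law says that `dψ` conjugates one operator `u ↦ R(u, v) w` into the other, so the
traces agree. -/
lemma ricci_law (h : IsPullback G G' ψ y) (v w : Euc m) :
    form (ricci G') y v w = form (ricci G) (ψ y) (fderiv ℝ ψ y v) (fderiv ℝ ψ y w) := by
  rw [form_ricci h.differentiableAt_conn_pullback, form_ricci h.differentiableAt_conn]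
  let e : Euc m ≃ₗ[ℝ] Euc m := LinearEquiv.ofBijective (fderiv ℝ ψ y).toLinearMap h.bijective
  rw [← LinearMap.trace_conj' (curvLin G' y w v) e]
  congr 1
  ext1 u
  obtain ⟨u, rfl⟩ := e.surjective u
  rw [LinearEquiv.conj_apply_apply, e.symm_apply_apply]
  exact h.curv_law u w v

/-- The matrix of the differential of `ψ`. -/
lemma exists_jacobian (h : IsPullback G G' ψ y) : ∃ J : Matrix (Fin m) (Fin m) ℝ, IsUnit J.det ∧
    (∀ v : Euc m, (fderiv ℝ ψ y v).ofLp = J *ᵥ v.ofLp) ∧ G' y = Jᵀ * G (ψ y) * J ∧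
    ricci G' y = Jᵀ * ricci G (ψ y) * J := by
  let J : Matrix (Fin m) (Fin m) ℝ :=
    Matrix.of fun i j => fderiv ℝ ψ y (EuclideanSpace.single j 1) i
  have hJ : ∀ v : Euc m, (fderiv ℝ ψ y v).ofLp = J *ᵥ v.ofLp := by
    intro v
    conv_lhs => rw [← sum_smul_single v]
    ext i
    simp [J, Matrix.mulVec, dotProduct, mul_comm]
  have hf : ∀ A B : Euc m → Matrix (Fin m) (Fin m) ℝ,
      (∀ v w, form A y v w = form B (ψ y) (fderiv ℝ ψ y v) (fderiv ℝ ψ y w)) →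
      A y = Jᵀ * B (ψ y) * J := by
    intro A B hAB
    ext i j
    rw [← form_single A, hAB, form_eq_dotProduct, hJ, hJ]
    simp only [PiLp.ofLp_single, Matrix.mulVec_single_one]
    rw [Matrix.mul_assoc, Matrix.mul_apply]
    rfl
  refine ⟨J, ?_, hJ, hf _ _ h.form_eq.self_of_nhds, hf _ _ h.ricci_law⟩
  rw [← Matrix.isUnit_iff_isUnit_det, ← Matrix.mulVec_injective_iff_isUnit]
  intro a b hab
  have h2 : fderiv ℝ ψ y (WithLp.toLp 2 a) = fderiv ℝ ψ y (WithLp.toLp 2 b) := by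
    apply WithLp.ofLp_injective 2
    rw [hJ, hJ]; exact hab
  exact WithLp.toLp_injective 2 (h.bijective.1 h2)

/-- Both the metric and Ricci transform as `A ↦ Jᵀ A J`, and the Jacobians cancel in the trace of
`G⁻¹ Ric`. -/
lemma scalar_law (h : IsPullback G G' ψ y) : scalar G' y = scalar G (ψ y) := by
  obtain ⟨J, hu, -, hG, hR⟩ := h.exists_jacobian
  rw [scalar_eq_trace, scalar_eq_trace, hG, hR]
  have huT : IsUnit (Jᵀ).det := by rwa [Matrix.det_transpose]
  rw [Matrix.mul_inv_rev, Matrix.mul_inv_rev, Matrix.transpose_mul, Matrix.transpose_mul,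
    Matrix.transpose_transpose]
  rw [show J⁻¹ * ((G (ψ y))⁻¹ * Jᵀ⁻¹) * (Jᵀ * ((ricci G (ψ y))ᵀ * J)) =
    J⁻¹ * ((G (ψ y))⁻¹ * (Jᵀ⁻¹ * Jᵀ) * (ricci G (ψ y))ᵀ * J) by simp only [Matrix.mul_assoc],
    Matrix.nonsing_inv_mul _ huT, Matrix.mul_one, Matrix.trace_mul_comm, Matrix.mul_assoc,
    Matrix.mul_nonsing_inv _ hu, Matrix.mul_one]

end IsPullback

end Coord

/-! ### The metric in exponential coordinates at the pole -/

open Coord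

lemma mfderiv_pole_comp {d : ℕ} {M : Type*} [TopologicalSpace M] [ChartedSpace (Euc d) M]
    {Φ : Euc d ≃ₘ^∞⟮𝓡 d, 𝓡 d⟯ M} {c : ℝ → Euc d} {c' : Euc d} {s : ℝ} (hc : HasDerivAt c c' s) :
    mfderiv 𝓘(ℝ, ℝ) (𝓡 d) (Φ ∘ c) s (1 : ℝ) = mfderiv (𝓡 d) (𝓡 d) Φ (c s) c' := by
  have hcomp := mfderiv_comp (I := 𝓘(ℝ, ℝ)) (I' := 𝓡 d) (I'' := 𝓡 d) s
    ((Φ.contMDiff (c s)).mdifferentiableAt (by simp)) hc.differentiableAt.mdifferentiableAt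
  have h1 : (mfderiv 𝓘(ℝ, ℝ) (𝓡 d) c s (1 : ℝ) : Euc d) = c' := by
    rw [mfderiv_eq_fderiv, ← hc.deriv]
    exact fderiv_apply_one_eq_deriv
  exact (congrArg (fun T => T (1 : ℝ)) hcomp).trans (congrArg (mfderiv (𝓡 d) (𝓡 d) Φ (c s)) h1)

section PoleChart

variable {d : ℕ} {M : Type*} [TopologicalSpace M] [ChartedSpace (Euc d) M] [IsManifold (𝓡 d) ∞ M]
  {Φ : Euc d ≃ₘ^∞⟮𝓡 d, 𝓡 d⟯ M}

lemma contDiffAt_pole_chart (x : M) : ContDiffAt ℝ ∞ (Φ.symm ∘ (extChartAt (𝓡 d) x).symm)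
    (extChartAt (𝓡 d) x x) := by
  rw [← contMDiffAt_iff_contDiffAt]
  exact (Φ.symm.contMDiff _).comp _ ((contMDiffOn_extChartAt_symm (n := ∞) x).contMDiffAt
    (extChartAt_target_mem_nhds x))

/-- The chart composed with `Φ` is a left inverse near the point, so the differential is injective,
hence bijective in equal dimensions. -/
lemma isUnit_fderiv_pole_chart (x : M) :
    IsUnit (fderiv ℝ (Φ.symm ∘ (extChartAt (𝓡 d) x).symm) (extChartAt (𝓡 d) x x)) := by
  set ψ := Φ.symm ∘ (extChartAt (𝓡 d) x).symm
  set χ : Euc d → Euc d := (extChartAt (𝓡 d) x) ∘ Φ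
  set y := extChartAt (𝓡 d) x x
  have hy : ψ y = Φ.symm x := by simp [ψ, y]
  have hχ : DifferentiableAt ℝ χ (ψ y) := by
    rw [← mdifferentiableAt_iff_differentiableAt, hy]
    refine MDifferentiableAt.comp _ ?_ ((Φ.contMDiff _).mdifferentiableAt (by simp))
    exact (contMDiffAt_extChartAt' (n := ∞) (by simp)).mdifferentiableAt (by simp)
  have hψ : DifferentiableAt ℝ ψ y := (contDiffAt_pole_chart x).differentiableAt (by simp)
  have h1 : (χ ∘ ψ) =ᶠ[𝓝 y] id := by
    filter_upwards [extChartAt_target_mem_nhds (I := 𝓡 d) x] with z hz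
    simpa [χ, ψ] using (extChartAt (𝓡 d) x).right_inv hz
  have h2 : (fderiv ℝ χ (ψ y)).comp (fderiv ℝ ψ y) = ContinuousLinearMap.id ℝ _ := by
    rw [← fderiv_comp _ hχ hψ, h1.fderiv_eq, fderiv_id]
  have hinj : Function.Injective (fderiv ℝ ψ y) := by
    intro a b hab
    have := congrArg (fderiv ℝ χ (ψ y)) hab
    rw [← ContinuousLinearMap.comp_apply, ← ContinuousLinearMap.comp_apply, h2] at this
    exact this
  rw [ContinuousLinearMap.isUnit_iff_bijective]
  exact ⟨hinj, (LinearMap.injective_iff_surjective (f := (fderiv ℝ ψ y).toLinearMap)).1 hinj⟩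

end PoleChart

section Pole

variable {d m : ℕ} {M : Type*} [TopologicalSpace M] [ChartedSpace (Euc d) M]
  [RiemannianBundle (fun x : M => TangentSpace (𝓡 d) x)]

lemma form_gram_metricForm (u : Euc m → M) (y v w : Euc m) :
    form (gram (metricForm d M) u) y v w =
      metricForm d M (u y) (mfderiv (𝓡 m) (𝓡 d) u y v) (mfderiv (𝓡 m) (𝓡 d) u y w) := by
  let L : Euc m →L[ℝ] TangentSpace (𝓡 d) (u y) := mfderiv (𝓡 m) (𝓡 d) u y
  have h : ∀ z : Euc m, L z = ∑ i, z i • L (EuclideanSpace.single i (1 : ℝ)) := by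
    intro z
    conv_lhs => rw [← sum_smul_single z]
    rw [map_sum]
    exact Finset.sum_congr rfl fun i _ => map_smul _ _ _
  change _ = metricForm d M (u y) (L v) (L w)
  rw [h v, h w, form_apply]
  unfold metricForm
  rw [sum_inner]
  refine Finset.sum_congr rfl fun i _ => ?_
  rw [inner_sum]
  refine Finset.sum_congr rfl fun j _ => ?_
  rw [real_inner_smul_left, real_inner_smul_right]
  change inner ℝ (L _) (L _) * _ = _
  ring

variable (Φ : Euc d ≃ₘ^∞⟮𝓡 d, 𝓡 d⟯ M)

/-- The coefficients of the metric in the global coordinates `Φ`. -/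
def poleGram : Euc d → Matrix (Fin d) (Fin d) ℝ := gram (metricForm d M) Φ

variable {Φ}

lemma isSymm_poleGram (x : Euc d) : (poleGram Φ x).IsSymm := by
  refine Matrix.IsSymm.ext fun i j => ?_
  simp only [poleGram, gram, metricForm, Matrix.of_apply]
  exact real_inner_comm _ _

lemma form_poleGram_pos (x : Euc d) {v : Euc d} (hv : v ≠ 0) : 0 < form (poleGram Φ) x v v := by
  rw [poleGram, form_gram_metricForm]
  refine real_inner_self_pos.2 fun h => hv ?_
  have := (Φ.mfderivToContinuousLinearEquiv (by simp) x).injective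
  exact this (h.trans (map_zero (mfderiv (𝓡 d) (𝓡 d) Φ x)).symm)

lemma posDef_poleGram (x : Euc d) : (poleGram Φ x).PosDef := by
  refine Matrix.PosDef.of_dotProduct_mulVec_pos ?_ fun v hv => ?_
  · rw [Matrix.IsHermitian, Matrix.conjTranspose_eq_transpose_of_trivial]
    exact isSymm_poleGram x
  · have := form_poleGram_pos (Φ := Φ) x (v := WithLp.toLp 2 v) (by simpa using hv)
    rw [form_eq_dotProduct] at this
    simpa using this

lemma isUnit_det_poleGram (x : Euc d) : IsUnit (poleGram Φ x).det :=
  (posDef_poleGram _).det_pos.ne'.isUnit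

/-- The pull-back of the metric under a map into `M`, read in the coordinates `Φ`. -/
lemma form_gram_eq {u : Euc m → M} {ψ : Euc m → Euc d} {y : Euc m} (hu : u = Φ ∘ ψ)
    (hψ : DifferentiableAt ℝ ψ y) (v w : Euc m) :
    form (gram (metricForm d M) u) y v w =
      form (poleGram Φ) (ψ y) (fderiv ℝ ψ y v) (fderiv ℝ ψ y w) := by
  subst hu
  have hc := mfderiv_comp (I := 𝓡 m) (I' := 𝓡 d) (I'' := 𝓡 d) y
    ((Φ.contMDiff (ψ y)).mdifferentiableAt (by simp)) hψ.mdifferentiableAt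
  rw [form_gram_metricForm, poleGram, form_gram_metricForm, hc, ← mfderiv_eq_fderiv]
  rfl

section Smooth

variable [IsManifold (𝓡 d) ∞ M] [IsContMDiffRiemannianBundle (𝓡 d) ∞ (Euc d)
      (fun x : M => TangentSpace (𝓡 d) x)]

/-- The entries are inner products of the vector fields `dΦ(e_i)` along `Φ`, which are smooth as
images under the tangent map. -/
lemma contDiff_poleGram (i j : Fin d) : ContDiff ℝ ∞ (fun x => poleGram Φ x i j) := by
  have h : ∀ v : Euc d, ContMDiff (𝓡 d) (𝓡 d).tangent ∞ (fun x : Euc d =>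
      (⟨Φ x, mfderiv (𝓡 d) (𝓡 d) Φ x v⟩ : TotalSpace (Euc d) fun x : M => TangentSpace (𝓡 d) x)) := by
    intro v
    have h1 : ContMDiff (𝓡 d).tangent (𝓡 d).tangent ∞ (tangentMap (𝓡 d) (𝓡 d) Φ) :=
      Φ.contMDiff.contMDiff_tangentMap (by simp)
    have h2 : ContMDiff (𝓡 d) (𝓡 d).tangent ∞
        (fun x : Euc d => (⟨x, v⟩ : TangentBundle (𝓡 d) (Euc d))) := by
      exact contMDiff_vectorSpace_iff_contDiff.2 contDiff_const
    exact h1.comp h2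
  have := ContMDiff.inner_bundle (h (EuclideanSpace.single i 1)) (h (EuclideanSpace.single j 1))
  exact this.contDiff

lemma isPullback_poleGram {G' : Euc d → Matrix (Fin d) (Fin d) ℝ} {ψ : Euc d → Euc d} {y : Euc d}
    (hψ : ContDiffAt ℝ 3 ψ y) (hJ : IsUnit (fderiv ℝ ψ y))
    (hG : ∀ᶠ z in 𝓝 y, ∀ v w,
      form G' z v w = form (poleGram Φ) (ψ z) (fderiv ℝ ψ z v) (fderiv ℝ ψ z w)) :
    IsPullback (poleGram Φ) G' ψ y where
  contDiffAt := hψ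
  isUnit_fderiv := hJ
  contDiffAt_metric i j := (contDiff_poleGram i j).contDiffAt.of_le ENat.LEInfty.out
  isSymm := Eventually.of_forall isSymm_poleGram
  isUnit_det := isUnit_det_poleGram _
  form_eq := hG

/-- The bridge between the chartwise definitions of curvature and the global coordinates `Φ`. -/
lemma isPullback_chartGram (x : M) :
    IsPullback (poleGram Φ) (chartGram (metricForm d M) x) (Φ.symm ∘ (extChartAt (𝓡 d) x).symm)
      (extChartAt (𝓡 d) x x) := by
  have h3 : ContDiffAt ℝ 3 (Φ.symm ∘ (extChartAt (𝓡 d) x).symm) (extChartAt (𝓡 d) x x) :=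
    (contDiffAt_pole_chart x).of_le ENat.LEInfty.out
  refine isPullback_poleGram h3 (isUnit_fderiv_pole_chart x) ?_
  filter_upwards [h3.eventually (by decide)] with z hz v w
  refine form_gram_eq ?_ (hz.differentiableAt (by norm_num)) v w
  ext z; simp

lemma scalarCurvature_pole (x : Euc d) :
    scalarCurvature (metricForm d M) (Φ x) = scalar (poleGram Φ) x := by
  rw [scalarCurvature, (isPullback_chartGram (Φ := Φ) (Φ x)).scalar_law]
  simp

lemma ricci_pole_ge {κ : ℝ} (h : RicciBoundedBelow (metricForm d M) κ) (x w : Euc d) :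
    κ * form (poleGram Φ) x w w ≤ form (ricci (poleGram Φ)) x w w := by
  have hp := isPullback_chartGram (Φ := Φ) (Φ x)
  obtain ⟨v, rfl⟩ := hp.bijective.2 w
  have h1 := h (Φ x) v.ofLp
  rw [← form_eq_dotProduct, ← form_eq_dotProduct, hp.form_eq.self_of_nhds, hp.ricci_law] at h1
  simpa using h1

/-- The geodesic equation is invariant under changes of coordinates. In the coordinates `Φ` the
geodesics are straight lines with zero acceleration, so only the Christoffel term remains. -/
lemma conn_pole_eq_zero {v : Euc d}
    (h : IsGeodesic (metricForm d M) (fun s : ℝ => Φ (s • v))) (s : ℝ) :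
    conn (poleGram Φ) (s • v) v v = 0 := by
  have hp := isPullback_chartGram (Φ := Φ) (Φ (s • v))
  set x := Φ (s • v) with hx
  set ψ := Φ.symm ∘ (extChartAt (𝓡 d) x).symm with hψ
  set y := extChartAt (𝓡 d) x x with hy
  let c : ℝ → Euc d := fun τ => extChartAt (𝓡 d) x (Φ (τ • v))
  have hcy : c s = y := rfl
  have hψy : ψ y = s • v := by simp [hψ, hy, hx]
  have hc : ContDiffAt ℝ ∞ c s := by
    rw [← contMDiffAt_iff_contDiffAt]
    refine ContMDiffAt.comp (I' := 𝓡 d) s (g := extChartAt (𝓡 d) x) (f := fun τ : ℝ => Φ (τ • v)) ?_ (h.1 s)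
    exact contMDiffAt_extChartAt' (by simp [hx])
  have hc2 : ContDiffAt ℝ 2 c s := hc.of_le ENat.LEInfty.out
  have hd : ∀ᶠ τ in 𝓝 s, DifferentiableAt ℝ c τ :=
    (hc2.eventually (by decide)).mono fun τ hτ => hτ.differentiableAt (by norm_num)
  have hcomp : ∀ i, ∀ᶠ τ in 𝓝 s, deriv (fun τ => c τ i) τ = deriv c τ i := by
    intro i
    filter_upwards [hd] with τ hτ
    exact ((EuclideanSpace.proj i : Euc d →L[ℝ] ℝ).hasFDerivAt.comp_hasDerivAt τ
      hτ.hasDerivAt).deriv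
  have hdc : DifferentiableAt ℝ (deriv c) s := by
    have : ContDiffAt ℝ 1 (fun τ => fderiv ℝ c τ 1) s :=
      (hc2.fderiv_right (by norm_num)).clm_apply contDiffAt_const
    exact this.differentiableAt (by norm_num)
  have hcomp2 : ∀ i, deriv (deriv (fun τ => c τ i)) s = deriv (deriv c) s i := by
    intro i
    rw [EventuallyEq.deriv_eq (hcomp i)]
    exact ((EuclideanSpace.proj i : Euc d →L[ℝ] ℝ).hasFDerivAt.comp_hasDerivAt s
      hdc.hasDerivAt).deriv
  have hgeo : deriv (deriv c) s + conn (chartGram (metricForm d M) x) y (deriv c s) (deriv c s) = 0 := by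
    ext k
    have h2 := h.2 s k
    simp only [PiLp.add_apply, conn_apply, PiLp.zero_apply]
    rw [← hcomp2, ← h2]
    congr 1
    refine Finset.sum_congr rfl fun i _ => Finset.sum_congr rfl fun j _ => ?_
    rw [← (hcomp i).self_of_nhds, ← (hcomp j).self_of_nhds, mul_assoc]
  have hev : ∀ᶠ τ in 𝓝 s, IsPullback (poleGram Φ) (chartGram (metricForm d M) x) ψ (c τ) :=
    hc.continuousAt.eventually hp.eventually
  have hsrc : ∀ᶠ τ in 𝓝 s, ψ (c τ) = τ • v := by
    have : ContinuousAt (fun τ : ℝ => Φ (τ • v)) s := (h.1 s).continuousAt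
    filter_upwards [this.eventually (extChartAt_source_mem_nhds (I := 𝓡 d) x)] with τ hτ
    simp only [hψ, c, Function.comp_apply]
    rw [(extChartAt (𝓡 d) x).left_inv hτ]
    simp
  -- Differentiating `ψ (c τ) = τ v` once gives this; its derivative, `h3` below, expresses `dψ
  -- (c'')` through the second derivative of `ψ`.
  have hfirst : ∀ᶠ τ in 𝓝 s, fderiv ℝ ψ (c τ) (deriv c τ) = v := by
    filter_upwards [hsrc.eventually_nhds, hev, hd] with τ h1 h2 h3
    have h4 := (h2.contDiffAt.differentiableAt (by norm_num)).hasFDerivAt.comp_hasDerivAt τ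
      h3.hasDerivAt
    have h5 : HasDerivAt (fun τ : ℝ => τ • v) v τ := by
      simpa using (hasDerivAt_id τ).smul_const v
    exact h4.unique (h5.congr_of_eventuallyEq h1)
  have h1 : HasFDerivAt (fderiv ℝ ψ) (fderiv ℝ (fderiv ℝ ψ) y) (c s) :=
    ((hp.contDiffAt.fderiv_right (m := 2) (by norm_num)).differentiableAt (by norm_num)).hasFDerivAt
  have h2 := (h1.comp_hasDerivAt s hd.self_of_nhds.hasDerivAt).clm_apply hdc.hasDerivAt
  have h3 := h2.unique ((hasDerivAt_const s v).congr_of_eventuallyEq hfirst)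
  have h4 := hp.conn_law (deriv c s) (deriv c s)
  have h5 := congrArg (fderiv ℝ ψ y) hgeo
  rw [map_add, h4, map_zero] at h5
  have h6 : fderiv ℝ ψ y (deriv c s) = v := hfirst.self_of_nhds
  rw [h6, hψy] at h5
  simp only [Function.comp_apply, hcy] at h3
  have h7 : conn (poleGram Φ) (s • v) v v = (fderiv ℝ ψ y (deriv (deriv c) s)
      + (conn (poleGram Φ) (s • v) v v + fderiv ℝ (fderiv ℝ ψ) y (deriv c s) (deriv c s)))
      - (fderiv ℝ (fderiv ℝ ψ) y (deriv c s) (deriv c s) + fderiv ℝ ψ y (deriv (deriv c) s)) := by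
    abel
  rw [h7, h5, h3, sub_zero]

end Smooth

end Pole

/-! ### The Gauss lemma -/

section GaussLemma

variable {d : ℕ} {G : Euc d → Matrix (Fin d) (Fin d) ℝ}

lemma form_one {x : Euc d} (h : G x = 1) (v w : Euc d) : form G x v w = inner ℝ v w := by
  rw [form_eq_dotProduct, h, Matrix.one_mulVec, EuclideanSpace.inner_eq_star_dotProduct,
    dotProduct_comm]
  simp

lemma hasDerivAt_form_line (hG : ∀ i j, Differentiable ℝ (fun x => G x i j)) (v u w : Euc d)
    (s : ℝ) : HasDerivAt (fun s : ℝ => form G (s • v) u w)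
      (fderiv ℝ (form G) (s • v) v u w) s := by
  have hf : DifferentiableAt ℝ (form G) (s • v) := by
    unfold form
    exact DifferentiableAt.fun_sum fun i _ => DifferentiableAt.fun_sum fun j _ =>
      (hasFDerivAt_smul_const (hG i j _).hasFDerivAt _).differentiableAt
  have h1 : HasDerivAt (fun s : ℝ => s • v) v s := by
    simpa using (hasDerivAt_id s).smul_const v
  have h2 := (hf.hasFDerivAt.comp_hasDerivAt s h1)
  have h3 := (h2.clm_apply (hasDerivAt_const s u)).clm_apply (hasDerivAt_const s w)
  simpa using h3

/-- Radial geodesics have constant speed. -/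
lemma form_radial_radial (hG : ∀ i j, Differentiable ℝ (fun x => G x i j))
    (hs : ∀ x, (G x).IsSymm) (hu : ∀ x, IsUnit (G x).det) (h0 : G 0 = 1)
    (hgeo : ∀ (s : ℝ) (v : Euc d), conn G (s • v) v v = 0) (s : ℝ) (v : Euc d) :
    form G (s • v) v v = inner ℝ v v := by
  -- By the Koszul formula the derivative is `2 G(Γ(v, v), v)`, which vanishes along the ray.
  have hd : ∀ s : ℝ, HasDerivAt (fun s : ℝ => form G (s • v) v v) 0 s := by
    intro s
    have h1 := hasDerivAt_form_line hG v v v s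
    have h2 := form_conn (fun i j => hG i j (s • v)) (hs _) (hu _) v v v
    rw [hgeo] at h2
    simp only [map_zero, zero_apply] at h2
    convert h1 using 1
    linarith
  have := is_const_of_deriv_eq_zero (fun s => (hd s).differentiableAt) (fun s => (hd s).deriv) s 0
  rw [this, form_one (by simpa using h0)]

/-- The Gauss lemma. -/
lemma gauss_lemma (hG : ∀ i j, Differentiable ℝ (fun x => G x i j))
    (hs : ∀ x, (G x).IsSymm) (hu : ∀ x, IsUnit (G x).det) (h0 : G 0 = 1)
    (hgeo : ∀ (s : ℝ) (v : Euc d), conn G (s • v) v v = 0) (v w : Euc d) :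
    form G v v w = inner ℝ v w := by
  have hf : Differentiable ℝ (form G) := by
    intro x
    unfold form
    exact DifferentiableAt.fun_sum fun i _ => DifferentiableAt.fun_sum fun j _ =>
      (hasFDerivAt_smul_const (hG i j _).hasFDerivAt _).differentiableAt
  have hQ : ∀ x : Euc d, form G x x x = inner ℝ x x := fun x => by
    simpa using form_radial_radial hG hs hu h0 hgeo 1 x
  -- Derivative in the direction `w` of the constant-speed identity `G_x(x, x) = |x|²`.
  have hD : ∀ x : Euc d, fderiv ℝ (form G) x w x x + 2 * form G x x w = 2 * inner ℝ x w := by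
    intro x
    have h1 := ((hf x).hasFDerivAt.clm_apply (hasFDerivAt_id x)).clm_apply (hasFDerivAt_id x)
    have h2 := (hasFDerivAt_id (𝕜 := ℝ) x).inner ℝ (hasFDerivAt_id x)
    have h3 : (fun y => form G y (id y) (id y)) = fun y => inner ℝ (id y) (id y) := by
      ext y; exact hQ y
    rw [h3] at h1
    have h4 := congrArg (fun T : Euc d →L[ℝ] ℝ => T w) (h1.unique h2)
    simp [fderivInnerCLM_apply] at h4
    rw [form_symm (hs x) w x, real_inner_comm x w] at h4
    linarith
  -- The defect in the lemma, multiplied by `s` so that it vanishes at `0`. By the Koszul formula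
  -- `∂_v G(v, w) = ½ ∂_w G(v, v)` along the ray, and with `hD` this makes `b' = 0`.
  set b : ℝ → ℝ := fun s => s * form G (s • v) v w - s * inner ℝ v w with hb
  have hd : ∀ s : ℝ, HasDerivAt b 0 s := by
    intro s
    have h1 := hasDerivAt_form_line hG v v w s
    have h2 := form_conn (fun i j => hG i j (s • v)) (hs _) (hu _) v v w
    rw [hgeo] at h2
    simp only [map_zero, zero_apply] at h2
    have h3 := ((hasDerivAt_id s).mul h1).sub ((hasDerivAt_id s).mul_const (inner ℝ v w))
    refine h3.congr_deriv ?_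
    change 1 * form G (s • v) v w + s * _ - 1 * _ = (0 : ℝ)
    rcases eq_or_ne s 0 with rfl | hs0
    · rw [zero_smul, form_one h0]; simp
    · have h4 := hD (s • v)
      simp only [map_smul, smul_apply, smul_eq_mul, real_inner_smul_left] at h4
      have h5 : s * (s * fderiv ℝ (form G) (s • v) w v v + 2 * form G (s • v) v w
          - 2 * inner ℝ v w) = 0 := by linarith
      have h6 := (mul_eq_zero.1 h5).resolve_left hs0
      linear_combination (1 / 2 : ℝ) * h6 - s * h2
  have := is_const_of_deriv_eq_zero (fun s => (hd s).differentiableAt) (fun s => (hd s).deriv) 1 0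
  simp [hb] at this
  linarith

end GaussLemma

/-! ### The exponential map preserves the distance to the pole -/

section Distance

variable {d : ℕ} {M : Type*} [MetricSpace M] [ChartedSpace (Euc d) M]
  [IsManifold (𝓡 d) ∞ M] [RiemannianBundle (fun x : M => TangentSpace (𝓡 d) x)]
  [IsContMDiffRiemannianBundle (𝓡 d) ∞ (Euc d) (fun x : M => TangentSpace (𝓡 d) x)]
  {p : M} {Φ : Euc d ≃ₘ^∞⟮𝓡 d, 𝓡 d⟯ M}

lemma differentiable_poleGram (i j : Fin d) : Differentiable ℝ (fun x => poleGram Φ x i j) :=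
  (contDiff_poleGram i j).differentiable (by simp)

namespace IsPoleExp

lemma form_radial_radial (h : IsPoleExp p Φ) (s : ℝ) (v : Euc d) :
    form (poleGram Φ) (s • v) v v = inner ℝ v v :=
  _root_.form_radial_radial differentiable_poleGram isSymm_poleGram isUnit_det_poleGram h.isometric
    (fun s v => conn_pole_eq_zero (h.geodesic v) s) s v

lemma form_radial (h : IsPoleExp p Φ) (v w : Euc d) :
    form (poleGram Φ) v v w = inner ℝ v w :=
  gauss_lemma differentiable_poleGram isSymm_poleGram isUnit_det_poleGram h.isometric
    (fun s v => conn_pole_eq_zero (h.geodesic v) s) v w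

lemma norm_mfderiv_radial (h : IsPoleExp p Φ) (s : ℝ) (v : Euc d) :
    ‖mfderiv (𝓡 d) (𝓡 d) Φ (s • v) v‖ = ‖v‖ := by
  have h1 := h.form_radial_radial s v
  rw [poleGram, form_gram_metricForm, metricForm, real_inner_self_eq_norm_sq,
    real_inner_self_eq_norm_sq] at h1
  exact (sq_eq_sq₀ (norm_nonneg _) (norm_nonneg _)).1 h1

/-- Gauss lemma and Cauchy–Schwarz: the radius function has gradient of length at most one for the
metric of `M`. -/
lemma abs_inner_le (h : IsPoleExp p Φ) (x w : Euc d) :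
    |inner ℝ x w| ≤ ‖x‖ * ‖mfderiv (𝓡 d) (𝓡 d) Φ x w‖ := by
  rw [← h.form_radial x w, poleGram, form_gram_metricForm]
  have h1 := h.norm_mfderiv_radial 1 x
  rw [one_smul] at h1
  rw [← h1]
  exact abs_real_inner_le_norm _ _

variable [IsRiemannianManifold (𝓡 d) M]

/-- The radial geodesic is a competitor of constant speed `‖v‖`. -/
lemma edist_le (h : IsPoleExp p Φ) (v : Euc d) : edist p (Φ v) ≤ ‖v‖ₑ := by
  rw [IsRiemannianManifold.out (I := 𝓡 d) p (Φ v)]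
  have hγ : ContMDiff 𝓘(ℝ, ℝ) (𝓡 d) 1 (fun s : ℝ => Φ (s • v)) :=
    (h.geodesic v).1.of_le (by simp)
  refine (riemannianEDist_le_pathELength (a := 0) (b := 1) hγ.contMDiffOn
    (by simp [h.map_zero]) (by simp) zero_le_one).trans ?_
  rw [pathELength_eq_lintegral_mfderiv_Icc]
  have hd : ∀ s : ℝ, ‖mfderiv 𝓘(ℝ, ℝ) (𝓡 d) (fun s : ℝ => Φ (s • v)) s 1‖ₑ = ‖v‖ₑ := by
    intro s
    have h5 : HasDerivAt (fun τ : ℝ => τ • v) v s := by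
      simpa using (hasDerivAt_id s).smul_const v
    refine (congrArg (fun z : TangentSpace (𝓡 d) (Φ (s • v)) => ‖z‖ₑ)
      (mfderiv_pole_comp (Φ := Φ) h5)).trans ?_
    rw [enorm_eq_iff_norm_eq]
    exact h.norm_mfderiv_radial s v
  simp [hd]

/-- The length of any `C¹` path is at least the change of its radius. The norm is not differentiable
at the origin, where the path starts, so `√(‖c‖² + ε²)` replaces it until `ε → 0`. -/
lemma le_edist (h : IsPoleExp p Φ) (v : Euc d) : ‖v‖ₑ ≤ edist p (Φ v) := by
  rw [IsRiemannianManifold.out (I := 𝓡 d) p (Φ v)]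
  refine le_of_forall_gt fun r hr => ?_
  obtain ⟨γ, h0, h1, hγ, hlen, -, -⟩ :=
    exists_lt_locally_constant_of_riemannianEDist_lt hr zero_lt_one
  refine lt_of_le_of_lt ?_ hlen
  obtain ⟨c, rfl⟩ : ∃ c : ℝ → Euc d, γ = Φ ∘ c := ⟨Φ.symm ∘ γ, by ext s; simp⟩
  have hcs : ContDiff ℝ 1 c := by
    rw [← contMDiff_iff_contDiff]
    have hcomp := (Φ.symm.contMDiff.of_le (by simp)).comp hγ
    have hce : Φ.symm ∘ Φ ∘ c = c := by ext1 s; simp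
    rwa [hce] at hcomp
  have hc0 : c 0 = 0 := Φ.injective (h0.trans h.map_zero.symm)
  have hc1 : c 1 = v := Φ.injective h1
  have hspeed : ∀ s, mfderiv 𝓘(ℝ, ℝ) (𝓡 d) (Φ ∘ c) s 1 =
      mfderiv (𝓡 d) (𝓡 d) Φ (c s) (deriv c s) := by
    intro s
    exact mfderiv_pole_comp (hcs.differentiable (by simp) s).hasDerivAt
  have key : ∀ ε : ℝ, 0 < ε → ENNReal.ofReal (Real.sqrt (‖v‖ ^ 2 + ε ^ 2) - ε) ≤
      pathELength (𝓡 d) (Φ ∘ c) 0 1 := by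
    intro ε hε
    set F : ℝ → ℝ := fun s => Real.sqrt (‖c s‖ ^ 2 + ε ^ 2) with hF
    have hpos : ∀ s, 0 < ‖c s‖ ^ 2 + ε ^ 2 := fun s => by positivity
    have hFs : ContDiff ℝ 1 F := by
      refine ContDiff.sqrt ?_ fun s => (hpos s).ne'
      exact (hcs.norm_sq ℝ).add contDiff_const
    have hFd : ∀ s, deriv F s = inner ℝ (c s) (deriv c s) / Real.sqrt (‖c s‖ ^ 2 + ε ^ 2) := by
      intro s
      have e1 := (((hcs.differentiable (by simp) s).hasDerivAt.norm_sq).add_const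
        (ε ^ 2)).sqrt (hpos s).ne'
      rw [hF, e1.deriv]
      ring
    have hle := enorm_sub_le_lintegral_deriv_of_contDiffOn_Icc (a := 0) (b := 1)
      hFs.contDiffOn zero_le_one
    have hF10 : ‖F 1 - F 0‖ₑ = ENNReal.ofReal (Real.sqrt (‖v‖ ^ 2 + ε ^ 2) - ε) := by
      have : F 0 = ε := by simp [hF, hc0, Real.sqrt_sq hε.le]
      rw [this, ← ofReal_norm, Real.norm_of_nonneg]
      · simp [hF, hc1]
      · rw [sub_nonneg]
        exact Real.le_sqrt_of_sq_le (by simp [hc1])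
    rw [← hF10]
    refine hle.trans ?_
    rw [pathELength_eq_lintegral_mfderiv_Icc]
    refine lintegral_mono fun s => ?_
    rw [hspeed, hFd]
    refine (ofReal_norm _).symm.le.trans (le_trans ?_ (ofReal_norm _).le)
    refine ENNReal.ofReal_le_ofReal ?_
    rw [Real.norm_eq_abs, abs_div, abs_of_nonneg (Real.sqrt_nonneg _),
      div_le_iff₀ (Real.sqrt_pos.2 (hpos s))]
    exact (h.abs_inner_le (c s) (deriv c s)).trans
      ((mul_comm _ _).le.trans (mul_le_mul_of_nonneg_left
        (Real.le_sqrt_of_sq_le (by nlinarith)) (norm_nonneg _)))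
  rw [← ofReal_norm]
  have hlim : Tendsto (fun ε : ℝ => ENNReal.ofReal (Real.sqrt (‖v‖ ^ 2 + ε ^ 2) - ε)) (𝓝[>] 0)
      (𝓝 (ENNReal.ofReal ‖v‖)) := by
    have hcont : Continuous fun ε : ℝ => ENNReal.ofReal (Real.sqrt (‖v‖ ^ 2 + ε ^ 2) - ε) := by
      exact ENNReal.continuous_ofReal.comp (by fun_prop)
    have := hcont.tendsto 0
    simp only [ne_eq, OfNat.ofNat_ne_zero, not_false_eq_true, zero_pow, add_zero, sub_zero,
      Real.sqrt_sq (norm_nonneg v)] at this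
    exact this.mono_left nhdsWithin_le_nhds
  exact le_of_tendsto hlim (eventually_mem_nhdsWithin.mono fun ε hε => key ε hε)

/-- The exponential map preserves the distance to the pole. -/
lemma dist_eq_norm (h : IsPoleExp p Φ) (v : Euc d) : dist p (Φ v) = ‖v‖ := by
  have h1 := le_antisymm (h.edist_le v) (h.le_edist v)
  rw [edist_dist, ← ofReal_norm] at h1
  exact (ENNReal.ofReal_eq_ofReal_iff dist_nonneg (norm_nonneg _)).1 h1

end IsPoleExp

end Distance

/-! ### Metrics of the form `ds² + h_s`: the Riccati and Gauss equations -/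

namespace Coord

variable {n : ℕ}

/-- The point of `ℝ^{n+1}` with first coordinate `s` and remaining coordinates `y`. -/
def consPoint (s : ℝ) (y : Euc n) : Euc (n + 1) := WithLp.toLp 2 (Fin.cons s y.ofLp)

/-- The spatial block of a metric on `ℝ^{n+1}`. -/
def spatial (G : Euc (n + 1) → Matrix (Fin (n + 1)) (Fin (n + 1)) ℝ) (z : Euc (n + 1)) :
    Matrix (Fin n) (Fin n) ℝ := (G z).submatrix Fin.succ Fin.succ

/-- The derivative of the spatial block in the first coordinate. -/
def spatialDot (G : Euc (n + 1) → Matrix (Fin (n + 1)) (Fin (n + 1)) ℝ) (z : Euc (n + 1)) :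
    Matrix (Fin n) (Fin n) ℝ := Matrix.of fun i j => pd 0 (fun x => spatial G x i j) z

/-- The shape operator `½ h⁻¹ ∂_s h` of the slices. -/
def shape (G : Euc (n + 1) → Matrix (Fin (n + 1)) (Fin (n + 1)) ℝ) (z : Euc (n + 1)) :
    Matrix (Fin n) (Fin n) ℝ := (1 / 2 : ℝ) • ((spatial G z)⁻¹ * spatialDot G z)

/-- Near `z`, the metric `G` has the form `ds² + h_s`. -/
structure IsBlock (G : Euc (n + 1) → Matrix (Fin (n + 1)) (Fin (n + 1)) ℝ) (z : Euc (n + 1)) :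
    Prop where
  contDiffAt : ∀ i j, ContDiffAt ℝ 2 (fun x => G x i j) z
  isSymm : ∀ᶠ x in 𝓝 z, (G x).IsSymm
  zero_zero : ∀ᶠ x in 𝓝 z, G x 0 0 = 1
  zero_succ : ∀ᶠ x in 𝓝 z, ∀ j : Fin n, G x 0 j.succ = 0
  isUnit_det : IsUnit (spatial G z).det

lemma pd_congr {m : ℕ} {f g : Euc m → ℝ} {z : Euc m} (h : f =ᶠ[𝓝 z] g) (i : Fin m) :
    pd i f z = pd i g z := by
  rw [pd, pd, h.fderiv_eq]

lemma pd_of_eventually_const {m : ℕ} {f : Euc m → ℝ} {z : Euc m} {c : ℝ}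
    (h : ∀ᶠ x in 𝓝 z, f x = c) (i : Fin m) : pd i f z = 0 := by
  rw [pd_congr (g := fun _ => c) h, pd]; simp

lemma pd_sum {m : ℕ} {ι : Type*} (t : Finset ι) {f : ι → Euc m → ℝ} {z : Euc m}
    (h : ∀ a ∈ t, DifferentiableAt ℝ (f a) z) (i : Fin m) :
    pd i (fun x => ∑ a ∈ t, f a x) z = ∑ a ∈ t, pd i (f a) z := by
  simp [pd, fderiv_fun_sum h]

lemma pd_mul {m : ℕ} {f g : Euc m → ℝ} {z : Euc m} (hf : DifferentiableAt ℝ f z)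
    (hg : DifferentiableAt ℝ g z) (i : Fin m) :
    pd i (fun x => f x * g x) z = pd i f z * g z + f z * pd i g z := by
  simp [pd, fderiv_fun_mul hf hg]; ring

lemma pd_const_mul {m : ℕ} {f : Euc m → ℝ} {z : Euc m} (hf : DifferentiableAt ℝ f z) (c : ℝ)
    (i : Fin m) : pd i (fun x => c * f x) z = c * pd i f z := by
  simp [pd, fderiv_const_mul hf]

lemma hasFDerivAt_consPoint (s : ℝ) (y : Euc n) : ∃ L : Euc n →L[ℝ] Euc (n + 1),
    HasFDerivAt (consPoint s) L y ∧
      ∀ i, L (EuclideanSpace.single i 1) = EuclideanSpace.single i.succ 1 := by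
  let L0 : Euc n →ₗ[ℝ] Euc (n + 1) :=
    { toFun := fun v => consPoint 0 v
      map_add' := fun a b => by
        ext k; refine Fin.cases ?_ (fun k => ?_) k <;> simp [consPoint]
      map_smul' := fun c a => by
        ext k; refine Fin.cases ?_ (fun k => ?_) k <;> simp [consPoint] }
  refine ⟨LinearMap.toContinuousLinearMap L0, ?_, fun i => ?_⟩
  · have h := (LinearMap.toContinuousLinearMap L0).hasFDerivAt (x := y)
    have h2 := h.add_const (consPoint s 0)
    refine h2.congr_of_eventuallyEq (Eventually.of_forall fun v => ?_)
    ext k; refine Fin.cases ?_ (fun k => ?_) k <;> simp [consPoint, L0]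
  · ext k; refine Fin.cases ?_ (fun k => ?_) k
    · simp [consPoint, L0]
    · simp [consPoint, L0, Pi.single_apply]

lemma pd_comp_consPoint {f : Euc (n + 1) → ℝ} {s : ℝ} {y : Euc n}
    (hf : DifferentiableAt ℝ f (consPoint s y)) (i : Fin n) :
    pd i (fun x => f (consPoint s x)) y = pd i.succ f (consPoint s y) := by
  obtain ⟨L, hL, hLs⟩ := hasFDerivAt_consPoint s y
  have h := hf.hasFDerivAt.comp y hL
  rw [pd, pd, show (fun x => f (consPoint s x)) = f ∘ consPoint s from rfl, h.fderiv]
  simp [hLs]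

lemma continuous_consPoint (s : ℝ) : Continuous (consPoint (n := n) s) :=
  continuous_iff_continuousAt.2 fun y =>
    (hasFDerivAt_consPoint s y).choose_spec.1.continuousAt

namespace IsBlock

variable {G : Euc (n + 1) → Matrix (Fin (n + 1)) (Fin (n + 1)) ℝ} {z : Euc (n + 1)}

/-- The Christoffel symbols below are computed pointwise; openness allows these formulas to be
differentiated. -/
lemma eventually (h : IsBlock G z) : ∀ᶠ x in 𝓝 z, IsBlock G x := by
  have e1 : ∀ᶠ x in 𝓝 z, ∀ i j, ContDiffAt ℝ 2 (fun x => G x i j) x :=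
    eventually_all.2 fun i => eventually_all.2 fun j => (h.contDiffAt i j).eventually (by decide)
  have e2 : ∀ᶠ x in 𝓝 z, IsUnit (spatial G x).det := by
    simp only [isUnit_iff_ne_zero]
    exact (contDiffAt_det (A := spatial G) (k := 2) fun i j =>
      h.contDiffAt i.succ j.succ).continuousAt.eventually_ne h.isUnit_det.ne_zero
  filter_upwards [e1, e2, h.isSymm.eventually_nhds, h.zero_zero.eventually_nhds,
    h.zero_succ.eventually_nhds] with x a b c d e using ⟨a, c, d, e, b⟩

lemma zero_zero' (h : IsBlock G z) : G z 0 0 = 1 := h.zero_zero.self_of_nhds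

lemma zero_succ' (h : IsBlock G z) (j : Fin n) : G z 0 j.succ = 0 := h.zero_succ.self_of_nhds j

lemma succ_zero (h : IsBlock G z) (j : Fin n) : G z j.succ 0 = 0 := by
  rw [← h.isSymm.self_of_nhds.apply, h.zero_succ']

lemma isSymm_spatial (h : IsBlock G z) : (spatial G z).IsSymm :=
  h.isSymm.self_of_nhds.submatrix _

lemma isSymm_spatialDot (h : IsBlock G z) : (spatialDot G z).IsSymm := by
  refine Matrix.IsSymm.ext fun i j => ?_
  refine pd_congr ?_ 0
  filter_upwards [h.eventually] with x hx
  exact hx.isSymm_spatial.apply _ _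

lemma differentiableAt (h : IsBlock G z) (i j) : DifferentiableAt ℝ (fun x => G x i j) z :=
  (h.contDiffAt i j).differentiableAt (by norm_num)

lemma pd_zero_zero (h : IsBlock G z) (l : Fin (n + 1)) : pd l (fun x => G x 0 0) z = 0 :=
  pd_of_eventually_const h.zero_zero l

lemma pd_zero_succ (h : IsBlock G z) (l : Fin (n + 1)) (j : Fin n) :
    pd l (fun x => G x 0 j.succ) z = 0 :=
  pd_of_eventually_const (h.zero_succ.mono fun _ hx => hx j) l

lemma pd_succ_zero (h : IsBlock G z) (l : Fin (n + 1)) (j : Fin n) :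
    pd l (fun x => G x j.succ 0) z = 0 :=
  pd_of_eventually_const (h.eventually.mono fun _ hx => hx.succ_zero j) l

lemma inv_apply (h : IsBlock G z) : (G z)⁻¹ 0 0 = 1 ∧ (∀ j : Fin n, (G z)⁻¹ 0 j.succ = 0) ∧
    (∀ j : Fin n, (G z)⁻¹ j.succ 0 = 0) ∧
    ∀ i j : Fin n, (G z)⁻¹ i.succ j.succ = (spatial G z)⁻¹ i j := by
  let N : Matrix (Fin (n + 1)) (Fin (n + 1)) ℝ := Matrix.of fun i j =>
    Fin.cases (Fin.cases 1 (fun _ => 0) j) (fun i' => Fin.cases 0 (fun j' => (spatial G z)⁻¹ i' j') j) i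
  have hN : G z * N = 1 := by
    have hinv := Matrix.mul_nonsing_inv _ h.isUnit_det
    ext i j
    rw [Matrix.mul_apply, Fin.sum_univ_succ]
    refine Fin.cases ?_ (fun i => ?_) i <;> refine Fin.cases ?_ (fun j => ?_) j
    · simp [N, h.zero_zero', h.zero_succ']
    · simp [N, h.zero_succ', (Fin.succ_ne_zero j).symm]
    · simp [N, h.succ_zero]
    · have := congrFun (congrFun hinv i) j
      rw [Matrix.mul_apply] at this
      simpa [N, h.succ_zero, spatial, Matrix.one_apply, Fin.succ_inj] using this
  rw [Matrix.inv_eq_right_inv hN]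
  simp [N]

lemma christoffel_zero_zero_zero (h : IsBlock G z) : christoffel G 0 0 0 z = 0 := by
  obtain ⟨i1, i2, i3, i4⟩ := h.inv_apply
  simp [christoffel, Fin.sum_univ_succ, i1, i2, h.pd_zero_zero]

lemma christoffel_zero_zero_succ (h : IsBlock G z) (j : Fin n) :
    christoffel G 0 0 j.succ z = 0 := by
  obtain ⟨i1, i2, i3, i4⟩ := h.inv_apply
  simp [christoffel, Fin.sum_univ_succ, i1, i2, h.pd_zero_zero, h.pd_zero_succ, h.pd_succ_zero]

lemma christoffel_zero_succ_zero (h : IsBlock G z) (j : Fin n) :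
    christoffel G 0 j.succ 0 z = 0 := by
  obtain ⟨i1, i2, i3, i4⟩ := h.inv_apply
  simp [christoffel, Fin.sum_univ_succ, i1, i2, h.pd_zero_zero, h.pd_zero_succ, h.pd_succ_zero]

lemma christoffel_succ_zero_zero (h : IsBlock G z) (i : Fin n) :
    christoffel G i.succ 0 0 z = 0 := by
  obtain ⟨i1, i2, i3, i4⟩ := h.inv_apply
  simp [christoffel, Fin.sum_univ_succ, i3, h.pd_zero_zero, h.pd_zero_succ]

lemma christoffel_zero_succ_succ (h : IsBlock G z) (i j : Fin n) :
    christoffel G 0 i.succ j.succ z = -(1 / 2) * spatialDot G z i j := by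
  obtain ⟨i1, i2, i3, i4⟩ := h.inv_apply
  simp [christoffel, Fin.sum_univ_succ, i1, i2, h.pd_succ_zero, spatialDot, spatial]

lemma christoffel_succ_zero_succ (h : IsBlock G z) (i j : Fin n) :
    christoffel G i.succ 0 j.succ z = shape G z i j := by
  obtain ⟨i1, i2, i3, i4⟩ := h.inv_apply
  simp only [christoffel, Fin.sum_univ_succ, i3, i4, h.pd_zero_succ, shape, Matrix.smul_apply,
    Matrix.mul_apply, smul_eq_mul]
  simp only [zero_mul, zero_add, add_zero, sub_zero]
  congr 1
  refine Finset.sum_congr rfl fun l _ => ?_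
  rw [← h.isSymm_spatialDot.apply l j]
  rfl

lemma christoffel_succ_succ_zero (h : IsBlock G z) (i j : Fin n) :
    christoffel G i.succ j.succ 0 z = shape G z i j := by
  obtain ⟨i1, i2, i3, i4⟩ := h.inv_apply
  simp only [christoffel, Fin.sum_univ_succ, i3, i4, h.pd_zero_succ, h.pd_succ_zero, shape,
    Matrix.smul_apply, Matrix.mul_apply, smul_eq_mul]
  simp only [zero_mul, zero_add, sub_zero]
  congr 1
  refine Finset.sum_congr rfl fun l _ => ?_
  rw [← h.isSymm_spatialDot.apply l j]
  rfl

lemma christoffel_succ_succ_succ {s : ℝ} {y : Euc n} (h : IsBlock G (consPoint s y))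
    (k i j : Fin n) : christoffel G k.succ i.succ j.succ (consPoint s y) =
      christoffel (fun x => spatial G (consPoint s x)) k i j y := by
  obtain ⟨i1, i2, i3, i4⟩ := h.inv_apply
  have hp : ∀ a b c : Fin n, pd a (fun x => spatial G (consPoint s x) b c) y =
      pd a.succ (fun x => G x b.succ c.succ) (consPoint s y) := fun a b c =>
    pd_comp_consPoint (h.differentiableAt b.succ c.succ) a
  simp only [christoffel, Fin.sum_univ_succ, i3, i4, hp]
  simp

lemma isUnit_det_metric (h : IsBlock G z) : IsUnit (G z).det := by
  rw [Matrix.det_succ_row_zero, Fin.sum_univ_succ]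
  simp only [h.zero_zero', h.zero_succ']
  have := h.isUnit_det
  rw [spatial] at this
  simpa using this

lemma contDiffAt_christoffel (h : IsBlock G z) (a i j : Fin (n + 1)) :
    ContDiffAt ℝ 1 (christoffel G a i j) z :=
  Coord.contDiffAt_christoffel (by norm_num) h.contDiffAt h.isUnit_det_metric a i j

lemma differentiableAt_shape (h : IsBlock G z) (i j : Fin n) :
    DifferentiableAt ℝ (fun x => shape G x i j) z := by
  have h1 := (h.contDiffAt_christoffel i.succ 0 j.succ).differentiableAt (by norm_num)
  refine h1.congr_of_eventuallyEq ?_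
  filter_upwards [h.eventually] with x hx
  rw [hx.christoffel_succ_zero_succ]

lemma differentiableAt_spatialDot (h : IsBlock G z) (i j : Fin n) :
    DifferentiableAt ℝ (fun x => spatialDot G x i j) z :=
  (contDiffAt_pd (k := 1) (h.contDiffAt i.succ j.succ) (by norm_num) 0).differentiableAt
    (by norm_num)

/-- The Riccati equation of the slices. -/
lemma ricci_zero_zero (h : IsBlock G z) : ricci G z 0 0 =
    -(∑ i, pd 0 (fun x => shape G x i i) z) - (shape G z * shape G z).trace := by
  have r0 : riemann G 0 0 0 0 z = 0 := by simp [riemann]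
  have ri : ∀ i : Fin n, riemann G i.succ 0 i.succ 0 z =
      -pd 0 (fun x => shape G x i i) z - (shape G z * shape G z) i i := by
    intro i
    have e1 : pd i.succ (christoffel G i.succ 0 0) z = 0 :=
      pd_of_eventually_const (h.eventually.mono fun x hx => hx.christoffel_succ_zero_zero i) _
    have e2 : pd 0 (christoffel G i.succ i.succ 0) z = pd 0 (fun x => shape G x i i) z :=
      pd_congr (h.eventually.mono fun x hx => hx.christoffel_succ_succ_zero i i) _
    simp only [riemann, e1, e2, Fin.sum_univ_succ, h.christoffel_zero_zero_zero,
      h.christoffel_succ_zero_zero, h.christoffel_zero_succ_zero, h.christoffel_succ_zero_succ,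
      h.christoffel_succ_succ_zero, Matrix.mul_apply]
    simp [sub_eq_add_neg]
  simp only [ricci, Matrix.of_apply, Fin.sum_univ_succ, r0, ri, Matrix.trace, Matrix.diag_apply,
    Finset.sum_sub_distrib, Finset.sum_neg_distrib, zero_add]

/-- The derivative of `h' = 2 h S`, that is `h'' = 2 (h' S + h S')`. -/
lemma pd_spatialDot (h : IsBlock G z) (i j : Fin n) :
    pd 0 (fun x => spatialDot G x i j) z = 2 * ((spatialDot G z * shape G z) i j
      + ∑ a, spatial G z i a * pd 0 (fun x => shape G x a j) z) := by
  have e : (fun x => spatialDot G x i j) =ᶠ[𝓝 z]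
      fun x => 2 * ∑ a, spatial G x i a * shape G x a j := by
    filter_upwards [h.eventually] with x hx
    rw [← Matrix.mul_apply, shape, Matrix.mul_smul, ← Matrix.mul_assoc,
      Matrix.mul_nonsing_inv _ hx.isUnit_det, Matrix.one_mul, Matrix.smul_apply, smul_eq_mul]
    ring
  have hd : ∀ a, DifferentiableAt ℝ (fun x => spatial G x i a) z := fun a =>
    h.differentiableAt i.succ a.succ
  rw [pd_congr e, pd_const_mul (DifferentiableAt.fun_sum fun a _ =>
    (hd a).fun_mul (h.differentiableAt_shape a j)),
    pd_sum _ fun a _ => (hd a).fun_mul (h.differentiableAt_shape a j)]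
  simp only [fun a => pd_mul (hd a) (h.differentiableAt_shape a j) 0, Finset.sum_add_distrib,
    Matrix.mul_apply]
  rfl

/-- The normal index of the contraction contributes `-½ h'' + ½ h' S`; each tangential one
contributes the intrinsic curvature and the quadratic terms of the Gauss equation. -/
lemma ricci_succ_succ {s : ℝ} {y : Euc n} (h : IsBlock G (consPoint s y)) (k j : Fin n) :
    ricci G (consPoint s y) k.succ j.succ = ricci (fun x => spatial G (consPoint s x)) y k j
      - (1 / 2) * pd 0 (fun x => spatialDot G x j k) (consPoint s y)
      + (1 / 2) * (spatialDot G (consPoint s y) * shape G (consPoint s y)) j k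
      - (1 / 2) * (shape G (consPoint s y)).trace * spatialDot G (consPoint s y) j k
      + (1 / 2) * ((spatialDot G (consPoint s y))ᵀ * shape G (consPoint s y)) k j := by
  set z := consPoint s y with hz
  have r0 : riemann G 0 k.succ 0 j.succ z = -(1 / 2) * pd 0 (fun x => spatialDot G x j k) z
      + (1 / 2) * (spatialDot G z * shape G z) j k := by
    have e1 : pd j.succ (christoffel G 0 0 k.succ) z = 0 :=
      pd_of_eventually_const (h.eventually.mono fun x hx => hx.christoffel_zero_zero_succ k) _
    have e2 : pd 0 (christoffel G 0 j.succ k.succ) z =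
        -(1 / 2) * pd 0 (fun x => spatialDot G x j k) z := by
      rw [pd_congr (h.eventually.mono fun x hx => hx.christoffel_zero_succ_succ j k),
        pd_const_mul (h.differentiableAt_spatialDot j k)]
    simp only [riemann, e1, e2, Fin.sum_univ_succ, h.christoffel_zero_zero_zero,
      h.christoffel_zero_zero_succ, h.christoffel_zero_succ_zero, h.christoffel_zero_succ_succ,
      h.christoffel_succ_zero_succ, Matrix.mul_apply, Finset.mul_sum]
    simp [mul_assoc]
  have hev : ∀ᶠ x in 𝓝 y, IsBlock G (consPoint s x) :=
    (continuous_consPoint s).continuousAt.eventually h.eventually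
  have hpd : ∀ a b c e : Fin n, pd a.succ (christoffel G b.succ c.succ e.succ) z =
      pd a (christoffel (fun x => spatial G (consPoint s x)) b c e) y := by
    intro a b c e
    rw [← pd_congr (f := fun x => christoffel G b.succ c.succ e.succ (consPoint s x))
      (hev.mono fun x hx => hx.christoffel_succ_succ_succ b c e)]
    exact (pd_comp_consPoint
      ((h.contDiffAt_christoffel _ _ _).differentiableAt (by norm_num)) a).symm
  have ri : ∀ i : Fin n, riemann G i.succ k.succ i.succ j.succ z =
      riemann (fun x => spatial G (consPoint s x)) i k i j y
      - (1 / 2) * (shape G z i i * spatialDot G z j k)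
      + (1 / 2) * (spatialDot G z i k * shape G z i j) := by
    intro i
    simp only [riemann, hpd, Fin.sum_univ_succ, h.christoffel_zero_succ_succ,
      h.christoffel_succ_succ_zero]
    simp only [hz, h.christoffel_succ_succ_succ]
    ring
  simp only [ricci, Matrix.of_apply, Fin.sum_univ_succ, r0, ri, Finset.sum_add_distrib,
    Finset.sum_sub_distrib, ← Finset.mul_sum, Matrix.trace, Matrix.diag_apply]
  rw [← Finset.sum_mul, Matrix.mul_apply (M := (spatialDot G z)ᵀ)]
  simp only [Matrix.transpose_apply]
  ring

/-- The traced Gauss equation of the slices. -/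
lemma scalar_eq {s : ℝ} {y : Euc n} (h : IsBlock G (consPoint s y)) :
    scalar G (consPoint s y) = scalar (fun x => spatial G (consPoint s x)) y
      - 2 * ∑ i, pd 0 (fun x => shape G x i i) (consPoint s y)
      - (shape G (consPoint s y)).trace ^ 2
      - (shape G (consPoint s y) * shape G (consPoint s y)).trace := by
  obtain ⟨i1, i2, i3, i4⟩ := h.inv_apply
  have hR := h.ricci_succ_succ
  have h00 := h.ricci_zero_zero
  have hpd := h.pd_spatialDot
  have hs := h.isSymm_spatial
  have hb := h.isSymm_spatialDot
  have hu := h.isUnit_det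
  set z := consPoint s y with hz
  set h' := spatial G z with hh'
  set B := spatialDot G z with hB
  set S := shape G z with hS
  have hSd : h'⁻¹ * B = (2 : ℝ) • S := by rw [hS, shape, smul_smul]; norm_num [hh', hB]
  let S' : Matrix (Fin n) (Fin n) ℝ := Matrix.of fun i j => pd 0 (fun x => shape G x i j) z
  have hB' : (Matrix.of fun i j => pd 0 (fun x => spatialDot G x i j) z) =
      (2 : ℝ) • (B * S + h' * S') := by
    ext i j; simp [hpd, Matrix.mul_apply, S']
  let Rh : Matrix (Fin n) (Fin n) ℝ := ricci (fun x => spatial G (consPoint s x)) y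
  have hRm : (Matrix.of fun k j : Fin n => ricci G z k.succ j.succ) =
      Rh - (1 / 2 : ℝ) • ((2 : ℝ) • (B * S + h' * S'))ᵀ + (1 / 2 : ℝ) • (B * S)ᵀ
        - ((1 / 2 : ℝ) * S.trace) • Bᵀ + (1 / 2 : ℝ) • (Bᵀ * S) := by
    rw [← hB']
    ext k j
    simp [hR, Rh, -Matrix.transpose_mul, Matrix.transpose_apply]
  have hsum : scalar G z = (h'⁻¹ * (Matrix.of fun k j : Fin n => ricci G z k.succ j.succ)ᵀ).trace
      + ricci G z 0 0 := by
    simp only [scalar, Fin.sum_univ_succ, i1, i2, i3, i4, Matrix.trace, Matrix.diag_apply,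
      Matrix.mul_apply, Matrix.transpose_apply, Matrix.of_apply]
    simp [add_comm]
  have hKh : h'⁻¹ * h' = 1 := Matrix.nonsing_inv_mul _ hu
  have hKs : (h'⁻¹)ᵀ = h'⁻¹ := by rw [Matrix.transpose_nonsing_inv, hs.eq]
  have t1 : (h'⁻¹ * (B * S)).trace = 2 * (S * S).trace := by
    rw [← Matrix.mul_assoc, hSd, Matrix.smul_mul, Matrix.trace_smul, smul_eq_mul]
  have t2 : (h'⁻¹ * (h' * S')).trace = ∑ i, pd 0 (fun x => shape G x i i) z := by
    rw [← Matrix.mul_assoc, hKh, Matrix.one_mul]; simp [Matrix.trace, S']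
  have t3 : (h'⁻¹ * B).trace = 2 * S.trace := by rw [hSd, Matrix.trace_smul, smul_eq_mul]
  have t4 : (h'⁻¹ * (Sᵀ * B)).trace = 2 * (S * S).trace := by
    rw [← t1, ← Matrix.trace_transpose, Matrix.transpose_mul, Matrix.transpose_mul,
      Matrix.transpose_transpose, hKs, hb.eq, Matrix.trace_mul_comm]
  -- In the tangential trace the multiples of `tr S²` cancel, leaving `R_h - tr S' - (tr S)²`; the
  -- normal component adds `-tr S' - tr S²`.
  rw [hsum, hRm, h00, scalar_eq_trace (fun x => spatial G (consPoint s x))]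
  simp only [Matrix.transpose_add, Matrix.transpose_sub, Matrix.transpose_smul,
    Matrix.transpose_transpose, Matrix.transpose_mul, Matrix.mul_add, Matrix.mul_sub,
    Matrix.mul_smul, Matrix.trace_add, Matrix.trace_sub, Matrix.trace_smul, smul_eq_mul, t1, t2,
    t3, t4]
  change _ = (h'⁻¹ * Rhᵀ).trace - _ - _ - _
  ring

end IsBlock

end Coord

/-! ### Jacobi's formula and a trace inequality -/

section LinearAlgebra

variable {ι : Type*} [Fintype ι] [DecidableEq ι]

lemma trace_adjugate_mul (A B : Matrix ι ι ℝ) :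
    (A.adjugate * B).trace = ∑ i, (A.updateCol i fun j => B j i).det := by
  simp only [Matrix.trace, Matrix.diag_apply]
  refine Finset.sum_congr rfl fun i _ => ?_
  rw [← Matrix.cramer_apply, Matrix.cramer_eq_adjugate_mulVec]
  rfl

/-- Jacobi's formula for the derivative of a determinant. -/
lemma hasDerivAt_det {A : ℝ → Matrix ι ι ℝ} {A' : Matrix ι ι ℝ} {s : ℝ}
    (h : ∀ i j, HasDerivAt (fun t => A t i j) (A' i j) s) :
    HasDerivAt (fun t => (A t).det) (((A s).adjugate * A').trace) s := by
  have h1 : HasDerivAt (fun t => (A t).det) (∑ σ : Equiv.Perm ι, ((Equiv.Perm.sign σ : ℤ) : ℝ) *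
      ∑ i, (∏ j ∈ Finset.univ.erase i, A s (σ j) j) • A' (σ i) i) s := by
    simp only [Matrix.det_apply']
    exact HasDerivAt.fun_sum fun σ _ =>
      (HasDerivAt.fun_finsetProd fun i _ => h (σ i) i).const_mul _
  refine h1.congr_deriv ?_
  rw [trace_adjugate_mul]
  simp only [Matrix.det_apply', Finset.mul_sum]
  rw [Finset.sum_comm]
  refine Finset.sum_congr rfl fun i _ => Finset.sum_congr rfl fun σ _ => ?_
  rw [← Finset.mul_prod_erase _ _ (Finset.mem_univ i)]
  have : ∏ j ∈ Finset.univ.erase i, ((A s).updateCol i fun j => A' j i) (σ j) j =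
      ∏ j ∈ Finset.univ.erase i, A s (σ j) j :=
    Finset.prod_congr rfl fun j hj => Matrix.updateCol_ne (Finset.ne_of_mem_erase hj)
  rw [this, Matrix.updateCol_self, smul_eq_mul]
  ring

open scoped MatrixOrder in
-- With `h⁻¹ = Cᵀ C` the trace is the sum of the squared entries of the symmetric matrix `C B Cᵀ`.
lemma trace_inv_mul_sq_nonneg {h B : Matrix ι ι ℝ} (hh : h.PosDef) (hB : B.IsSymm) :
    0 ≤ (h⁻¹ * B * (h⁻¹ * B)).trace := by
  obtain ⟨C, hC⟩ := CStarAlgebra.nonneg_iff_eq_star_mul_self.1 hh.inv.posSemidef.nonneg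
  rw [Matrix.star_eq_conjTranspose, Matrix.conjTranspose_eq_transpose_of_trivial] at hC
  set X : Matrix ι ι ℝ := C * B * Cᵀ with hX
  have hXs : Xᵀ = X := by
    simp [hX, Matrix.transpose_mul, hB.eq, Matrix.mul_assoc]
  have h1 : (h⁻¹ * B * (h⁻¹ * B)).trace = (X * Xᵀ).trace := by
    rw [hXs, hC, hX]
    calc (Cᵀ * C * B * (Cᵀ * C * B)).trace = (Cᵀ * (C * B * Cᵀ * C * B)).trace := by
          simp only [Matrix.mul_assoc]
      _ = _ := by rw [Matrix.trace_mul_comm]; simp only [Matrix.mul_assoc]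
  rw [h1]
  simp only [Matrix.trace, Matrix.diag_apply, Matrix.mul_apply, Matrix.transpose_apply]
  exact Finset.sum_nonneg fun i _ => Finset.sum_nonneg fun j _ => mul_self_nonneg _

/-- The Cauchy–Schwarz inequality `(tr S)² ≤ n tr S²` for an operator `S = ½ h⁻¹ B` which is
self-adjoint for `h`. -/
lemma sq_trace_le {h B : Matrix ι ι ℝ} (hh : h.PosDef) (hB : B.IsSymm) :
    (((1 / 2 : ℝ) • (h⁻¹ * B)).trace) ^ 2 ≤
      Fintype.card ι * (((1 / 2 : ℝ) • (h⁻¹ * B)) * ((1 / 2 : ℝ) • (h⁻¹ * B))).trace := by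
  rcases isEmpty_or_nonempty ι with hι | hι
  · simp [Matrix.trace]
  have hu : IsUnit h.det := hh.det_pos.ne'.isUnit
  set S := (1 / 2 : ℝ) • (h⁻¹ * B) with hS
  set N : ℝ := (Fintype.card ι : ℝ) with hN
  have hN0 : 0 < N := by positivity
  have hsymm : h.IsSymm := by
    have := hh.isHermitian
    rwa [Matrix.IsHermitian, Matrix.conjTranspose_eq_transpose_of_trivial] at this
  -- Applied to the trace-free part `S - (tr S / n) 1`, whose square has trace `tr S² - (tr S)² /
  -- n`.
  have h1 := trace_inv_mul_sq_nonneg hh (B := (1 / 2 : ℝ) • B - (S.trace / N) • h)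
    ((hB.smul _).sub (hsymm.smul _))
  have h2 : h⁻¹ * ((1 / 2 : ℝ) • B - (S.trace / N) • h) = S - (S.trace / N) • 1 := by
    rw [Matrix.mul_sub, Matrix.mul_smul, Matrix.mul_smul, Matrix.nonsing_inv_mul _ hu]
  rw [h2] at h1
  simp only [Matrix.sub_mul, Matrix.mul_sub, Matrix.smul_mul, Matrix.mul_smul, Matrix.one_mul,
    Matrix.mul_one, Matrix.trace_sub, Matrix.trace_smul, Matrix.trace_one, smul_eq_mul] at h1
  rw [← hN] at h1
  have h3 : (S * S).trace - S.trace / N * S.trace -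
      S.trace / N * (S.trace - S.trace / N * N) =
      (S * S).trace - S.trace ^ 2 / N := by field_simp; ring
  rw [h3, sub_nonneg, div_le_iff₀ hN0] at h1
  linarith

end LinearAlgebra

/-! ### Stereographic charts of the unit sphere -/

section SphereChart

variable {n : ℕ}

/-- The inverse of the preferred chart of the sphere at `θ`, as a map into `ℝ^{n+1}`. -/
def sphChart (θ : Sph n) (y : Euc n) : Euc (n + 1) := ((extChartAt (𝓡 n) θ).symm y : Sph n)

lemma sphChart_center (θ : Sph n) : sphChart θ (extChartAt (𝓡 n) θ θ) = θ := by
  simp [sphChart]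

lemma norm_sphChart (θ : Sph n) (y : Euc n) : ‖sphChart θ y‖ = 1 := by
  simp [sphChart]

/-- The preferred charts are stereographic projections, whose targets are the whole space; hence
smoothness is global. -/
lemma contDiff_sphChart (θ : Sph n) : ContDiff ℝ ∞ (sphChart θ) := by
  have := Fact.mk (@finrank_euclideanSpace_fin ℝ _ (n + 1))
  have ht : (extChartAt (𝓡 n) θ).target = Set.univ := by
    have : (chartAt (EuclideanSpace ℝ (Fin n)) θ).target = Set.univ :=
      stereographic'_target (n := n) (-θ)
    simp [this]
  have h1 : ContMDiffOn (𝓡 n) (𝓡 n) ∞ (extChartAt (𝓡 n) θ).symm Set.univ := by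
    rw [← ht]; exact contMDiffOn_extChartAt_symm θ
  rw [← contMDiff_iff_contDiff]
  exact contMDiff_coe_sphere.comp (contMDiffOn_univ.1 h1)

lemma inner_sphChart_fderiv (θ : Sph n) (y v : Euc n) :
    inner ℝ (sphChart θ y) (fderiv ℝ (sphChart θ) y v) = 0 := by
  have hd : DifferentiableAt ℝ (sphChart θ) y := (contDiff_sphChart θ).differentiable (by simp) y
  have h1 := hd.hasFDerivAt.inner ℝ hd.hasFDerivAt
  have h2 : (fun y => inner ℝ (sphChart θ y) (sphChart θ y)) = fun _ => (1 : ℝ) := by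
    ext y; rw [real_inner_self_eq_norm_sq, norm_sphChart]; norm_num
  rw [h2] at h1
  have h3 := congrArg (fun T : Euc n →L[ℝ] ℝ => T v) (h1.unique (hasFDerivAt_const _ _))
  simp [fderivInnerCLM_apply] at h3
  rw [real_inner_comm (sphChart θ y)] at h3
  linarith

lemma injective_mfderiv_coe_sphere (θ : Sph n) :
    Function.Injective (mfderiv (𝓡 n) 𝓘(ℝ, Euc (n + 1)) ((↑) : Sph n → Euc (n + 1)) θ) := by
  have := Fact.mk (@finrank_euclideanSpace_fin ℝ _ (n + 1))
  convert! injective_mvfderiv_subtypeVal_sphere θ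

lemma injective_fderiv_sphChart (θ : Sph n) :
    Function.Injective (fderiv ℝ (sphChart θ) (extChartAt (𝓡 n) θ θ)) := by
  have := Fact.mk (@finrank_euclideanSpace_fin ℝ _ (n + 1))
  have h1 := mfderiv_comp (I := 𝓡 n) (I' := 𝓡 n) (I'' := 𝓘(ℝ, Euc (n + 1)))
    (extChartAt (𝓡 n) θ θ) (g := ((↑) : Sph n → Euc (n + 1))) (f := (extChartAt (𝓡 n) θ).symm)
    ((contMDiff_coe_sphere (m := ∞) _).mdifferentiableAt (by simp))
    (((contMDiffOn_extChartAt_symm (n := ∞) θ).contMDiffAt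
      (extChartAt_target_mem_nhds θ)).mdifferentiableAt (by simp))
  have h2 : Function.Injective (mfderiv (𝓡 n) (𝓡 n) (extChartAt (𝓡 n) θ).symm
      (extChartAt (𝓡 n) θ θ)) := by
    have h3 := mfderiv_extChartAt_comp_mfderivWithin_extChartAt_symm (I := 𝓡 n) (x := θ)
      (mem_extChartAt_target θ)
    intro a b hab
    have h4 : mfderiv (𝓡 n) (𝓡 n) (extChartAt (𝓡 n) θ).symm (extChartAt (𝓡 n) θ θ) =
      mfderivWithin (𝓡 n) (𝓡 n) (extChartAt (𝓡 n) θ).symm (Set.range (𝓡 n))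
      (extChartAt (𝓡 n) θ θ) := by
      rw [ModelWithCorners.range_eq_univ, mfderivWithin_univ]
    rw [← h4] at h3
    have := congrArg (mfderiv (𝓡 n) (𝓡 n) (extChartAt (𝓡 n) θ)
      ((extChartAt (𝓡 n) θ).symm (extChartAt (𝓡 n) θ θ))) hab
    rw [← ContinuousLinearMap.comp_apply, ← ContinuousLinearMap.comp_apply, h3] at this
    exact this
  have h5 : Function.Injective (mfderiv (𝓡 n) 𝓘(ℝ, Euc (n + 1)) (sphChart θ)
      (extChartAt (𝓡 n) θ θ)) := by
    intro a b hab
    refine h2 (injective_mfderiv_coe_sphere _ ?_)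
    exact (congrArg (fun T => T a) h1).symm.trans (hab.trans (congrArg (fun T => T b) h1))
  rw [← mfderiv_eq_fderiv]
  exact h5

end SphereChart

/-! ### Polar coordinates -/

section Polar

variable {m k n : ℕ}

/-- The coefficients of the pull-back of the metric `G` under `ψ`. -/
def pullGram (G : Euc k → Matrix (Fin k) (Fin k) ℝ) (ψ : Euc m → Euc k) (z : Euc m) :
    Matrix (Fin m) (Fin m) ℝ :=
  Matrix.of fun i j => form G (ψ z) (fderiv ℝ ψ z (EuclideanSpace.single i 1))
    (fderiv ℝ ψ z (EuclideanSpace.single j 1))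

lemma form_pullGram (G : Euc k → Matrix (Fin k) (Fin k) ℝ) (ψ : Euc m → Euc k) (z v w : Euc m) :
    form (pullGram G ψ) z v w = form G (ψ z) (fderiv ℝ ψ z v) (fderiv ℝ ψ z w) := by
  conv_rhs => rw [← sum_smul_single v, ← sum_smul_single w]
  simp only [map_sum, map_smul, sum_apply, smul_apply, smul_eq_mul, form_apply (pullGram G ψ),
    pullGram, Matrix.of_apply, Finset.mul_sum]
  rw [Finset.sum_comm]
  refine Finset.sum_congr rfl fun i _ => Finset.sum_congr rfl fun j _ => by ring

lemma det_pullGram (G : Euc m → Matrix (Fin m) (Fin m) ℝ) (ψ : Euc m → Euc m) (z : Euc m) :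
    (pullGram G ψ z).det = (G (ψ z)).det * (pullGram (fun _ => 1) ψ z).det := by
  let J : Matrix (Fin m) (Fin m) ℝ :=
    Matrix.of fun i j => fderiv ℝ ψ z (EuclideanSpace.single j 1) i
  have h : ∀ A : Euc m → Matrix (Fin m) (Fin m) ℝ, pullGram A ψ z = Jᵀ * A (ψ z) * J := by
    intro A
    ext i j
    rw [pullGram, Matrix.of_apply, form_eq_dotProduct, Matrix.mul_assoc, Matrix.mul_apply]
    rfl
  rw [h, h]
  simp only [Matrix.det_mul, Matrix.det_one]
  ring

/-- The coordinates of a point of `ℝ^{n+1}` other than the first one. -/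
def tailPoint : Euc (n + 1) →L[ℝ] Euc n :=
  LinearMap.toContinuousLinearMap
    { toFun := fun z => WithLp.toLp 2 fun i => z i.succ
      map_add' := fun _ _ => by ext; simp
      map_smul' := fun _ _ => by ext; simp }

lemma tailPoint_apply (z : Euc (n + 1)) (i : Fin n) : tailPoint z i = z i.succ := rfl

lemma tailPoint_consPoint (s : ℝ) (y : Euc n) : tailPoint (consPoint s y) = y := by
  ext i; simp [tailPoint_apply, consPoint]

lemma consPoint_zero (s : ℝ) (y : Euc n) : consPoint s y 0 = s := by simp [consPoint]

lemma hasDerivAt_consPoint (s : ℝ) (y : Euc n) :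
    HasDerivAt (fun t => consPoint t y) (EuclideanSpace.single 0 1) s := by
  have h : (fun t => consPoint t y) =
      fun t : ℝ => t • (EuclideanSpace.single 0 1 : Euc (n + 1)) + consPoint 0 y := by
    ext t l
    refine Fin.cases ?_ (fun l => ?_) l <;> simp [consPoint]
  rw [h]
  simpa using ((hasDerivAt_id s).smul_const (EuclideanSpace.single 0 1 : Euc (n + 1))).add_const
    (consPoint 0 y)

lemma hasDerivAt_comp_consPoint {f : Euc (n + 1) → ℝ} {s : ℝ} {y : Euc n}
    (hf : DifferentiableAt ℝ f (consPoint s y)) :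
    HasDerivAt (fun t => f (consPoint t y)) (pd 0 f (consPoint s y)) s :=
  hf.hasFDerivAt.comp_hasDerivAt s (hasDerivAt_consPoint s y)

/-- Polar coordinates of `ℝ^{n+1}` over the preferred chart of the sphere at `θ`. -/
def polar (θ : Sph n) (z : Euc (n + 1)) : Euc (n + 1) := z 0 • sphChart θ (tailPoint z)

lemma contDiff_polar (θ : Sph n) : ContDiff ℝ ∞ (polar θ) := by
  have h0 : ContDiff ℝ ∞ (fun z : Euc (n + 1) => z 0) :=
    (EuclideanSpace.proj (0 : Fin (n + 1)) : Euc (n + 1) →L[ℝ] ℝ).contDiff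
  exact h0.smul ((contDiff_sphChart θ).comp tailPoint.contDiff)

lemma fderiv_polar (θ : Sph n) (z w : Euc (n + 1)) : fderiv ℝ (polar θ) z w =
    w 0 • sphChart θ (tailPoint z)
      + z 0 • fderiv ℝ (sphChart θ) (tailPoint z) (tailPoint w) := by
  have h0 := (EuclideanSpace.proj (0 : Fin (n + 1)) : Euc (n + 1) →L[ℝ] ℝ).hasFDerivAt (x := z)
  have h1 := (((contDiff_sphChart θ).differentiable (by simp) (tailPoint z)).hasFDerivAt).comp z
    (tailPoint (n := n)).hasFDerivAt
  have h2 := h0.smul h1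
  have h3 : (fun x : Euc (n + 1) => (EuclideanSpace.proj (0 : Fin (n + 1)) : Euc (n + 1) →L[ℝ] ℝ) x
      • (sphChart θ ∘ tailPoint) x) = polar θ := rfl
  rw [← h3]
  erw [h2.fderiv]
  simp [add_comm]

lemma fderiv_polar_zero (θ : Sph n) (z : Euc (n + 1)) :
    fderiv ℝ (polar θ) z (EuclideanSpace.single 0 1) = sphChart θ (tailPoint z) := by
  have : tailPoint (EuclideanSpace.single 0 1 : Euc (n + 1)) = 0 := by
    ext i; simp [tailPoint_apply]
  simp [fderiv_polar, this]

lemma fderiv_polar_succ (θ : Sph n) (z : Euc (n + 1)) (i : Fin n) :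
    fderiv ℝ (polar θ) z (EuclideanSpace.single i.succ 1) =
      z 0 • fderiv ℝ (sphChart θ) (tailPoint z) (EuclideanSpace.single i 1) := by
  have : tailPoint (EuclideanSpace.single i.succ 1 : Euc (n + 1)) = EuclideanSpace.single i 1 := by
    ext j; simp [tailPoint_apply]
  rw [fderiv_polar, this]
  simp [(Fin.succ_ne_zero i).symm]

/-- The radial and tangential parts of the image of a vector are orthogonal, so a kernel vector has
both parts zero; `s ≠ 0` and the immersed sphere then give injectivity. -/
lemma isUnit_fderiv_polar (θ : Sph n) {s : ℝ} (hs : s ≠ 0) :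
    IsUnit (fderiv ℝ (polar θ) (consPoint s (extChartAt (𝓡 n) θ θ))) := by
  set y := extChartAt (𝓡 n) θ θ
  set L := fderiv ℝ (polar θ) (consPoint s y)
  have hker : ∀ w, L w = 0 → w = 0 := by
    intro w hw
    simp only [L] at hw
    rw [fderiv_polar, tailPoint_consPoint, consPoint_zero] at hw
    have h1 := congrArg (fun x => inner ℝ (sphChart θ y) x) hw
    simp only [inner_add_right, real_inner_smul_right, inner_sphChart_fderiv,
      real_inner_self_eq_norm_sq, norm_sphChart, inner_zero_right] at h1
    have h2 : w 0 = 0 := by linarith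
    rw [h2, zero_smul, zero_add] at hw
    have h3 := (smul_eq_zero.1 hw).resolve_left hs
    have h4 : tailPoint w = 0 := injective_fderiv_sphChart θ (h3.trans (map_zero _).symm)
    ext l
    refine Fin.cases ?_ (fun l => ?_) l
    · simpa using h2
    · rw [← tailPoint_apply, h4]; rfl
  have hinj : Function.Injective L := (injective_iff_map_eq_zero L).2 hker
  rw [ContinuousLinearMap.isUnit_iff_bijective]
  exact ⟨hinj, (LinearMap.injective_iff_surjective (f := L.toLinearMap)).1 hinj⟩

/-- The metric which `G` induces on the sphere of radius `s`, in the preferred chart at `θ`. -/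
def sphMetric (G : Euc (n + 1) → Matrix (Fin (n + 1)) (Fin (n + 1)) ℝ) (θ : Sph n) (s : ℝ) :
    Euc n → Matrix (Fin n) (Fin n) ℝ :=
  pullGram G fun y => s • sphChart θ y

lemma fderiv_smul_sphChart (θ : Sph n) (s : ℝ) (y : Euc n) :
    fderiv ℝ (fun y => s • sphChart θ y) y = s • fderiv ℝ (sphChart θ) y :=
  fderiv_fun_const_smul ((contDiff_sphChart θ).differentiable (by simp) y) s

lemma spatial_pullGram_polar (G : Euc (n + 1) → Matrix (Fin (n + 1)) (Fin (n + 1)) ℝ) (θ : Sph n)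
    (s : ℝ) (y : Euc n) : spatial (pullGram G (polar θ)) (consPoint s y) = sphMetric G θ s y := by
  ext i j
  simp only [spatial, Matrix.submatrix_apply, sphMetric, pullGram, Matrix.of_apply,
    fderiv_polar_succ, fderiv_smul_sphChart, tailPoint_consPoint, consPoint_zero, polar]
  rfl

/-- A metric satisfying the conclusion of the Gauss lemma. -/
def IsRadial (G : Euc (n + 1) → Matrix (Fin (n + 1)) (Fin (n + 1)) ℝ) : Prop :=
  ∀ (s : ℝ) (v w : Euc (n + 1)), form G (s • v) v w = inner ℝ v w

/-- The flat metric serves as the reference for volume densities. -/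
lemma isRadial_one : IsRadial (n := n) fun _ => 1 := fun _ v w => form_one rfl v w

namespace IsRadial

variable {G : Euc (n + 1) → Matrix (Fin (n + 1)) (Fin (n + 1)) ℝ}

lemma pullGram_polar_zero_zero (hr : IsRadial G) (θ : Sph n) (z : Euc (n + 1)) :
    pullGram G (polar θ) z 0 0 = 1 := by
  rw [pullGram, Matrix.of_apply, fderiv_polar_zero, polar, hr, real_inner_self_eq_norm_sq,
    norm_sphChart]
  norm_num

lemma pullGram_polar_zero_succ (hr : IsRadial G) (θ : Sph n) (z : Euc (n + 1)) (j : Fin n) :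
    pullGram G (polar θ) z 0 j.succ = 0 := by
  rw [pullGram, Matrix.of_apply, fderiv_polar_zero, fderiv_polar_succ, polar, hr,
    real_inner_smul_right, inner_sphChart_fderiv, mul_zero]

lemma det_pullGram_polar (hr : IsRadial G) (θ : Sph n) (s : ℝ) (y : Euc n) :
    (pullGram G (polar θ) (consPoint s y)).det = (sphMetric G θ s y).det := by
  rw [← spatial_pullGram_polar, Matrix.det_succ_row_zero, Fin.sum_univ_succ]
  simp only [hr.pullGram_polar_zero_zero, hr.pullGram_polar_zero_succ]
  simp [spatial]

/-- In polar coordinates the determinant of a radial metric is that of its spherical block. The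
Jacobian of `polar` is the same for `G` and for the flat metric, so the two blocks differ by the
factor `det G`. -/
lemma det_sphMetric (hr : IsRadial G) (θ : Sph n) (s : ℝ) (y : Euc n) :
    (sphMetric G θ s y).det =
      s ^ (2 * n) * (G (s • sphChart θ y)).det * (sphMetric (fun _ => 1) θ 1 y).det := by
  have h1 : sphMetric (fun _ => 1) θ s y = (s ^ 2) • sphMetric (fun _ => 1) θ 1 y := by
    ext i j
    simp only [sphMetric, pullGram, Matrix.of_apply, fderiv_smul_sphChart, Matrix.smul_apply,
      smul_apply, map_smul, smul_eq_mul, form_one (G := fun _ : Euc (n + 1) => 1) rfl]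
    ring
  have h2 : polar θ (consPoint s y) = s • sphChart θ y := by
    simp [polar, tailPoint_consPoint, consPoint_zero]
  rw [← hr.det_pullGram_polar, det_pullGram, isRadial_one.det_pullGram_polar, h1,
    Matrix.det_smul, h2, Fintype.card_fin, ← pow_mul]
  ring

lemma det_sphMetric_one_pos (θ : Sph n) :
    0 < (sphMetric (fun _ => 1) θ 1 (extChartAt (𝓡 n) θ θ)).det := by
  have hpd : (sphMetric (fun _ => 1) θ 1 (extChartAt (𝓡 n) θ θ)).PosDef := by
    refine Matrix.PosDef.of_dotProduct_mulVec_pos ?_ fun v hv => ?_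
    · rw [Matrix.IsHermitian, Matrix.conjTranspose_eq_transpose_of_trivial]
      refine Matrix.IsSymm.ext fun i j => ?_
      simp only [sphMetric, pullGram, Matrix.of_apply,
        form_one (G := fun _ : Euc (n + 1) => 1) rfl]
      exact real_inner_comm _ _
    · have h1 := form_pullGram (fun _ => 1) (fun y => (1 : ℝ) • sphChart θ y)
        (extChartAt (𝓡 n) θ θ) (WithLp.toLp 2 v) (WithLp.toLp 2 v)
      rw [form_one (G := fun _ : Euc (n + 1) => 1) rfl, form_eq_dotProduct] at h1
      simp only [star_trivial]
      refine lt_of_lt_of_eq (real_inner_self_pos.2 fun h0 => ?_) h1.symm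
      rw [fderiv_smul_sphChart, one_smul] at h0
      have := injective_fderiv_sphChart θ (h0.trans (map_zero _).symm)
      exact hv (by simpa using this)
  exact hpd.det_pos

end IsRadial

end Polar

/-! ### Mean curvature and scalar curvature of the spheres -/

section RadialCurvature

variable {n : ℕ} {G : Euc (n + 1) → Matrix (Fin (n + 1)) (Fin (n + 1)) ℝ}

/-- The determinant of `G` along the ray through `θ`. -/
def radialDet (G : Euc (n + 1) → Matrix (Fin (n + 1)) (Fin (n + 1)) ℝ) (θ : Euc (n + 1)) (s : ℝ) :
    ℝ := (G (s • θ)).det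

/-- The mean curvature of the sphere of radius `s` in the direction `θ`. -/
def meanCurvature (G : Euc (n + 1) → Matrix (Fin (n + 1)) (Fin (n + 1)) ℝ) (θ : Euc (n + 1))
    (s : ℝ) : ℝ :=
  n / s + deriv (radialDet G θ) s / (2 * radialDet G θ s)

namespace IsRadial

lemma isPullback_polar (hC : ∀ i j, ContDiff ℝ ∞ (fun x => G x i j)) (hP : ∀ x, (G x).PosDef)
    (θ : Sph n) {s : ℝ} (hs : s ≠ 0) : IsPullback G (pullGram G (polar θ)) (polar θ)
      (consPoint s (extChartAt (𝓡 n) θ θ)) where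
  contDiffAt := (contDiff_polar θ).contDiffAt.of_le ENat.LEInfty.out
  isUnit_fderiv := isUnit_fderiv_polar θ hs
  contDiffAt_metric i j := (hC i j).contDiffAt.of_le ENat.LEInfty.out
  isSymm := Eventually.of_forall fun x => by
    have := (hP x).isHermitian
    rwa [Matrix.IsHermitian, Matrix.conjTranspose_eq_transpose_of_trivial] at this
  isUnit_det := (hP _).det_pos.ne'.isUnit
  form_eq := Eventually.of_forall fun z v w => form_pullGram G (polar θ) z v w

lemma det_sphMetric_pos (hr : IsRadial G) (hP : ∀ x, (G x).PosDef) (θ : Sph n) {s : ℝ}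
    (hs : s ≠ 0) : 0 < (sphMetric G θ s (extChartAt (𝓡 n) θ θ)).det := by
  rw [hr.det_sphMetric]
  have h1 := (hP (s • sphChart θ (extChartAt (𝓡 n) θ θ))).det_pos
  have h2 := det_sphMetric_one_pos θ
  have h3 : 0 < s ^ (2 * n) := by rw [pow_mul]; positivity
  positivity

lemma isBlock_polar (hr : IsRadial G) (hC : ∀ i j, ContDiff ℝ ∞ (fun x => G x i j))
    (hP : ∀ x, (G x).PosDef) (θ : Sph n) {s : ℝ} (hs : s ≠ 0) :
    IsBlock (pullGram G (polar θ)) (consPoint s (extChartAt (𝓡 n) θ θ)) where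
  contDiffAt := (isPullback_polar hC hP θ hs).contDiffAt_pullback
  isSymm := (isPullback_polar hC hP θ hs).eventually.mono fun _ hx => hx.isSymm_pullback
  zero_zero := Eventually.of_forall fun z => hr.pullGram_polar_zero_zero θ z
  zero_succ := Eventually.of_forall fun z j => hr.pullGram_polar_zero_succ θ z j
  isUnit_det := by
    rw [spatial_pullGram_polar]
    exact (hr.det_sphMetric_pos hP θ hs).ne'.isUnit

lemma posDef_sphMetric (hr : IsRadial G) (hC : ∀ i j, ContDiff ℝ ∞ (fun x => G x i j))
    (hP : ∀ x, (G x).PosDef) (θ : Sph n) {s : ℝ} (hs : s ≠ 0) :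
    (sphMetric G θ s (extChartAt (𝓡 n) θ θ)).PosDef := by
  refine Matrix.PosDef.of_dotProduct_mulVec_pos ?_ fun v hv => ?_
  · rw [Matrix.IsHermitian, Matrix.conjTranspose_eq_transpose_of_trivial,
      ← spatial_pullGram_polar]
    exact (hr.isBlock_polar hC hP θ hs).isSymm_spatial
  · have h1 := form_pullGram G (fun y => s • sphChart θ y)
      (extChartAt (𝓡 n) θ θ) (WithLp.toLp 2 v) (WithLp.toLp 2 v)
    rw [form_eq_dotProduct, form_eq_dotProduct] at h1
    simp only [star_trivial]
    have h2 := (hP (s • sphChart θ (extChartAt (𝓡 n) θ θ))).dotProduct_mulVec_pos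
      (x := (fderiv ℝ (fun y => s • sphChart θ y) (extChartAt (𝓡 n) θ θ) (WithLp.toLp 2 v)).ofLp)
      fun h0 => ?_
    · rw [star_trivial] at h2
      exact lt_of_lt_of_eq h2 h1.symm
    · rw [fderiv_smul_sphChart] at h0
      have h3 : s • fderiv ℝ (sphChart θ) (extChartAt (𝓡 n) θ θ) (WithLp.toLp 2 v) = 0 :=
        WithLp.ofLp_injective 2 h0
      have h4 := (smul_eq_zero.1 h3).resolve_left hs
      have := injective_fderiv_sphChart θ (h4.trans (map_zero _).symm)
      exact hv (by simpa using this)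

lemma contDiff_radialDet (hC : ∀ i j, ContDiff ℝ ∞ (fun x => G x i j)) (θ : Euc (n + 1)) :
    ContDiff ℝ ∞ (radialDet G θ) := by
  rw [contDiff_iff_contDiffAt]
  intro s
  refine contDiffAt_det fun i j => ?_
  exact ((hC i j).comp (contDiff_id.smul contDiff_const)).contDiffAt

lemma radialDet_pos (hP : ∀ x, (G x).PosDef) (θ : Euc (n + 1)) (s : ℝ) : 0 < radialDet G θ s :=
  (hP _).det_pos

/-- By Jacobi's formula `tr S = ½ (log det h_s)'`, and `det h_s` is `s^{2n} det G(sθ)` times a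
constant in `s`. -/
lemma trace_shape (hr : IsRadial G) (hC : ∀ i j, ContDiff ℝ ∞ (fun x => G x i j))
    (hP : ∀ x, (G x).PosDef) (θ : Sph n) {s : ℝ} (hs : s ≠ 0) :
    (shape (pullGram G (polar θ)) (consPoint s (extChartAt (𝓡 n) θ θ))).trace =
      meanCurvature G θ s := by
  have hB := hr.isBlock_polar hC hP θ hs
  have hdet := hr.det_sphMetric_pos hP θ hs
  set y := extChartAt (𝓡 n) θ θ with hy
  set c : ℝ := (sphMetric (fun _ => 1) θ 1 y).det with hc
  have hc0 : 0 < c := det_sphMetric_one_pos θ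
  have hD := radialDet_pos hP (θ : Euc (n + 1)) s
  have h1 := hasDerivAt_det (A := fun t => spatial (pullGram G (polar θ)) (consPoint t y))
    (A' := spatialDot (pullGram G (polar θ)) (consPoint s y)) (s := s)
    fun i j => hasDerivAt_comp_consPoint (hB.differentiableAt i.succ j.succ)
  have h2 : (fun t => (spatial (pullGram G (polar θ)) (consPoint t y)).det) =
      fun t => t ^ (2 * n) * radialDet G θ t * c := by
    ext t
    rw [spatial_pullGram_polar, hr.det_sphMetric, hy, sphChart_center]
    rfl
  have h3 : HasDerivAt (fun t => t ^ (2 * n) * radialDet G θ t * c)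
      (((2 * n : ℕ) * s ^ (2 * n - 1) * radialDet G θ s
        + s ^ (2 * n) * deriv (radialDet G θ) s) * c) s :=
    ((hasDerivAt_pow (2 * n) s).mul
      ((contDiff_radialDet hC _).differentiable (by simp) s).hasDerivAt).mul_const c
  rw [h2] at h1
  have h4 := h1.unique h3
  set h' := spatial (pullGram G (polar θ)) (consPoint s y) with hh'
  set B := spatialDot (pullGram G (polar θ)) (consPoint s y)
  have hdet' : h'.det = s ^ (2 * n) * radialDet G θ s * c := congrFun h2 s
  have hu : h'.det ≠ 0 := hB.isUnit_det.ne_zero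
  have h5 : h'.adjugate = h'.det • h'⁻¹ := by
    rw [Matrix.inv_def, Ring.inverse_eq_inv', smul_smul, mul_inv_cancel₀ hu, one_smul]
  rw [h5, Matrix.smul_mul, Matrix.trace_smul, smul_eq_mul, hdet'] at h4
  rw [shape, Matrix.trace_smul, smul_eq_mul]
  change 1 / 2 * (h'⁻¹ * B).trace = _
  rw [meanCurvature]
  -- The case `n = 0` is separate because the exponent `2 * n - 1` is truncated.
  have hpow : ((2 * n : ℕ) : ℝ) * s ^ (2 * n - 1) = 2 * n / s * s ^ (2 * n) := by
    rcases Nat.eq_zero_or_pos n with rfl | hn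
    · simp
    · obtain ⟨k, hk⟩ : ∃ k, 2 * n = k + 1 := ⟨2 * n - 1, by omega⟩
      rw [hk]
      simp only [Nat.add_sub_cancel]
      rw [← hk]; push_cast
      field_simp
      rw [hk]; ring
  rw [hpow] at h4
  have hsn : s ^ (2 * n) ≠ 0 := pow_ne_zero _ hs
  have h6 : (h'⁻¹ * B).trace = 2 * n / s + deriv (radialDet G θ) s / radialDet G θ s := by
    have h7 : s ^ (2 * n) * radialDet G θ s * c * (h'⁻¹ * B).trace =
        s ^ (2 * n) * radialDet G θ s * c *
          (2 * n / s + deriv (radialDet G θ) s / radialDet G θ s) := by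
      rw [h4]; field_simp
    exact mul_left_cancel₀ (by positivity) h7
  rw [h6]
  field_simp

lemma hasDerivAt_meanCurvature (hr : IsRadial G) (hC : ∀ i j, ContDiff ℝ ∞ (fun x => G x i j))
    (hP : ∀ x, (G x).PosDef) (θ : Sph n) {s : ℝ} (hs : s ≠ 0) :
    HasDerivAt (meanCurvature G θ) (∑ i, pd 0 (fun x => shape (pullGram G (polar θ)) x i i)
      (consPoint s (extChartAt (𝓡 n) θ θ))) s := by
  have hB := hr.isBlock_polar hC hP θ hs
  have h1 : HasDerivAt
      (fun t => (shape (pullGram G (polar θ)) (consPoint t (extChartAt (𝓡 n) θ θ))).trace)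
      (∑ i, pd 0 (fun x => shape (pullGram G (polar θ)) x i i)
      (consPoint s (extChartAt (𝓡 n) θ θ))) s := by
    simp only [Matrix.trace, Matrix.diag_apply]
    exact HasDerivAt.fun_sum fun i _ => hasDerivAt_comp_consPoint (hB.differentiableAt_shape i i)
  refine h1.congr_of_eventuallyEq ?_
  filter_upwards [eventually_ne_nhds hs] with t ht
  exact (hr.trace_shape hC hP θ ht).symm

lemma ricci_polar (hC : ∀ i j, ContDiff ℝ ∞ (fun x => G x i j))
    (hP : ∀ x, (G x).PosDef) (θ : Sph n) {s : ℝ} (hs : s ≠ 0) :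
    ricci (pullGram G (polar θ)) (consPoint s (extChartAt (𝓡 n) θ θ)) 0 0 =
      form (ricci G) (s • (θ : Euc (n + 1))) θ θ := by
  have h1 := (isPullback_polar hC hP θ hs).ricci_law (EuclideanSpace.single 0 1)
    (EuclideanSpace.single 0 1)
  rw [form_single, fderiv_polar_zero, polar, tailPoint_consPoint, consPoint_zero,
    sphChart_center] at h1
  exact h1

lemma scalar_polar (hC : ∀ i j, ContDiff ℝ ∞ (fun x => G x i j))
    (hP : ∀ x, (G x).PosDef) (θ : Sph n) {s : ℝ} (hs : s ≠ 0) :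
    scalar (pullGram G (polar θ)) (consPoint s (extChartAt (𝓡 n) θ θ)) =
      scalar G (s • (θ : Euc (n + 1))) := by
  have h1 := (isPullback_polar hC hP θ hs).scalar_law
  rwa [polar, tailPoint_consPoint, consPoint_zero, sphChart_center] at h1

/-- The Riccati inequality for the mean curvature of the spheres. -/
lemma deriv_meanCurvature_le (hr : IsRadial G) (hC : ∀ i j, ContDiff ℝ ∞ (fun x => G x i j))
    (hP : ∀ x, (G x).PosDef) (hn : 0 < n) (θ : Sph n) {s : ℝ} (hs : s ≠ 0) :
    deriv (meanCurvature G θ) s + meanCurvature G θ s ^ 2 / n ≤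
      -form (ricci G) (s • (θ : Euc (n + 1))) θ θ := by
  have hB := hr.isBlock_polar hC hP θ hs
  have h1 := hB.ricci_zero_zero
  rw [ricci_polar hC hP θ hs, ← (hr.hasDerivAt_meanCurvature hC hP θ hs).deriv] at h1
  have h2 := sq_trace_le (h := spatial (pullGram G (polar θ))
    (consPoint s (extChartAt (𝓡 n) θ θ))) (by
      rw [spatial_pullGram_polar]; exact hr.posDef_sphMetric hC hP θ hs) hB.isSymm_spatialDot
  change (shape _ _).trace ^ 2 ≤ _ * (shape _ _ * shape _ _).trace at h2
  rw [hr.trace_shape hC hP θ hs, Fintype.card_fin] at h2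
  have hn' : (0 : ℝ) < n := by exact_mod_cast hn
  have h3 : meanCurvature G θ s ^ 2 / n ≤ (shape (pullGram G (polar θ))
      (consPoint s (extChartAt (𝓡 n) θ θ)) * shape (pullGram G (polar θ))
      (consPoint s (extChartAt (𝓡 n) θ θ))).trace := by
    rw [div_le_iff₀ hn']; linarith
  linarith

/-- The Gauss equation for the scalar curvature of the spheres. -/
lemma scalar_sphMetric (hr : IsRadial G) (hC : ∀ i j, ContDiff ℝ ∞ (fun x => G x i j))
    (hP : ∀ x, (G x).PosDef) (θ : Sph n) {s : ℝ} (hs : s ≠ 0) :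
    scalar (sphMetric G θ s) (extChartAt (𝓡 n) θ θ) = scalar G (s • (θ : Euc (n + 1)))
      + deriv (meanCurvature G θ) s - form (ricci G) (s • (θ : Euc (n + 1))) θ θ
      + meanCurvature G θ s ^ 2 := by
  have hB := hr.isBlock_polar hC hP θ hs
  have h1 := hB.ricci_zero_zero
  have h2 := hB.scalar_eq
  rw [ricci_polar hC hP θ hs, ← (hr.hasDerivAt_meanCurvature hC hP θ hs).deriv] at h1
  rw [scalar_polar hC hP θ hs, ← (hr.hasDerivAt_meanCurvature hC hP θ hs).deriv,
    hr.trace_shape hC hP θ hs] at h2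
  simp only [spatial_pullGram_polar] at h2
  change _ = scalar (sphMetric G θ s) _ - _ - _ - _ at h2
  linarith

end IsRadial

end RadialCurvature

/-! ### Sturm comparison for `f'' ≤ f` -/

section Comparison

/-- Comparison for `f'' ≤ f` on a half line: the logarithmic derivative is at most `coth`. -/
lemma deriv_mul_sinh_le {f g g' : ℝ → ℝ} (hf : ∀ s, 0 < s → 0 < f s)
    (hfd : ∀ s, 0 < s → HasDerivAt f (g s) s) (hgd : ∀ s, 0 < s → HasDerivAt g (g' s) s)
    (hle : ∀ s, 0 < s → g' s ≤ f s) {t : ℝ} (ht : 0 < t) :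
    g t * Real.sinh t ≤ f t * Real.cosh t := by
  -- Nothing is assumed at `0`, so the comparison solution `sinh (s - ε)` starts at `ε`, where the
  -- Wronskian equals `-f ε < 0`; then `ε → 0`.
  have key : ∀ ε ∈ Set.Ioo 0 t, g t * Real.sinh (t - ε) - f t * Real.cosh (t - ε) ≤ 0 := by
    rintro ε ⟨hε, hεt⟩
    set w : ℝ → ℝ := fun s => g s * Real.sinh (s - ε) - f s * Real.cosh (s - ε) with hw
    have hwd : ∀ s, 0 < s → HasDerivAt w ((g' s - f s) * Real.sinh (s - ε)) s := by
      intro s hs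
      have e1 : HasDerivAt (fun s => s - ε) 1 s := (hasDerivAt_id s).sub_const ε
      have := ((hgd s hs).mul e1.sinh).sub ((hfd s hs).mul e1.cosh)
      refine this.congr_deriv ?_
      ring
    have hanti : AntitoneOn w (Set.Icc ε t) := by
      refine antitoneOn_of_deriv_nonpos (convex_Icc ε t)
        (fun s hs => (hwd s (hε.trans_le hs.1)).continuousAt.continuousWithinAt)
        (fun s hs => ?_) fun s hs => ?_
      · rw [interior_Icc] at hs
        exact (hwd s (hε.trans hs.1)).differentiableAt.differentiableWithinAt
      · rw [interior_Icc] at hs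
        rw [(hwd s (hε.trans hs.1)).deriv]
        exact mul_nonpos_of_nonpos_of_nonneg (sub_nonpos.2 (hle s (hε.trans hs.1)))
          (Real.sinh_nonneg_iff.2 (sub_nonneg.2 hs.1.le))
    have h1 := hanti (Set.left_mem_Icc.2 hεt.le) (Set.right_mem_Icc.2 hεt.le) hεt.le
    have h2 : w ε = -f ε := by simp [hw]
    have := hf ε hε
    exact h1.trans (by rw [h2]; linarith)
  have hlim : Tendsto (fun ε => g t * Real.sinh (t - ε) - f t * Real.cosh (t - ε)) (𝓝[>] 0)
      (𝓝 (g t * Real.sinh t - f t * Real.cosh t)) := by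
    have hc : Continuous fun ε => g t * Real.sinh (t - ε) - f t * Real.cosh (t - ε) :=
      (continuous_const.mul (Real.continuous_sinh.comp (continuous_const.sub continuous_id))).sub
        (continuous_const.mul (Real.continuous_cosh.comp (continuous_const.sub continuous_id)))
    have := hc.tendsto 0
    simp only [sub_zero] at this
    exact this.mono_left nhdsWithin_le_nhds
  have := le_of_tendsto hlim (eventually_of_mem (Ioo_mem_nhdsGT ht) key)
  linarith

/-- Comparison for `f'' ≤ f` on a half line: the logarithmic derivative is at least `-1`. -/
lemma neg_le_deriv {f g g' : ℝ → ℝ} (hf : ∀ s, 0 < s → 0 < f s)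
    (hfd : ∀ s, 0 < s → HasDerivAt f (g s) s) (hgd : ∀ s, 0 < s → HasDerivAt g (g' s) s)
    (hle : ∀ s, 0 < s → g' s ≤ f s) {t : ℝ} (ht : 0 < t) : -f t ≤ g t := by
  by_contra! hcon
  -- `a' = e^{-s} (f'' - f) ≤ 0`: once `f' + f` is negative, `a` stays below a negative constant
  -- `-c`.
  set a : ℝ → ℝ := fun s => Real.exp (-s) * (g s + f s) with ha
  have had : ∀ s, 0 < s → HasDerivAt a (Real.exp (-s) * (g' s - f s)) s := by
    intro s hs
    have := ((hasDerivAt_id s).neg.exp).mul ((hgd s hs).add (hfd s hs))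
    refine this.congr_deriv ?_
    simp only [Pi.add_apply, Pi.neg_apply, id]
    ring
  have hanti : AntitoneOn a (Set.Ici t) := by
    refine antitoneOn_of_deriv_nonpos (convex_Ici t)
      (fun s hs => (had s (ht.trans_le hs)).continuousAt.continuousWithinAt)
      (fun s hs => ?_) fun s hs => ?_
    · rw [interior_Ici] at hs
      exact (had s (ht.trans hs)).differentiableAt.differentiableWithinAt
    · rw [interior_Ici] at hs
      rw [(had s (ht.trans hs)).deriv]
      exact mul_nonpos_of_nonneg_of_nonpos (Real.exp_pos _).le
        (sub_nonpos.2 (hle s (ht.trans hs)))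
  set c : ℝ := -a t with hc
  have hc0 : 0 < c := by
    have : a t < 0 := mul_neg_of_pos_of_neg (Real.exp_pos _) (by linarith)
    linarith
  -- Since `(e^s f)' = e^{2s} a ≤ -c`, the positive function `e^s f` decreases at least linearly.
  set b : ℝ → ℝ := fun s => Real.exp s * f s + c * s with hb
  have hbd : ∀ s, 0 < s → HasDerivAt b (Real.exp s * (g s + f s) + c) s := by
    intro s hs
    have := ((Real.hasDerivAt_exp s).mul (hfd s hs)).add ((hasDerivAt_id s).const_mul c)
    refine this.congr_deriv ?_
    ring
  have hbanti : AntitoneOn b (Set.Ici t) := by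
    refine antitoneOn_of_deriv_nonpos (convex_Ici t)
      (fun s hs => (hbd s (ht.trans_le hs)).continuousAt.continuousWithinAt)
      (fun s hs => ?_) fun s hs => ?_
    · rw [interior_Ici] at hs
      exact (hbd s (ht.trans hs)).differentiableAt.differentiableWithinAt
    · rw [interior_Ici] at hs
      have hs0 : 0 < s := ht.trans hs
      rw [(hbd s hs0).deriv]
      have h1 : a s ≤ -c := by
        have := hanti Set.self_mem_Ici (Set.mem_Ici.2 (Set.mem_Ioi.1 hs).le) (Set.mem_Ioi.1 hs).le
        linarith
      have h2 : Real.exp s * (g s + f s) = Real.exp s * Real.exp s * a s := by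
        simp only [ha]
        rw [Real.exp_neg]
        field_simp
      have h3 : 1 ≤ Real.exp s * Real.exp s := by
        have := Real.one_le_exp hs0.le
        nlinarith
      rw [h2]
      nlinarith
  -- The radius by which this linear decrease exhausts `e^t f t`, contradicting positivity.
  set T : ℝ := t + Real.exp t * f t / c with hT
  have hTt : t ≤ T := by
    have : 0 ≤ Real.exp t * f t / c := by
      have := hf t ht
      positivity
    linarith
  have h1 := hbanti Set.self_mem_Ici hTt hTt
  have h2 : c * T = c * t + Real.exp t * f t := by rw [hT]; field_simp
  have h3 : 0 < Real.exp T * f T := mul_pos (Real.exp_pos _) (hf T (ht.trans_le hTt))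
  simp only [hb] at h1
  linarith

/-- Comparison for `f'' ≤ f` on a half line: `f / sinh` is nonincreasing. -/
lemma antitoneOn_div_sinh {f g g' : ℝ → ℝ} (hf : ∀ s, 0 < s → 0 < f s)
    (hfd : ∀ s, 0 < s → HasDerivAt f (g s) s) (hgd : ∀ s, 0 < s → HasDerivAt g (g' s) s)
    (hle : ∀ s, 0 < s → g' s ≤ f s) : AntitoneOn (fun s => f s / Real.sinh s) (Set.Ioi 0) := by
  have hd : ∀ s, 0 < s → HasDerivAt (fun s => f s / Real.sinh s)
      ((g s * Real.sinh s - f s * Real.cosh s) / Real.sinh s ^ 2) s := fun s hs =>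
    (hfd s hs).div (Real.hasDerivAt_sinh s) (Real.sinh_pos_iff.2 hs).ne'
  refine antitoneOn_of_deriv_nonpos (convex_Ioi 0)
    (fun s hs => (hd s hs).continuousAt.continuousWithinAt) (fun s hs => ?_) fun s hs => ?_
  · rw [interior_Ioi] at hs
    exact (hd s hs).differentiableAt.differentiableWithinAt
  · rw [interior_Ioi] at hs
    rw [(hd s hs).deriv]
    refine div_nonpos_of_nonpos_of_nonneg ?_ (sq_nonneg _)
    have := deriv_mul_sinh_le hf hfd hgd hle hs
    linarith

end Comparison

/-! ### Bounds for the mean curvature, volume density and scalar curvature -/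

section Bishop

variable {n : ℕ} {G : Euc (n + 1) → Matrix (Fin (n + 1)) (Fin (n + 1)) ℝ}

/-- The `n`-th root of the radial volume density. -/
def radialRoot (G : Euc (n + 1) → Matrix (Fin (n + 1)) (Fin (n + 1)) ℝ) (θ : Euc (n + 1)) (s : ℝ) :
    ℝ := s * radialDet G θ s ^ (1 / (2 * n) : ℝ)

namespace IsRadial

lemma radialRoot_pos (hP : ∀ x, (G x).PosDef) (θ : Euc (n + 1)) {s : ℝ} (hs : 0 < s) :
    0 < radialRoot G θ s :=
  mul_pos hs (Real.rpow_pos_of_pos (radialDet_pos hP θ s) _)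

lemma radialRoot_pow (hP : ∀ x, (G x).PosDef) (hn : 0 < n) (θ : Euc (n + 1)) (s : ℝ) :
    radialRoot G θ s ^ n = s ^ n * Real.sqrt (radialDet G θ s) := by
  have hn' : (n : ℝ) ≠ 0 := by exact_mod_cast hn.ne'
  rw [radialRoot, mul_pow, ← Real.rpow_mul_natCast (radialDet_pos hP θ s).le, Real.sqrt_eq_rpow]
  congr 2
  field_simp

/-- The exponent `1/(2n)` is the one for which the logarithmic derivative is exactly `H/n`; this
turns the Riccati inequality into `f'' ≤ f`. -/
lemma hasDerivAt_radialRoot (hC : ∀ i j, ContDiff ℝ ∞ (fun x => G x i j))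
    (hP : ∀ x, (G x).PosDef) (hn : 0 < n) (θ : Euc (n + 1)) {s : ℝ} (hs : 0 < s) :
    HasDerivAt (radialRoot G θ) (meanCurvature G θ s / n * radialRoot G θ s) s := by
  have hD := radialDet_pos hP θ s
  have hn' : (n : ℝ) ≠ 0 := by exact_mod_cast hn.ne'
  have h1 := ((contDiff_radialDet hC θ).differentiable (by simp) s).hasDerivAt
  have h2 := (hasDerivAt_id s).mul (h1.rpow_const (p := (1 / (2 * n) : ℝ)) (Or.inl hD.ne'))
  refine h2.congr_deriv ?_
  rw [Real.rpow_sub_one hD.ne', meanCurvature, radialRoot]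
  simp only [id]
  field_simp

/-- Sturm comparison for `f = radialRoot`, with `f'' = (H' + H²/n) f / n ≤ f`. Squaring the first
bound requires a lower bound on `H` too, namely `H ≥ -n`, available because the rays extend to
infinity. -/
lemma meanCurvature_bounds (hr : IsRadial G) (hC : ∀ i j, ContDiff ℝ ∞ (fun x => G x i j))
    (hP : ∀ x, (G x).PosDef) (hn : 0 < n)
    (hric : ∀ x w, -(n : ℝ) * form G x w w ≤ form (ricci G) x w w) (θ : Sph n) {t : ℝ}
    (ht : 0 < t) :
    meanCurvature G θ t ^ 2 * Real.sinh t ^ 2 ≤ n ^ 2 * Real.cosh t ^ 2 ∧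
      radialRoot G θ t ≤ Real.sinh t := by
  have hn' : (0 : ℝ) < n := by exact_mod_cast hn
  set f := radialRoot G (θ : Euc (n + 1)) with hfdef
  set H := meanCurvature G (θ : Euc (n + 1)) with hH
  have hf : ∀ s, 0 < s → 0 < f s := fun s hs => radialRoot_pos hP _ hs
  have hfd : ∀ s, 0 < s → HasDerivAt f (H s / n * f s) s := fun s hs =>
    hasDerivAt_radialRoot hC hP hn _ hs
  have hHd : ∀ s, 0 < s → HasDerivAt H (deriv H s) s := fun s hs =>
    (hr.hasDerivAt_meanCurvature hC hP θ hs.ne').differentiableAt.hasDerivAt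
  have hgd : ∀ s, 0 < s → HasDerivAt (fun s => H s / n * f s)
      (deriv H s / n * f s + H s / n * (H s / n * f s)) s := fun s hs =>
    ((hHd s hs).div_const _).mul (hfd s hs)
  have hric' : ∀ s, 0 < s → deriv H s + H s ^ 2 / n ≤ n := by
    intro s hs
    have h1 := hr.deriv_meanCurvature_le hC hP hn θ hs.ne'
    have h2 := hric (s • (θ : Euc (n + 1))) θ
    rw [hr, real_inner_self_eq_norm_sq] at h2
    simp at h2
    linarith
  have hle : ∀ s, 0 < s → deriv H s / n * f s + H s / n * (H s / n * f s) ≤ f s := by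
    intro s hs
    have h1 : deriv H s / n * f s + H s / n * (H s / n * f s) =
        (deriv H s + H s ^ 2 / n) / n * f s := by field_simp
    rw [h1]
    have h2 : (deriv H s + H s ^ 2 / n) / n ≤ 1 := (div_le_one hn').2 (hric' s hs)
    exact mul_le_of_le_one_left (hf s hs).le h2
  have hft := hf t ht
  have hsinh : 0 < Real.sinh t := Real.sinh_pos_iff.2 ht
  have hcosh : 0 < Real.cosh t := Real.cosh_pos t
  refine ⟨?_, ?_⟩
  · have h1 := deriv_mul_sinh_le hf hfd hgd hle ht
    have h2 := neg_le_deriv hf hfd hgd hle ht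
    have h3 : H t * Real.sinh t ≤ n * Real.cosh t := by
      have h4 : (H t * Real.sinh t) * (f t / n) ≤ (n * Real.cosh t) * (f t / n) := by
        calc (H t * Real.sinh t) * (f t / n) = H t / n * f t * Real.sinh t := by ring
          _ ≤ f t * Real.cosh t := h1
          _ = _ := by field_simp
      exact le_of_mul_le_mul_right h4 (by positivity)
    have h5 : -(n : ℝ) ≤ H t := by
      have h6 : -(n : ℝ) * (f t / n) ≤ H t * (f t / n) := by
        calc -(n : ℝ) * (f t / n) = -f t := by field_simp
          _ ≤ H t / n * f t := h2
          _ = _ := by ring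
      exact le_of_mul_le_mul_right h6 (by positivity)
    have h7 : -(n * Real.cosh t) ≤ H t * Real.sinh t := by
      have := Real.sinh_lt_cosh t
      nlinarith
    rw [← mul_pow, ← mul_pow]
    exact sq_le_sq' h7 h3
  · have hanti := antitoneOn_div_sinh hf hfd hgd hle
    -- Monotonicity of `f/sinh` between `s` and `t`, followed by `s ≤ sinh s`, which removes the
    -- factor `s` of `f s`.
    have hev : ∀ᶠ s in 𝓝[>] (0 : ℝ),
        f t / Real.sinh t ≤ radialDet G (θ : Euc (n + 1)) s ^ (1 / (2 * n) : ℝ) := by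
      filter_upwards [Ioo_mem_nhdsGT ht] with s hs
      refine (hanti hs.1 ht hs.2.le).trans ?_
      rw [div_le_iff₀ (Real.sinh_pos_iff.2 hs.1), hfdef, radialRoot, mul_comm]
      exact mul_le_mul_of_nonneg_left (Real.self_le_sinh_iff.2 hs.1.le)
        (Real.rpow_nonneg (radialDet_pos hP _ s).le _)
    have hG0 : G 0 = 1 := by
      ext i j
      have := hr 0 (EuclideanSpace.single i 1) (EuclideanSpace.single j 1)
      rw [zero_smul, form_single] at this
      rw [this, ← form_one (G := fun _ : Euc (n + 1) => 1) (x := 0) rfl, form_single]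
    have hlim : Tendsto (fun s => radialDet G (θ : Euc (n + 1)) s ^ (1 / (2 * n) : ℝ)) (𝓝[>] 0)
        (𝓝 1) := by
      have hc : ContinuousAt (fun s => radialDet G (θ : Euc (n + 1)) s ^ (1 / (2 * n) : ℝ)) 0 :=
        (contDiff_radialDet hC _).continuous.continuousAt.rpow_const
          (Or.inl (radialDet_pos hP _ 0).ne')
      have h0 : radialDet G (θ : Euc (n + 1)) 0 = 1 := by simp [radialDet, hG0]
      have := hc.tendsto
      rw [h0, Real.one_rpow] at this
      exact this.mono_left nhdsWithin_le_nhds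
    have := ge_of_tendsto hlim hev
    rwa [div_le_one hsinh] at this

/-- The upper bound for the scalar curvature of the spheres. -/
lemma scalar_sphMetric_le (hr : IsRadial G) (hC : ∀ i j, ContDiff ℝ ∞ (fun x => G x i j))
    (hP : ∀ x, (G x).PosDef) (hn : 0 < n)
    (hric : ∀ x w, -(n : ℝ) * form G x w w ≤ form (ricci G) x w w) (θ : Sph n) {t : ℝ}
    (ht : 0 < t) : scalar (sphMetric G θ t) (extChartAt (𝓡 n) θ θ) ≤
      (scalar G (t • (θ : Euc (n + 1))) + n * (n + 1)) + n * (n - 1) / Real.sinh t ^ 2 := by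
  have hn' : (1 : ℝ) ≤ n := by exact_mod_cast hn
  have hn0 : (0 : ℝ) < n := by linarith
  have hsinh : 0 < Real.sinh t := Real.sinh_pos_iff.2 ht
  rw [hr.scalar_sphMetric hC hP θ ht.ne']
  have h1 := hr.deriv_meanCurvature_le hC hP hn θ ht.ne'
  have h2 := hric (t • (θ : Euc (n + 1))) θ
  rw [hr, real_inner_self_eq_norm_sq] at h2
  simp at h2
  have h3 := (hr.meanCurvature_bounds hC hP hn hric θ ht).1
  set H := meanCurvature G (θ : Euc (n + 1)) t
  have h4 : H ^ 2 ≤ n ^ 2 * (1 + 1 / Real.sinh t ^ 2) := by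
    rw [Real.cosh_sq'] at h3
    have h5 : n ^ 2 * (1 + 1 / Real.sinh t ^ 2) = n ^ 2 * (1 + Real.sinh t ^ 2) / Real.sinh t ^ 2 := by
      field_simp
      ring
    rw [h5, le_div_iff₀ (by positivity)]
    exact h3
  -- The inequality used is `R_h ≤ R - 2 Ric(θ, θ) + H² (n-1)/n`; the constant is `2n + n(n-1) =
  -- n(n+1)`.
  have h6 : H ^ 2 - H ^ 2 / n = H ^ 2 * ((n - 1) / n) := by field_simp
  have h7 : H ^ 2 * ((n - 1) / n) ≤ n ^ 2 * (1 + 1 / Real.sinh t ^ 2) * ((n - 1) / n) :=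
    mul_le_mul_of_nonneg_right h4 (div_nonneg (by linarith) hn0.le)
  have h8 : n ^ 2 * (1 + 1 / Real.sinh t ^ 2) * ((n - 1) / n) =
      (n : ℝ) * (n - 1) + n * (n - 1) / Real.sinh t ^ 2 := by field_simp
  linarith

end IsRadial

end Bishop

/-! ### Constant rescaling, and continuity of the curvatures -/

namespace Coord

variable {m : ℕ}

lemma inv_smul_matrix {c : ℝ} (hc : c ≠ 0) (A : Matrix (Fin m) (Fin m) ℝ) :
    (c • A)⁻¹ = c⁻¹ • A⁻¹ := by
  by_cases hA : IsUnit A.det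
  · refine Matrix.inv_eq_right_inv ?_
    rw [Matrix.smul_mul, Matrix.mul_smul, smul_smul, mul_inv_cancel₀ hc, one_smul,
      Matrix.mul_nonsing_inv _ hA]
  · have h1 : ¬IsUnit (c • A).det := by
      rw [isUnit_iff_ne_zero, not_not] at hA
      simp [hA]
    rw [Matrix.nonsing_inv_apply_not_isUnit _ hA, Matrix.nonsing_inv_apply_not_isUnit _ h1,
      smul_zero]

lemma pd_const_mul_field (c : ℝ) (f : Euc m → ℝ) (i : Fin m) (y : Euc m) :
    pd i (fun z => c * f z) y = c * pd i f y := by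
  have h : fderiv ℝ (fun z => c * f z) y = c • fderiv ℝ f y := by
    have := congrFun (fderiv_const_smul_field (𝕜 := ℝ) (f := f) c) y
    exact this
  rw [pd, pd, h]
  rfl

lemma christoffel_smul {c : ℝ} (hc : c ≠ 0) (A : Euc m → Matrix (Fin m) (Fin m) ℝ) :
    christoffel (fun z => c • A z) = christoffel A := by
  ext k i j y
  simp only [christoffel, Matrix.smul_apply, smul_eq_mul, pd_const_mul_field, inv_smul_matrix hc]
  congr 1
  refine Finset.sum_congr rfl fun l _ => ?_
  field_simp

/-- Constant factors cancel in the Christoffel symbols, so Ricci is unchanged and only the inverse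
metric of the trace scales. -/
lemma scalar_smul {c : ℝ} (hc : c ≠ 0) (A : Euc m → Matrix (Fin m) (Fin m) ℝ) (y : Euc m) :
    scalar (fun z => c • A z) y = c⁻¹ * scalar A y := by
  have h : ricci (fun z => c • A z) = ricci A := by
    unfold ricci riemann
    rw [christoffel_smul hc]
  rw [scalar, scalar, h, inv_smul_matrix hc]
  simp only [Matrix.smul_apply, smul_eq_mul, Finset.mul_sum, mul_assoc]

variable {G : Euc m → Matrix (Fin m) (Fin m) ℝ}

lemma continuous_ricci_apply (hC : ∀ i j, ContDiff ℝ ∞ (fun x => G x i j))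
    (hu : ∀ x, IsUnit (G x).det) (k j : Fin m) : Continuous fun x => ricci G x k j := by
  have h1 : ∀ a b c, ContDiff ℝ ∞ (christoffel G a b c) := fun a b c =>
    contDiff_iff_contDiffAt.2 fun x =>
      contDiffAt_christoffel (k' := ∞) (by simp) (fun i j => (hC i j).contDiffAt) (hu x) a b c
  have h2 : ∀ a b c e, Continuous (pd e (christoffel G a b c)) := fun a b c e =>
    continuous_iff_continuousAt.2 fun x =>
      (contDiffAt_pd (k := 0) (h1 a b c).contDiffAt (by simp) e).continuousAt
  unfold ricci riemann
  simp only [Matrix.of_apply]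
  refine continuous_finsetSum _ fun i _ => ?_
  refine ((h2 _ _ _ _).sub (h2 _ _ _ _)).add (continuous_finsetSum _ fun a _ => ?_)
  exact ((h1 _ _ _).continuous.mul (h1 _ _ _).continuous).sub
    ((h1 _ _ _).continuous.mul (h1 _ _ _).continuous)

lemma continuous_scalar (hC : ∀ i j, ContDiff ℝ ∞ (fun x => G x i j))
    (hu : ∀ x, IsUnit (G x).det) : Continuous (scalar G) := by
  unfold scalar
  refine continuous_finsetSum _ fun i _ => continuous_finsetSum _ fun j _ => ?_
  refine Continuous.mul ?_ (continuous_ricci_apply hC hu i j)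
  exact continuous_iff_continuousAt.2 fun x =>
    (contDiffAt_inv_apply (k := ∞) (fun i j => (hC i j).contDiffAt) (hu x) i j).continuousAt

end Coord

section ContinuitySphere

variable {n : ℕ} {G : Euc (n + 1) → Matrix (Fin (n + 1)) (Fin (n + 1)) ℝ}

namespace IsRadial

/-- The derivative along the ray is written through the differential of `det G` on the whole space,
so that the dependence on `θ` becomes visibly continuous. -/
lemma meanCurvature_eq (hC : ∀ i j, ContDiff ℝ ∞ (fun x => G x i j)) (θ : Euc (n + 1)) (s : ℝ) :
    meanCurvature G θ s = n / s + fderiv ℝ (fun x => (G x).det) (s • θ) θ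
      / (2 * (G (s • θ)).det) := by
  have hF : ContDiff ℝ ∞ fun x => (G x).det :=
    contDiff_iff_contDiffAt.2 fun x => contDiffAt_det fun i j => (hC i j).contDiffAt
  have h5 : HasDerivAt (fun τ : ℝ => τ • θ) θ s := by
    simpa using (hasDerivAt_id s).smul_const θ
  have h6 : HasDerivAt (radialDet G θ) (fderiv ℝ (fun x => (G x).det) (s • θ) θ) s :=
    HasFDerivAt.comp_hasDerivAt (l := fun x => (G x).det) s
      (hF.differentiable (by simp) (s • θ)).hasFDerivAt h5
  rw [meanCurvature, h6.deriv, radialDet]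

lemma deriv_meanCurvature_eq (hC : ∀ i j, ContDiff ℝ ∞ (fun x => G x i j))
    (hP : ∀ x, (G x).PosDef) (θ : Euc (n + 1)) {s : ℝ} (hs : s ≠ 0) :
    deriv (meanCurvature G θ) s = -n / s ^ 2 +
      (fderiv ℝ (fderiv ℝ fun x => (G x).det) (s • θ) θ θ * (2 * (G (s • θ)).det)
        - fderiv ℝ (fun x => (G x).det) (s • θ) θ
          * (2 * fderiv ℝ (fun x => (G x).det) (s • θ) θ)) / (2 * (G (s • θ)).det) ^ 2 := by
  have hF : ContDiff ℝ ∞ fun x => (G x).det :=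
    contDiff_iff_contDiffAt.2 fun x => contDiffAt_det fun i j => (hC i j).contDiffAt
  have h5 : HasDerivAt (fun τ : ℝ => τ • θ) θ s := by
    simpa using (hasDerivAt_id s).smul_const θ
  have h6 : HasDerivAt (fun τ : ℝ => (G (τ • θ)).det)
      (fderiv ℝ (fun x => (G x).det) (s • θ) θ) s :=
    HasFDerivAt.comp_hasDerivAt (l := fun x => (G x).det) s
      (hF.differentiable (by simp) (s • θ)).hasFDerivAt h5
  have hF' : ContDiff ℝ ∞ (fderiv ℝ fun x => (G x).det) := hF.fderiv_right (by simp)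
  have h7 : HasDerivAt (fun τ : ℝ => fderiv ℝ (fun x => (G x).det) (τ • θ) θ)
      (fderiv ℝ (fderiv ℝ fun x => (G x).det) (s • θ) θ θ) s := by
    have := ((hF'.differentiable (by simp) (s • θ)).hasFDerivAt.comp_hasDerivAt s h5).clm_apply
      (hasDerivAt_const s θ)
    simpa using this
  have h8 : HasDerivAt (fun τ : ℝ => (n : ℝ) / τ) (-n / s ^ 2) s := by
    have := (hasDerivAt_inv hs).const_mul (n : ℝ)
    refine this.congr_deriv ?_
    ring
  have h9 := h8.add (h7.div (h6.const_mul 2) (mul_ne_zero two_ne_zero (hP (s • θ)).det_pos.ne'))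
  rw [funext (meanCurvature_eq hC θ)]
  exact h9.deriv

/-- The definition uses a chart that changes with `θ`, so continuity cannot be read from it. The
Gauss equation expresses the same quantity by functions on the ambient space evaluated at `s θ` and
`θ`. -/
lemma continuous_scalar_sphMetric (hr : IsRadial G) (hC : ∀ i j, ContDiff ℝ ∞ (fun x => G x i j))
    (hP : ∀ x, (G x).PosDef) {s : ℝ} (hs : s ≠ 0) :
    Continuous fun θ : Sph n => scalar (sphMetric G θ s) (extChartAt (𝓡 n) θ θ) := by
  have hF : ContDiff ℝ ∞ fun x => (G x).det :=
    contDiff_iff_contDiffAt.2 fun x => contDiffAt_det fun i j => (hC i j).contDiffAt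
  have hF' : ContDiff ℝ ∞ (fderiv ℝ fun x => (G x).det) := hF.fderiv_right (by simp)
  have hF'' : ContDiff ℝ ∞ (fderiv ℝ (fderiv ℝ fun x => (G x).det)) := hF'.fderiv_right (by simp)
  have hu : ∀ x, IsUnit (G x).det := fun x => (hP x).det_pos.ne'.isUnit
  have hθ : Continuous fun θ : Sph n => (θ : Euc (n + 1)) := continuous_subtype_val
  have hsθ : Continuous fun θ : Sph n => s • (θ : Euc (n + 1)) := hθ.const_smul s
  have c0 := hF.continuous.comp hsθ
  have c1 := (hF'.continuous.comp hsθ).clm_apply hθ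
  have c2 := ((hF''.continuous.comp hsθ).clm_apply hθ).clm_apply hθ
  have cH : Continuous fun θ : Sph n => meanCurvature G θ s := by
    simp only [meanCurvature_eq hC]
    exact continuous_const.add (c1.div (continuous_const.mul c0) fun θ =>
      mul_ne_zero two_ne_zero (hP _).det_pos.ne')
  have cH' : Continuous fun θ : Sph n => deriv (meanCurvature G θ) s := by
    simp only [deriv_meanCurvature_eq hC hP _ hs]
    refine continuous_const.add (((c2.mul (continuous_const.mul c0)).sub
      (c1.mul (continuous_const.mul c1))).div ((continuous_const.mul c0).pow 2) fun θ =>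
      pow_ne_zero 2 (mul_ne_zero two_ne_zero (hP _).det_pos.ne'))
  have cR : Continuous fun θ : Sph n => form (ricci G) (s • (θ : Euc (n + 1))) θ θ := by
    simp only [form_apply]
    refine continuous_finsetSum _ fun i _ => continuous_finsetSum _ fun j _ => ?_
    have hi : ∀ i : Fin (n + 1), Continuous fun θ : Sph n => (θ : Euc (n + 1)) i := fun i =>
      (EuclideanSpace.proj i : Euc (n + 1) →L[ℝ] ℝ).continuous.comp hθ
    exact ((continuous_ricci_apply hC hu i j).comp hsθ).mul ((hi i).mul (hi j))
  simp only [fun θ : Sph n => hr.scalar_sphMetric hC hP θ hs]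
  exact ((((continuous_scalar hC hu).comp hsθ).add cH').sub cR).add (cH.pow 2)

end IsRadial

end ContinuitySphere

/-! ### Geodesic spheres of `M` and their rescaled metrics -/

lemma sphGram_euclideanForm {n : ℕ} (θ : Sph n) :
    sphGram (euclideanForm n) ((↑) : Sph n → Euc (n + 1)) θ = sphMetric (fun _ => 1) θ 1 := by
  ext y i j
  rw [sphMetric, pullGram, Matrix.of_apply, form_one (G := fun _ : Euc (n + 1) => 1) rfl,
    fderiv_smul_sphChart, one_smul]
  simp only [sphGram, gram, Matrix.of_apply, euclideanForm]
  rw [mfderiv_eq_fderiv]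
  rfl

lemma sphGram_metricForm {n : ℕ} {M : Type*} [TopologicalSpace M] [ChartedSpace (Euc (n + 1)) M]
    [RiemannianBundle (fun x : M => TangentSpace (𝓡 (n + 1)) x)]
    {Φ : Euc (n + 1) ≃ₘ^∞⟮𝓡 (n + 1), 𝓡 (n + 1)⟯ M} (t : ℝ) (θ : Sph n) :
    sphGram (metricForm (n + 1) M) (geodesicSphere Φ t) θ = sphMetric (poleGram Φ) θ t := by
  ext y i j
  have h := form_gram_eq (Φ := Φ) (u := geodesicSphere Φ t ∘ (extChartAt (𝓡 n) θ).symm)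
    (ψ := fun y => t • sphChart θ y) rfl
    (((contDiff_sphChart θ).differentiable (by simp) y).const_smul t)
    (EuclideanSpace.single i 1) (EuclideanSpace.single j 1)
  rw [form_single] at h
  exact h

section Spheres

variable {n : ℕ} {M : Type*} [MetricSpace M] [ChartedSpace (Euc (n + 1)) M]
  [IsManifold (𝓡 (n + 1)) ∞ M] [RiemannianBundle (fun x : M => TangentSpace (𝓡 (n + 1)) x)]
  [IsContMDiffRiemannianBundle (𝓡 (n + 1)) ∞ (Euc (n + 1))
    (fun x : M => TangentSpace (𝓡 (n + 1)) x)]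
  {p : M} {Φ : Euc (n + 1) ≃ₘ^∞⟮𝓡 (n + 1), 𝓡 (n + 1)⟯ M}

namespace IsPoleExp

/-- The Gauss lemma at the point `s v`, divided by `s`; at `s = 0` the isometry condition replaces
it. -/
lemma isRadial (h : IsPoleExp p Φ) : IsRadial (poleGram Φ) := by
  intro s v w
  rcases eq_or_ne s 0 with rfl | hs
  · rw [zero_smul]
    exact form_one h.isometric v w
  · have h1 := h.form_radial (s • v) w
    rw [map_smul, smul_apply, smul_eq_mul, real_inner_smul_left] at h1
    exact mul_left_cancel₀ hs h1

/-- The volume density of the geodesic spheres. -/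
lemma inducedVolume_metricForm (h : IsPoleExp p Φ) {t : ℝ} (ht : 0 < t) :
    inducedVolume (metricForm (n + 1) M) (geodesicSphere Φ t) =
      (sphMeasure n).withDensity fun θ => ENNReal.ofReal
        (t ^ n * Real.sqrt (radialDet (poleGram Φ) θ t)) := by
  unfold inducedVolume
  congr 1
  ext θ
  have hc := IsRadial.det_sphMetric_one_pos θ
  rw [sphGram_metricForm, sphGram_euclideanForm, h.isRadial.det_sphMetric, sphChart_center,
    mul_div_assoc, div_self hc.ne', mul_one, mul_comm 2 n, pow_mul,
    Real.sqrt_mul (by positivity), Real.sqrt_sq (by positivity)]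
  rfl

variable [IsRiemannianManifold (𝓡 (n + 1)) M]

lemma dist_geodesicSphere (h : IsPoleExp p Φ) {t : ℝ} (ht : 0 < t) (θ : Sph n) :
    dist p (geodesicSphere Φ t θ) = t := by
  rw [geodesicSphere, h.dist_eq_norm, norm_smul]
  simp [abs_of_pos ht]

lemma range_geodesicSphere (h : IsPoleExp p Φ) {t : ℝ} (ht : 0 < t) :
    Set.range (geodesicSphere Φ t) = {x | dist p x = t} := by
  ext x
  constructor
  · rintro ⟨θ, rfl⟩
    exact h.dist_geodesicSphere ht θ
  · intro hx
    obtain ⟨v, rfl⟩ := Φ.surjective x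
    have hv : ‖v‖ = t := by rw [← h.dist_eq_norm]; exact hx
    refine ⟨⟨t⁻¹ • v, ?_⟩, ?_⟩
    · rw [mem_sphere_zero_iff_norm, norm_smul, hv, norm_inv, Real.norm_of_nonneg ht.le,
        inv_mul_cancel₀ ht.ne']
    · rw [geodesicSphere, smul_smul, mul_inv_cancel₀ ht.ne', one_smul]
      rfl

/-- The conformal factor depends only on the distance to `p`, hence is constant on each sphere. -/
lemma sphGram_compactifiedForm (h : IsPoleExp p Φ) {t : ℝ} (ht : 0 < t) (θ : Sph n) :
    sphGram (compactifiedForm (n + 1) p) (geodesicSphere Φ t) θ =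
      fun y => (4 * Real.exp (-2 * t)) • sphMetric (poleGram Φ) θ t y := by
  rw [← sphGram_metricForm]
  ext y i j
  simp only [sphGram, gram, Matrix.of_apply, compactifiedForm, Function.comp_apply,
    h.dist_geodesicSphere ht, Matrix.smul_apply, smul_eq_mul]

lemma inducedScalar_compactifiedForm (h : IsPoleExp p Φ) {t : ℝ} (ht : 0 < t) (θ : Sph n) :
    inducedScalar (compactifiedForm (n + 1) p) (geodesicSphere Φ t) θ =
      Real.exp (2 * t) / 4 * scalar (sphMetric (poleGram Φ) θ t) (extChartAt (𝓡 n) θ θ) := by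
  rw [inducedScalar, h.sphGram_compactifiedForm ht, scalar_smul (by positivity), mul_inv,
    ← Real.exp_neg]
  ring_nf

lemma inducedVolume_compactifiedForm (h : IsPoleExp p Φ) {t : ℝ} (ht : 0 < t) :
    inducedVolume (compactifiedForm (n + 1) p) (geodesicSphere Φ t) =
      ENNReal.ofReal ((2 * Real.exp (-t)) ^ n) •
        inducedVolume (metricForm (n + 1) M) (geodesicSphere Φ t) := by
  unfold inducedVolume
  rw [← withDensity_smul' _ _ ENNReal.ofReal_ne_top]
  congr 1
  ext θ
  have hk : 4 * Real.exp (-2 * t) = (2 * Real.exp (-t)) ^ 2 := by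
    rw [mul_pow, ← Real.exp_nat_mul]; ring_nf
  rw [h.sphGram_compactifiedForm ht, Pi.smul_apply, smul_eq_mul,
    ← ENNReal.ofReal_mul (by positivity), sphGram_metricForm, Matrix.det_smul, Fintype.card_fin, hk,
    ← pow_mul, mul_comm 2 n, pow_mul, mul_div_assoc, Real.sqrt_mul (by positivity),
    Real.sqrt_sq (by positivity)]

end IsPoleExp

end Spheres

/-! ### Asymptotics and the estimates for the rescaled spheres -/

lemma exp_two_mul_div_sinh_sq {t : ℝ} (ht : 0 < t) :
    Real.exp (2 * t) / 4 / Real.sinh t ^ 2 = ((1 - Real.exp (-2 * t)) ^ 2)⁻¹ := by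
  have h1 : 2 * Real.sinh t = Real.exp t * (1 - Real.exp (-2 * t)) := by
    rw [mul_sub, ← Real.exp_add, Real.sinh_eq]; ring_nf
  have h2 : Real.exp (2 * t) = Real.exp t ^ 2 := by rw [← Real.exp_nat_mul]; norm_num
  have h3 : Real.sinh t ≠ 0 := (Real.sinh_pos_iff.2 ht).ne'
  have h4 : 1 - Real.exp (-2 * t) ≠ 0 := fun h => h3 (by rw [h] at h1; linarith)
  rw [div_div, h2, show 4 * Real.sinh t ^ 2 = (2 * Real.sinh t) ^ 2 by ring, h1, mul_pow]
  field_simp [Real.exp_ne_zero]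

lemma tendsto_exp_two_mul_div_sinh_sq :
    Tendsto (fun t : ℝ => Real.exp (2 * t) / 4 / Real.sinh t ^ 2) atTop (𝓝 1) := by
  have h0 : Tendsto (fun t : ℝ => Real.exp (-2 * t)) atTop (𝓝 0) :=
    Real.tendsto_exp_atBot.comp (tendsto_id.const_mul_atTop_of_neg (by norm_num))
  have h1 : Tendsto (fun t : ℝ => ((1 - Real.exp (-2 * t)) ^ 2)⁻¹) atTop (𝓝 1) := by
    simpa using ((h0.const_sub 1).pow 2).inv₀ (by norm_num)
  refine h1.congr' ?_
  filter_upwards [eventually_gt_atTop 0] with t ht using (exp_two_mul_div_sinh_sq ht).symm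

/-- Gives the error coefficient its sign, so that the volume multiplying it can be replaced by the
larger `ω_n`. -/
lemma one_le_exp_two_mul_div_sinh_sq {t : ℝ} (ht : 0 < t) :
    1 ≤ Real.exp (2 * t) / 4 / Real.sinh t ^ 2 := by
  have h1 : Real.exp (-2 * t) < 1 := Real.exp_lt_one_iff.2 (by linarith)
  have h2 := Real.exp_pos (-2 * t)
  rw [exp_two_mul_div_sinh_sq ht]
  exact (one_le_inv₀ (by nlinarith)).2 (by nlinarith)

instance (n : ℕ) : IsFiniteMeasure (sphMeasure n) := by unfold sphMeasure; infer_instance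

section Spheres

variable {n : ℕ} {M : Type*} [MetricSpace M] [ChartedSpace (Euc (n + 1)) M]
  [IsManifold (𝓡 (n + 1)) ∞ M]
  [RiemannianBundle (fun x : M => TangentSpace (𝓡 (n + 1)) x)]
  [IsContMDiffRiemannianBundle (𝓡 (n + 1)) ∞ (Euc (n + 1))
    (fun x : M => TangentSpace (𝓡 (n + 1)) x)]
  {p : M} {Φ : Euc (n + 1) ≃ₘ^∞⟮𝓡 (n + 1), 𝓡 (n + 1)⟯ M}

lemma continuous_scalarCurvature_geodesicSphere (t : ℝ) : Continuous fun θ : Sph n =>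
    scalarCurvature (metricForm (n + 1) M) (geodesicSphere Φ t θ) := by
  simp only [geodesicSphere, scalarCurvature_pole]
  exact (Coord.continuous_scalar contDiff_poleGram isUnit_det_poleGram).comp
    (continuous_subtype_val.const_smul t)

namespace IsPoleExp

variable [IsRiemannianManifold (𝓡 (n + 1)) M]

/-- The rescaled density relative to the round sphere is `(2e^{-t} f)^n`, and `2e^{-t} f ≤ 2e^{-t}
sinh t = 1 - e^{-2t}`. -/
lemma inducedVolume_compactifiedForm_le (h : IsPoleExp p Φ) (hn : 0 < n)
    (hric : RicciBoundedBelow (metricForm (n + 1) M) (-(n : ℝ))) {t : ℝ} (ht : 0 < t) :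
    inducedVolume (compactifiedForm (n + 1) p) (geodesicSphere Φ t) Set.univ ≤
      sphMeasure n Set.univ := by
  rw [h.inducedVolume_compactifiedForm ht, h.inducedVolume_metricForm ht,
    ← withDensity_smul' _ _ ENNReal.ofReal_ne_top, withDensity_apply _ MeasurableSet.univ,
    Measure.restrict_univ]
  calc _ ≤ ∫⁻ _ : Sph n, 1 ∂(sphMeasure n) := lintegral_mono fun θ => ?_
    _ = _ := by rw [lintegral_const, one_mul]
  have hP : ∀ x, (poleGram Φ x).PosDef := posDef_poleGram
  have hb := (h.isRadial.meanCurvature_bounds contDiff_poleGram hP hn (ricci_pole_ge hric) θ ht).2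
  rw [Pi.smul_apply, smul_eq_mul, ← ENNReal.ofReal_mul (by positivity), ENNReal.ofReal_le_one,
    ← IsRadial.radialRoot_pow hP hn, ← mul_pow]
  have hpos := IsRadial.radialRoot_pos hP (θ : Euc (n + 1)) ht
  refine pow_le_one₀ (by positivity) ?_
  calc _ ≤ 2 * Real.exp (-t) * Real.sinh t := by gcongr
    _ = 1 - Real.exp (-t) * Real.exp (-t) := by
      rw [Real.sinh_eq, show ∀ a b : ℝ, 2 * a * ((b - a) / 2) = a * b - a * a by intros; ring,
        ← Real.exp_add, neg_add_cancel, Real.exp_zero]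
    _ ≤ 1 := sub_le_self _ (by positivity)

lemma isFiniteMeasure_inducedVolume_compactifiedForm (h : IsPoleExp p Φ) (hn : 0 < n)
    (hric : RicciBoundedBelow (metricForm (n + 1) M) (-(n : ℝ))) {t : ℝ} (ht : 0 < t) :
    IsFiniteMeasure (inducedVolume (compactifiedForm (n + 1) p) (geodesicSphere Φ t)) :=
  ⟨(h.inducedVolume_compactifiedForm_le hn hric ht).trans_lt (measure_lt_top _ _)⟩

lemma inducedScalar_compactifiedForm_le (h : IsPoleExp p Φ) (hn : 0 < n)
    (hric : RicciBoundedBelow (metricForm (n + 1) M) (-(n : ℝ))) {t : ℝ} (ht : 0 < t)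
    (θ : Sph n) :
    inducedScalar (compactifiedForm (n + 1) p) (geodesicSphere Φ t) θ ≤
      Real.exp (2 * t) / 4 *
          |scalarCurvature (metricForm (n + 1) M) (geodesicSphere Φ t θ) + n * (n + 1)| +
        n * (n - 1) * (Real.exp (2 * t) / 4 / Real.sinh t ^ 2) := by
  have h1 := h.isRadial.scalar_sphMetric_le contDiff_poleGram posDef_poleGram hn
    (ricci_pole_ge hric) θ ht
  rw [h.inducedScalar_compactifiedForm ht, geodesicSphere, scalarCurvature_pole]
  calc _ ≤ Real.exp (2 * t) / 4 * (|scalar (poleGram Φ) (t • (θ : Euc (n + 1))) + n * (n + 1)| +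
        n * (n - 1) / Real.sinh t ^ 2) := by
        gcongr
        exact h1.trans (by gcongr; exact le_abs_self _)
    _ = _ := by ring

lemma continuous_inducedScalar_compactifiedForm (h : IsPoleExp p Φ) {t : ℝ} (ht : 0 < t) :
    Continuous (inducedScalar (compactifiedForm (n + 1) p) (geodesicSphere Φ t)) := by
  rw [show inducedScalar (compactifiedForm (n + 1) p) (geodesicSphere Φ t) = _ from
    funext fun θ => h.inducedScalar_compactifiedForm ht θ]
  exact continuous_const.mul
    (h.isRadial.continuous_scalar_sphMetric contDiff_poleGram posDef_poleGram ht.ne')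

/-- The rescaled volume is a constant multiple of the original one, so averages agree for both. The
pointwise bound is integrated, and the integral is the average times the volume. -/
lemma integral_inducedScalar_le (h : IsPoleExp p Φ) (hn : 0 < n)
    (hric : RicciBoundedBelow (metricForm (n + 1) M) (-(n : ℝ))) {t : ℝ} (ht : 0 < t) :
    ∫ θ, inducedScalar (compactifiedForm (n + 1) p) (geodesicSphere Φ t) θ
        ∂(inducedVolume (compactifiedForm (n + 1) p) (geodesicSphere Φ t)) ≤
      (Real.exp (2 * t) / 4 *
          (⨍ θ, |scalarCurvature (metricForm (n + 1) M) (geodesicSphere Φ t θ) + n * (n + 1)|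
            ∂(inducedVolume (metricForm (n + 1) M) (geodesicSphere Φ t))) +
        n * (n - 1) * (Real.exp (2 * t) / 4 / Real.sinh t ^ 2)) *
      (inducedVolume (compactifiedForm (n + 1) p) (geodesicSphere Φ t)).real Set.univ := by
  have hfin := h.isFiniteMeasure_inducedVolume_compactifiedForm hn hric ht
  have havg : ⨍ θ, |scalarCurvature (metricForm (n + 1) M) (geodesicSphere Φ t θ) + n * (n + 1)|
        ∂(inducedVolume (metricForm (n + 1) M) (geodesicSphere Φ t)) =
      ⨍ θ, |scalarCurvature (metricForm (n + 1) M) (geodesicSphere Φ t θ) + n * (n + 1)|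
        ∂(inducedVolume (compactifiedForm (n + 1) p) (geodesicSphere Φ t)) := by
    have hc : ENNReal.ofReal ((2 * Real.exp (-t)) ^ n) ≠ 0 := by
      rw [Ne, ENNReal.ofReal_eq_zero, not_le]; positivity
    rw [h.inducedVolume_compactifiedForm ht, average, average, Measure.smul_apply, smul_smul,
      smul_eq_mul, ENNReal.mul_inv (Or.inl hc) (Or.inl ENNReal.ofReal_ne_top), mul_right_comm,
      ENNReal.inv_mul_cancel hc ENNReal.ofReal_ne_top, one_mul]
  rw [havg]
  set ν := inducedVolume (compactifiedForm (n + 1) p) (geodesicSphere Φ t) with hν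
  have hcont : Continuous fun θ : Sph n =>
      |scalarCurvature (metricForm (n + 1) M) (geodesicSphere Φ t θ) + n * (n + 1)| :=
    ((continuous_scalarCurvature_geodesicSphere t).add_const _).abs
  have hint : ∀ f : Sph n → ℝ, Continuous f → Integrable f ν := fun f hf =>
    hf.integrable_of_hasCompactSupport (HasCompactSupport.of_compactSpace f)
  calc _ ≤ ∫ θ, (Real.exp (2 * t) / 4 *
          |scalarCurvature (metricForm (n + 1) M) (geodesicSphere Φ t θ) + n * (n + 1)| +
        n * (n - 1) * (Real.exp (2 * t) / 4 / Real.sinh t ^ 2)) ∂ν :=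
        integral_mono (hint _ (h.continuous_inducedScalar_compactifiedForm ht))
          (hint _ ((continuous_const.mul hcont).add continuous_const))
          (h.inducedScalar_compactifiedForm_le hn hric ht)
    _ = _ := by
      rw [integral_add ((hint _ hcont).const_mul _) (integrable_const _), integral_const_mul,
        integral_const, ← measure_smul_average, smul_eq_mul, smul_eq_mul]
      ring

end IsPoleExp

end Spheres

theorem mainTheorem3 (n : ℕ) (hn : 3 ≤ n) (k : ℕ∞)
    (M : Type*) [MetricSpace M] [ChartedSpace (Euc (n + 1)) M]
    [IsManifold (𝓡 (n + 1)) ∞ M]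
    [RiemannianBundle (fun x : M => TangentSpace (𝓡 (n + 1)) x)]
    [IsContMDiffRiemannianBundle (𝓡 (n + 1)) ∞ (Euc (n + 1))
      (fun x : M => TangentSpace (𝓡 (n + 1)) x)]
    [IsRiemannianManifold (𝓡 (n + 1)) M] [CompleteSpace M]
    (hcc : IsConformallyCompact n k M)
    (p : M) (Φ : Euc (n + 1) ≃ₘ^∞⟮𝓡 (n + 1), 𝓡 (n + 1)⟯ M) (hpole : IsPoleExp p Φ)
    (hric : RicciBoundedBelow (metricForm (n + 1) M) (-(n : ℝ)))
    (hscal : (fun t : ℝ =>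
        ⨍ θ, |scalarCurvature (metricForm (n + 1) M) (geodesicSphere Φ t θ) + n * (n + 1)|
          ∂(inducedVolume (metricForm (n + 1) M) (geodesicSphere Φ t)))
      =o[atTop] (fun t : ℝ => Real.exp (-2 * t))) :
    -- the hypersurfaces parametrized by `geodesicSphere Φ t` are the level sets of the distance
    (∀ t : ℝ, 0 < t → Set.range (geodesicSphere Φ t) = {x | dist p x = t}) ∧
    -- total scalar curvature of the level sets
    (∀ t : ℝ, 0 < t → Integrable
      (inducedScalar (compactifiedForm (n + 1) p) (geodesicSphere Φ t))
      (inducedVolume (compactifiedForm (n + 1) p) (geodesicSphere Φ t))) ∧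
    (∀ ε : ℝ, 0 < ε → ∀ᶠ t : ℝ in atTop,
      ∫ θ, inducedScalar (compactifiedForm (n + 1) p) (geodesicSphere Φ t) θ
          ∂(inducedVolume (compactifiedForm (n + 1) p) (geodesicSphere Φ t))
        ≤ n * (n - 1) *
            (inducedVolume (compactifiedForm (n + 1) p) (geodesicSphere Φ t)).real Set.univ + ε) ∧
    -- volume of the level sets
    (∀ t : ℝ, 0 < t →
      inducedVolume (compactifiedForm (n + 1) p) (geodesicSphere Φ t) Set.univ
        ≤ sphMeasure n Set.univ) ∧
    -- pointwise decay
    ((fun x : M => scalarCurvature (metricForm (n + 1) M) x + n * (n + 1))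
        =o[comap (fun x : M => dist p x) atTop] (fun x : M => Real.exp (-2 * dist p x)) →
      ∀ ε : ℝ, 0 < ε → ∀ᶠ t : ℝ in atTop, ∀ θ : Sph n,
        inducedScalar (compactifiedForm (n + 1) p) (geodesicSphere Φ t) θ
          ≤ n * (n - 1) + ε) := by
  have hn0 : 0 < n := by omega
  have hn1 : (0 : ℝ) ≤ n * (n - 1) := by
    have : (3 : ℝ) ≤ n := by exact_mod_cast hn
    nlinarith
  refine ⟨fun t ht => hpole.range_geodesicSphere ht, fun t ht => ?_, fun ε hε => ?_,
    fun t ht => hpole.inducedVolume_compactifiedForm_le hn0 hric ht, fun hdec ε hε => ?_⟩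
  · have := hpole.isFiniteMeasure_inducedVolume_compactifiedForm hn0 hric ht
    exact (hpole.continuous_inducedScalar_compactifiedForm ht).integrable_of_hasCompactSupport
      (HasCompactSupport.of_compactSpace _)
  -- The excess over `n(n-1) Vol`, with `ω_n` in place of the volume: the hypothesis kills the first
  -- summand and `κ → 1` the second.
  · have hlim : Tendsto (fun t : ℝ => (Real.exp (2 * t) / 4 *
          (⨍ θ, |scalarCurvature (metricForm (n + 1) M) (geodesicSphere Φ t θ) + n * (n + 1)|
            ∂(inducedVolume (metricForm (n + 1) M) (geodesicSphere Φ t))) +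
          n * (n - 1) * (Real.exp (2 * t) / 4 / Real.sinh t ^ 2 - 1)) *
        (sphMeasure n).real Set.univ) atTop (𝓝 0) := by
      have h1 := hscal.tendsto_div_nhds_zero.div_const 4
      have h2 := (tendsto_exp_two_mul_div_sinh_sq.sub_const 1).const_mul ((n : ℝ) * (n - 1))
      have h3 := (h1.add h2).mul_const ((sphMeasure n).real Set.univ)
      simp only [zero_div, sub_self, mul_zero, add_zero, zero_mul] at h3
      refine h3.congr fun t => ?_
      rw [show Real.exp (-2 * t) = (Real.exp (2 * t))⁻¹ by rw [← Real.exp_neg]; ring_nf,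
        div_inv_eq_mul]
      ring
    filter_upwards [hlim.eventually (gt_mem_nhds hε), eventually_gt_atTop 0] with t hlt ht
    have hfin := hpole.isFiniteMeasure_inducedVolume_compactifiedForm hn0 hric ht
    have hV : (inducedVolume (compactifiedForm (n + 1) p) (geodesicSphere Φ t)).real Set.univ ≤
        (sphMeasure n).real Set.univ :=
      ENNReal.toReal_mono (measure_ne_top _ _)
        (hpole.inducedVolume_compactifiedForm_le hn0 hric ht)
    have hA : 0 ≤ ⨍ θ, |scalarCurvature (metricForm (n + 1) M) (geodesicSphere Φ t θ) +
        n * (n + 1)| ∂(inducedVolume (metricForm (n + 1) M) (geodesicSphere Φ t)) :=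
      integral_nonneg fun θ => abs_nonneg _
    have hκ := sub_nonneg.2 (one_le_exp_two_mul_div_sinh_sq ht)
    refine (hpole.integral_inducedScalar_le hn0 hric ht).trans ?_
    have hmono := mul_le_mul_of_nonneg_left hV
      (add_nonneg (mul_nonneg (by positivity : 0 ≤ Real.exp (2 * t) / 4) hA)
        (mul_nonneg hn1 hκ))
    linarith
  -- The curvature term contributes at most `ε/4` after rescaling, and `κ → 1` leaves an error below
  -- `ε/2`.
  · have hbound := hdec.bound hε
    rw [eventually_comap] at hbound
    have hlim := (tendsto_exp_two_mul_div_sinh_sq.const_mul ((n : ℝ) * (n - 1))).eventually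
      (gt_mem_nhds (show (n : ℝ) * (n - 1) * 1 < n * (n - 1) + ε / 2 by linarith))
    filter_upwards [hbound, hlim, eventually_gt_atTop 0] with t hb hκ ht θ
    have hd := hpole.dist_geodesicSphere ht θ
    have hR := hb _ hd
    rw [Real.norm_eq_abs, hd, Real.norm_of_nonneg (Real.exp_pos _).le] at hR
    refine (hpole.inducedScalar_compactifiedForm_le hn0 hric ht θ).trans ?_
    have h1 := mul_le_mul_of_nonneg_left hR (by positivity : 0 ≤ Real.exp (2 * t) / 4)
    have h2 : Real.exp (2 * t) / 4 * (ε * Real.exp (-2 * t)) = ε / 4 := by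
      rw [show ∀ a b : ℝ, a / 4 * (ε * b) = ε / 4 * (a * b) by intros; ring, ← Real.exp_add]
      simp
    linarith

end
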